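/- Fix $r>0$. A convex $r$-disc-polygon is a compact convex set $P\subset\mathbb{R}^2$ with non-empty interior whose boundary is the union of finitely many circular arcs of radius $r$. The $r$-hull $[X]_r$ of a set $X\subset\mathbb{R}^2$ is the intersection of all closed discs of radius $r$ that contain $X$. For a convex $r$-disc-polygon or the $r$-hull of finitely many points, let $f_0$ denote its number of vertices, that is, of points at which its outer unit normal vector is not unique. Theorem 1. Let $P$ be a convex $r$-disc-polygon, let $x_1,\dots,x_n$ be independent random points, each uniformly distributed in $P$, and let $P_n^r=[\{x_1,\dots,x_n\}]_r$. Then, for every $n$, the random variables $f_0(P_n^r)$ and $\mathrm{area}(P\setminus P_n^r)$ are integrable, and $$\lim_{n\to\infty}\frac{\mathbb{E}\,f_0(P_n^r)}{\ln n}=\frac23\,f_0(P)$$ and $$\lim_{n\to\infty}\frac{n\,\mathbb{E}\,\mathrm{area}(P\setminus P_n^r)}{\ln n}=\frac23\,f_0(P)\,\mathrm{area}(P).$$ -/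

import Mathlib

open MeasureTheory

noncomputable section

/-- The Euclidean plane. -/
abbrev Plane : Type := EuclideanSpace ℝ (Fin 2)

/-- The closed arc of the circle with centre `c` and radius `r` that is swept out when the polar
angle runs from `α` to `β`. -/
def circularArc (c : Plane) (r α β : ℝ) : Set Plane :=
  (fun θ : ℝ => c + r • !₂[Real.cos θ, Real.sin θ]) '' Set.Icc α β

/-- A convex `r`-disc-polygon: a compact convex set in the plane, with non-empty interior, that is
bounded by a finite number of circular arcs of radius `r`. -/
structure IsDiscPolygon (r : ℝ) (P : Set Plane) : Prop where
  isCompact : IsCompact P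
  convex : Convex ℝ P
  interior_nonempty : (interior P).Nonempty
  frontier_eq : ∃ (m : ℕ) (c : Fin m → Plane) (α β : Fin m → ℝ),
    frontier P = ⋃ i, circularArc (c i) r (α i) (β i)

/-- The `r`-hull of `X`: the intersection of all closed discs of radius `r` that contain `X`. -/
def rHull (r : ℝ) (X : Set Plane) : Set Plane :=
  ⋂ c ∈ {c : Plane | X ⊆ Metric.closedBall c r}, Metric.closedBall c r

/-- The outer unit normal vectors of `K` at the point `x`. -/
def outerNormals (K : Set Plane) (x : Plane) : Set Plane :=
  {u | ‖u‖ = 1 ∧ ∀ y ∈ K, inner ℝ u (y - x) ≤ 0}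

/-- The vertices of a convex disc-polygon: its points at which the outer unit normal vector is not
unique, that is, the points where arcs of two different circles meet. The only vertex of a
one-point set is its point, and a full disc has no vertex. -/
def vertices (K : Set Plane) : Set Plane :=
  {x | x ∈ K ∧ (outerNormals K x).Nontrivial}

/-- The number of vertices. -/
def f₀ (K : Set Plane) : ℕ := (vertices K).ncard

/-- The area (two-dimensional Lebesgue measure). -/
def area (S : Set Plane) : ℝ := (volume S).toReal

/-- The law of `n` independent uniform random points in `P`. -/
def uniformSample (P : Set Plane) (n : ℕ) : Measure (Fin n → Plane) :=
  Measure.pi fun _ => ProbabilityTheory.cond volume P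

end

/-! Both expectations reduce to one number, `missProb`: the probability that a uniform point of `P`
is missed by the `r`-hull of `m` others. Almost surely the vertices of the hull of `n` points are
the points missed by the hull of the rest, so `E f₀` is `n` times this probability with `m = n - 1`.
The mean missed area is `area P` times it with `m = n` (`integral_f₀`, `integral_area`).

A point `y` missed by a sample in general position has exactly one first hull edge: one sample point
`z` such that the disc `D` of radius `r` with short counterclockwise boundary arc from `y` to `z`
contains the whole sample (`exists_unique_arcCentre`, `notMem_rHull_of_arcCentre`). Hence for `m +
1` sample points the probability is `(m + 1) ∫∫ μ(D)^m` over pairs `(y, z)` (`measure_missSet`). For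
a fixed chord `z - y` the centre of `D` is a translate of `y`, so this becomes an integral over
centres `c` of `μ(D_c)^m` times the measure of the chords of the circle around `c` with both ends in
`P` (`lintegral_pairs`). It remains to find the asymptotics of the integral of `edgeDensity`.

By Blaschke's rolling theorem `P` lies in every disc of radius `r` that touches it at a boundary
point with the same outer normal. Hence every relevant centre is a touching centre in some direction
`φ`, pulled back by some `l ≥ 0`. Away from the vertices there are only finitely many touching
centres, the cap cut off has area at least a constant times `l`, and the contribution is `O(N⁻²)`.
At a vertex `v` the normals fill an arc and `c = v - (r + l) u(φ)`, where `u(φ)` is the unit vector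
at angle `φ`. If `φ` is at a small angle `η` from an end of that arc and `l` is small against `η`,
the circle around `c` meets `P` in an arc of angle about `l / (r η)`. So the cap has area about `l²
/ (2 η)` and the chords have measure about `l³ / (6 r η³)`. With `a = N / area P` the contribution
is ∫∫ r · l³ / (6 r η³) · exp(-a l² / (2 η)) dl dη ≈ ∫ dη / (3 a² η) ≈ log a / (3 a²), where the
last integral is cut off at `η` of order `1 / a`. Each vertex has two such ends, which gives `2/3`
per vertex; all other regimes are `O(a⁻²)` (`corner_integral_le`, `le_corner_integral`). The
estimates hold up to a factor `k > 1`, and `k` tends to `1` at the end (`tendsto_of_log_bounds`). -/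

noncomputable section

/-! ### Unit vectors, frames and polar coordinates in the plane -/

/-- The unit vector with polar angle `θ`. -/
def unitVec (θ : ℝ) : Plane := !₂[Real.cos θ, Real.sin θ]

@[simp] lemma unitVec_zero_coord (θ : ℝ) : unitVec θ 0 = Real.cos θ := rfl

@[simp] lemma unitVec_one_coord (θ : ℝ) : unitVec θ 1 = Real.sin θ := rfl

lemma Plane.inner_eq (x y : Plane) : inner ℝ x y = x 0 * y 0 + x 1 * y 1 := by
  simp [PiLp.inner_apply, Fin.sum_univ_two, mul_comm]

lemma Plane.ext' {x y : Plane} (h0 : x 0 = y 0) (h1 : x 1 = y 1) : x = y := by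
  ext i; fin_cases i <;> assumption

lemma inner_unitVec (a b : ℝ) : inner ℝ (unitVec a) (unitVec b) = Real.cos (a - b) := by
  simp [Plane.inner_eq, Real.cos_sub]

@[simp] lemma norm_unitVec (a : ℝ) : ‖unitVec a‖ = 1 := by
  have h := real_inner_self_eq_norm_sq (unitVec a)
  rw [inner_unitVec, sub_self, Real.cos_zero] at h
  nlinarith [norm_nonneg (unitVec a)]

@[fun_prop] lemma continuous_unitVec : Continuous unitVec := by
  unfold unitVec; fun_prop

lemma unitVec_add_pi (a : ℝ) : unitVec (a + Real.pi) = -unitVec a := by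
  apply Plane.ext' <;> simp

@[simp] lemma unitVec_add_two_pi (a : ℝ) : unitVec (a + 2 * Real.pi) = unitVec a := by
  apply Plane.ext' <;> simp

@[simp] lemma unitVec_sub_two_pi (a : ℝ) : unitVec (a - 2 * Real.pi) = unitVec a := by
  apply Plane.ext' <;> simp

lemma unitVec_add (a t : ℝ) :
    unitVec (a + t) = Real.cos t • unitVec a + Real.sin t • unitVec (a + Real.pi / 2) := by
  apply Plane.ext' <;> simp [Real.cos_add, Real.sin_add] <;> ring

lemma exists_unitVec_eq {u : Plane} (hu : ‖u‖ = 1) :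
    ∃ θ ∈ Set.Ioc (-Real.pi) Real.pi, unitVec θ = u := by
  have h : u 0 ^ 2 + u 1 ^ 2 = 1 := by
    have := EuclideanSpace.norm_sq_eq u
    rw [hu] at this
    simp [Fin.sum_univ_two] at this
    linarith
  set z : ℂ := ⟨u 0, u 1⟩
  have hz : ‖z‖ = 1 := by
    rw [← Real.sqrt_one, ← h, Complex.norm_eq_sqrt_sq_add_sq]
  have hz0 : z ≠ 0 := by rintro h0; simp [h0] at hz
  refine ⟨z.arg, Complex.arg_mem_Ioc z, Plane.ext' ?_ ?_⟩
  · simp [Complex.cos_arg hz0, hz, z]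
  · simp [Complex.sin_arg, hz, z]

lemma exists_eq_norm_smul_unitVec (x : Plane) :
    ∃ θ ∈ Set.Ioc (-Real.pi) Real.pi, x = ‖x‖ • unitVec θ := by
  by_cases hx : x = 0
  · exact ⟨0, by constructor <;> linarith [Real.pi_pos], by simp [hx]⟩
  · obtain ⟨θ, hθ, h⟩ := exists_unitVec_eq (u := ‖x‖⁻¹ • x) (norm_smul_inv_norm hx)
    exact ⟨θ, hθ, by rw [h, smul_inv_smul₀ (norm_ne_zero_iff.2 hx)]⟩

lemma unitVec_eq_iff {a b : ℝ} : unitVec a = unitVec b ↔ Real.cos (a - b) = 1 := by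
  constructor
  · intro h
    rw [← inner_unitVec, h, inner_unitVec]; simp
  · intro h
    have := inner_unitVec a b
    rw [h] at this
    exact (inner_eq_one_iff_of_norm_eq_one (norm_unitVec a) (norm_unitVec b)).1 this

lemma exists_int_of_unitVec_eq {a b : ℝ} (h : unitVec a = unitVec b) :
    ∃ k : ℤ, a = b + k * (2 * Real.pi) := by
  obtain ⟨k, hk⟩ := (Real.cos_eq_one_iff _).1 (unitVec_eq_iff.1 h)
  exact ⟨k, by linarith⟩

lemma unitVec_add_int_mul (a : ℝ) (k : ℤ) : unitVec (a + k * (2 * Real.pi)) = unitVec a := by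
  rw [unitVec_eq_iff]
  simp [Real.cos_int_mul_two_pi]

/-- The isometry of the plane that takes the coordinate frame to the frame at angle `φ`. -/
def Plane.rotation (φ : ℝ) : Plane →ₗᵢ[ℝ] Plane where
  toFun x := x 0 • unitVec φ + x 1 • unitVec (φ + Real.pi / 2)
  map_add' x y := by simp [add_smul]; abel
  map_smul' a x := by simp [mul_smul]
  norm_map' x := by
    have := Real.sin_sq_add_cos_sq φ
    simp only [LinearMap.coe_mk, AddHom.coe_mk]
    rw [EuclideanSpace.norm_eq, EuclideanSpace.norm_eq]
    congr 1
    simp [Fin.sum_univ_two, Real.cos_add_pi_div_two, Real.sin_add_pi_div_two]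
    linear_combination (x 0 ^ 2 + x 1 ^ 2) * this

lemma Plane.measurePreserving_rotation (c : Plane) (φ : ℝ) :
    MeasurePreserving (fun x : Plane => c + Plane.rotation φ x) volume volume := by
  have h1 := (LinearIsometry.toLinearIsometryEquiv (Plane.rotation φ) rfl).measurePreserving
  exact (measurePreserving_add_left volume c).comp h1

/-- Fubini's theorem in the orthonormal frame at angle `φ` around `c`. -/
lemma lintegral_frame (c : Plane) (φ : ℝ) {f : Plane → ENNReal} (hf : Measurable f) :
    ∫⁻ x, f x = ∫⁻ p : ℝ × ℝ, f (c + p.1 • unitVec φ + p.2 • unitVec (φ + Real.pi / 2)) := by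
  rw [← (Plane.measurePreserving_rotation c φ).lintegral_comp hf,
    ← (EuclideanSpace.volume_preserving_symm_measurableEquiv_toLp (Fin 2)).symm.lintegral_comp
      (by fun_prop),
    ← (volume_preserving_finTwoArrow ℝ).symm.lintegral_comp (by fun_prop)]
  refine lintegral_congr fun p => ?_
  simp [Plane.rotation, MeasurableEquiv.finTwoArrow, add_assoc]

/-- Polar coordinates around `c`, with angles measured from `φ`. -/
lemma lintegral_polar (c : Plane) (φ : ℝ) {f : Plane → ENNReal} (hf : Measurable f) :
    ∫⁻ x, f x = ∫⁻ t in Set.Ioo (-Real.pi) Real.pi, ∫⁻ ρ in Set.Ioi (0 : ℝ),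
      ENNReal.ofReal ρ * f (c + ρ • unitVec (φ + t)) := by
  rw [lintegral_frame c φ hf, ← lintegral_comp_polarCoord_symm]
  rw [polarCoord_target, Measure.volume_eq_prod, ← Measure.prod_restrict, lintegral_prod_symm]
  · refine lintegral_congr fun t => lintegral_congr fun ρ => ?_
    rw [unitVec_add φ t]
    simp [polarCoord_symm_apply, mul_smul, add_assoc, smul_add]
  · apply Measurable.aemeasurable
    simp only [polarCoord_symm_apply]
    fun_prop

/-! ### Support points and touching discs -/

lemma finite_line_inter_sphere (a b c : Plane) (hb : b ≠ 0) (r : ℝ) :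
    {t : ℝ | ‖a + t • b - c‖ = r}.Finite := by
  rcases Set.eq_empty_or_nonempty {t : ℝ | ‖a + t • b - c‖ = r} with h | ⟨t₁, h₁⟩
  · rw [h]; exact Set.finite_empty
  have key : ∀ t : ℝ, ‖a + t • b - c‖ = r →
      ‖a - c‖ ^ 2 + 2 * (t * inner ℝ (a - c) b) + t ^ 2 * ‖b‖ ^ 2 = r ^ 2 := by
    intro t ht
    rw [← ht, show a + t • b - c = (a - c) + t • b by abel, norm_add_sq_real, inner_smul_right,
      norm_smul, mul_pow, Real.norm_eq_abs, sq_abs]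
  have hb' : ‖b‖ ^ 2 ≠ 0 := by simpa using hb
  -- Given one root of the quadratic equation, Vieta's formula yields the other.
  refine (Set.toFinite {t₁, -(2 * inner ℝ (a - c) b) / ‖b‖ ^ 2 - t₁}).subset fun t ht => ?_
  have e₁ := key t₁ h₁
  have e := key t ht
  have : (t - t₁) * ((t + t₁) * ‖b‖ ^ 2 + 2 * inner ℝ (a - c) b) = 0 := by linear_combination e - e₁
  rcases mul_eq_zero.1 this with h | h
  · left; linarith
  · right
    rw [Set.mem_singleton_iff]
    field_simp
    linear_combination h

lemma circularArc_subset_sphere (c : Plane) {r : ℝ} (hr : 0 < r) (α β : ℝ) :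
    circularArc c r α β ⊆ {x | ‖x - c‖ = r} := by
  rintro _ ⟨θ, -, rfl⟩
  have := norm_unitVec θ
  simp only [unitVec] at this
  simp [norm_smul, this, abs_of_pos hr]

/-- `x` is a point of `P` that is extremal in direction `θ`. -/
def IsSupportPoint (P : Set Plane) (θ : ℝ) (x : Plane) : Prop :=
  x ∈ P ∧ ∀ y ∈ P, inner ℝ (unitVec θ) (y - x) ≤ 0

lemma IsSupportPoint.notMem_interior {P : Set Plane} {θ : ℝ} {x : Plane}
    (h : IsSupportPoint P θ x) : x ∉ interior P := by
  intro hx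
  have hc : ContinuousAt (fun t : ℝ => x + t • unitVec θ) 0 := by fun_prop
  have := hc.preimage_mem_nhds (t := P) (by simpa using mem_interior_iff_mem_nhds.1 hx)
  obtain ⟨ε, hε, hb⟩ := Metric.mem_nhds_iff.1 this
  have := h.2 _ (hb (show ε / 2 ∈ Metric.ball 0 ε by
    simp [abs_of_pos hε, hε]))
  simp [inner_smul_right] at this
  linarith

namespace IsDiscPolygon

variable {r : ℝ} {P : Set Plane}

/-- Strict convexity of `P`: a line meets each of the finitely many boundary circles in a finite
set, and a segment is infinite. -/
lemma not_segment_subset_frontier (hP : IsDiscPolygon r P) (hr : 0 < r) {a b : Plane}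
    (hab : a ≠ b) : ¬ segment ℝ a b ⊆ frontier P := by
  intro h
  obtain ⟨m, c, α, β, hf⟩ := hP.frontier_eq
  have hfin : (⋃ i, {t : ℝ | ‖a + t • (b - a) - c i‖ = r}).Finite :=
    Set.finite_iUnion fun i => finite_line_inter_sphere a (b - a) (c i) (sub_ne_zero.2 hab.symm) r
  refine (Set.Icc_infinite (zero_lt_one' ℝ)) (hfin.subset fun t ht => ?_)
  have : a + t • (b - a) ∈ frontier P := h (by
    rw [segment_eq_image']; exact ⟨t, ht, rfl⟩)
  rw [hf, Set.mem_iUnion] at this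
  obtain ⟨i, hi⟩ := this
  exact Set.mem_iUnion.2 ⟨i, circularArc_subset_sphere _ hr _ _ hi⟩

lemma frontier_of_isSupportPoint {θ : ℝ} {x : Plane}
    (h : IsSupportPoint P θ x) : x ∈ frontier P :=
  ⟨subset_closure h.1, h.notMem_interior⟩

/-- The segment between two extremal points in one direction would consist of extremal points, hence
lie in the frontier. -/
lemma isSupportPoint_unique (hP : IsDiscPolygon r P) (hr : 0 < r) {θ : ℝ} {x y : Plane}
    (hx : IsSupportPoint P θ x) (hy : IsSupportPoint P θ y) : x = y := by
  by_contra hne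
  refine hP.not_segment_subset_frontier hr hne ?_
  rintro z ⟨a, b, ha, hb, hab, rfl⟩
  refine frontier_of_isSupportPoint (θ := θ) ⟨hP.convex hx.1 hy.1 ha hb hab, fun w hw => ?_⟩
  have h1 := hx.2 w hw
  have h2 := hy.2 w hw
  have : w - (a • x + b • y) = a • (w - x) + b • (w - y) := by
    have : w = (a + b) • w := by rw [hab, one_smul]
    nth_rewrite 1 [this]
    module
  rw [this, inner_add_right, inner_smul_right, inner_smul_right]
  nlinarith

lemma exists_isSupportPoint (hP : IsDiscPolygon r P) (θ : ℝ) : ∃ x, IsSupportPoint P θ x := by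
  obtain ⟨x, hx, h⟩ := hP.isCompact.exists_isMaxOn (hP.interior_nonempty.mono interior_subset)
    (f := fun x => inner ℝ (unitVec θ) x) (by fun_prop)
  refine ⟨x, hx, fun y hy => ?_⟩
  rw [inner_sub_right]
  exact sub_nonpos.2 (h hy)

end IsDiscPolygon

/-- The extremal point of `P` in direction `θ`. -/
def supportPoint (P : Set Plane) (θ : ℝ) : Plane := Classical.epsilon (IsSupportPoint P θ)

namespace IsDiscPolygon

variable {r : ℝ} {P : Set Plane}

lemma isSupportPoint (hP : IsDiscPolygon r P) (θ : ℝ) :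
    IsSupportPoint P θ (supportPoint P θ) :=
  Classical.epsilon_spec (hP.exists_isSupportPoint θ)

lemma supportPoint_mem (hP : IsDiscPolygon r P) (θ : ℝ) : supportPoint P θ ∈ P :=
  (hP.isSupportPoint θ).1

lemma supportPoint_eq (hP : IsDiscPolygon r P) (hr : 0 < r) {θ : ℝ} {x : Plane}
    (h : IsSupportPoint P θ x) : supportPoint P θ = x :=
  hP.isSupportPoint_unique hr (hP.isSupportPoint θ) h

end IsDiscPolygon

lemma supportPoint_congr {P : Set Plane} {θ φ : ℝ} (h : unitVec θ = unitVec φ) :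
    supportPoint P θ = supportPoint P φ := by
  unfold supportPoint IsSupportPoint; rw [h]

/-- The centre of the disc of radius `r` that touches `P` from outside in direction `θ`. -/
def supportCentre (r : ℝ) (P : Set Plane) (θ : ℝ) : Plane := supportPoint P θ - r • unitVec θ

lemma supportCentre_congr {r : ℝ} {P : Set Plane} {θ φ : ℝ} (h : unitVec θ = unitVec φ) :
    supportCentre r P θ = supportCentre r P φ := by
  unfold supportCentre; rw [h, supportPoint_congr h]

namespace IsDiscPolygon

variable {r : ℝ} {P : Set Plane}

/-- Any cluster point of support points is extremal in the limit direction, hence equal to the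
support point there; compactness of `P` turns this into convergence. -/
lemma continuous_supportPoint (hP : IsDiscPolygon r P) (hr : 0 < r) :
    Continuous (supportPoint P) := by
  rw [continuous_iff_continuousAt]
  intro θ
  refine hP.isCompact.tendsto_nhds_of_unique_mapClusterPt
    (Filter.Eventually.of_forall hP.supportPoint_mem) fun y hy hcl => ?_
  refine (hP.supportPoint_eq hr ⟨hy, fun z hz => ?_⟩).symm
  by_contra! hpos
  have hopen : IsOpen {q : ℝ × Plane | 0 < inner ℝ (unitVec q.1) (z - q.2)} :=
    isOpen_lt continuous_const (by fun_prop)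
  have hmem := hopen.mem_nhds (show (θ, y) ∈ _ from hpos)
  rw [nhds_prod_eq, Filter.mem_prod_iff] at hmem
  obtain ⟨U, hU, W, hW, hUW⟩ := hmem
  obtain ⟨θ', h1, h2⟩ := ((mapClusterPt_iff_frequently.1 hcl W hW).and_eventually hU).exists
  have := hUW (Set.mk_mem_prod h2 h1)
  exact absurd this (not_lt.2 ((hP.isSupportPoint θ').2 z hz))

lemma continuous_supportCentre (hP : IsDiscPolygon r P) (hr : 0 < r) :
    Continuous (supportCentre r P) := by
  have := hP.continuous_supportPoint hr
  unfold supportCentre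
  fun_prop

/-- Every boundary point is an end point of a boundary arc or touches the disc of its arc. -/
lemma exists_finite_centres (hP : IsDiscPolygon r P) (hr : 0 < r) :
    ∃ C V : Set Plane, C.Finite ∧ V.Finite ∧
      ∀ θ, supportCentre r P θ ∈ C ∨ supportPoint P θ ∈ V := by
  obtain ⟨m, c, α, β, hf⟩ := hP.frontier_eq
  refine ⟨Set.range c, Set.range (fun i => c i + r • unitVec (α i)) ∪
    Set.range (fun i => c i + r • unitVec (β i)), Set.finite_range c,
    (Set.finite_range _).union (Set.finite_range _), fun θ => ?_⟩
  have hs := hP.isSupportPoint θ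
  have := frontier_of_isSupportPoint hs
  rw [hf, Set.mem_iUnion] at this
  obtain ⟨i, s, hs1, hs2⟩ := this
  change c i + r • unitVec s = _ at hs2
  by_cases h1 : s = α i
  · right; left; exact ⟨i, by simp only [← h1, hs2]⟩
  by_cases h2 : s = β i
  · right; right; exact ⟨i, by simp only [← h2, hs2]⟩
  left
  refine ⟨i, ?_⟩
  have hmem : Set.Ioo (α i) (β i) ∈ nhds s :=
    Ioo_mem_nhds (lt_of_le_of_ne hs1.1 (Ne.symm h1)) (lt_of_le_of_ne hs1.2 h2)
  -- Inside its arc the support point maximises the linear functional along the arc, so the normal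
  -- of the circle there is the given normal or its opposite.
  have hmax : ∀ t ∈ Set.Ioo (α i) (β i), Real.cos (t - θ) ≤ Real.cos (s - θ) := by
    intro t ht
    have hmemP : c i + r • unitVec t ∈ P := by
      have : c i + r • unitVec t ∈ frontier P := by
        rw [hf]; exact Set.mem_iUnion.2 ⟨i, t, Set.Ioo_subset_Icc_self ht, rfl⟩
      exact hP.isCompact.isClosed.frontier_subset this
    have := hs.2 _ hmemP
    rw [← hs2, add_sub_add_left_eq_sub, ← smul_sub, inner_smul_right, inner_sub_right,
      inner_unitVec, inner_unitVec, ← Real.cos_neg (θ - t), ← Real.cos_neg (θ - s)] at this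
    simp only [neg_sub] at this
    nlinarith
  have hloc : IsLocalMax (fun t => Real.cos (t - θ)) s := by
    filter_upwards [hmem] with t ht using hmax t ht
  have hd : HasDerivAt (fun t => Real.cos (t - θ)) (-Real.sin (s - θ)) s := by
    simpa using ((hasDerivAt_id' s).sub_const θ).cos
  have hsin : Real.sin (s - θ) = 0 := by
    have := hloc.hasDerivAt_eq_zero hd; linarith
  have hcos : Real.cos (s - θ) = 1 := by
    rcases Real.sin_eq_zero_iff_cos_eq.1 hsin with h | h
    · exact h
    -- With the opposite normal the cosine would have a strict minimum at `s`, contradicting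
    -- maximality.
    exfalso
    obtain ⟨ε, hε, hb⟩ := Metric.mem_nhds_iff.1 hmem
    have hδ : 0 < min (ε / 2) 1 := by positivity
    have hδ' : min (ε / 2) 1 < ε := lt_of_le_of_lt (min_le_left _ _) (by linarith)
    have := hmax (s + min (ε / 2) 1) (hb (by simp [abs_of_pos hδ, hδ']))
    rw [h, show s + min (ε / 2) 1 - θ = (s - θ) + min (ε / 2) 1 by ring, Real.cos_add, hsin, h]
      at this
    have h3 : Real.cos (min (ε / 2) 1) < 1 := by
      have := Real.cos_lt_cos_of_nonneg_of_le_pi (x := 0) le_rfl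
        (by linarith [min_le_right (ε / 2) (1:ℝ), Real.pi_gt_three]) hδ
      simpa using this
    linarith
  rw [supportCentre, ← hs2, unitVec_eq_iff.2 hcos]
  abel

/-! ### Blaschke's rolling theorem and the arcs contained in `P` -/

open Filter Topology in
/-- The one-sided form of Blaschke's rolling theorem. -/
lemma inner_supportCentre_le_aux (hP : IsDiscPolygon r P) (hr : 0 < r) (φ σ : ℝ)
    (hσ : σ = 1 ∨ σ = -1) {s : ℝ} (hs : s ∈ Set.Icc 0 Real.pi) :
    inner ℝ (unitVec φ) (supportCentre r P φ - supportCentre r P (φ + σ * s)) ≤ 0 := by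
  obtain ⟨C, V, hC, hV, hCV⟩ := hP.exists_finite_centres hr
  have hqc := hP.continuous_supportCentre hr
  have hpc := hP.continuous_supportPoint hr
  -- No differentiability is available, so monotonicity comes from a Dini derivative: at each `x` it
  -- suffices that slopes to points `z` arbitrarily close on the right are nonpositive.
  refine image_le_of_liminf_slope_right_le_deriv_boundary (a := 0) (b := Real.pi)
    (f := fun s => inner ℝ (unitVec φ) (supportCentre r P φ - supportCentre r P (φ + σ * s)))
    (B := fun _ => 0) (B' := fun _ => 0) (by fun_prop) (by simp) continuousOn_const
    (fun x _ => hasDerivWithinAt_const _ _ _) ?_ hs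
  intro x hx ρ hρ
  have hbig : ∃ᶠ z in 𝓝[>] x, slope (fun s => inner ℝ (unitVec φ)
      (supportCentre r P φ - supportCentre r P (φ + σ * s))) x z ≤ 0 := by
    have hev : ∀ᶠ z in 𝓝[>] x, z ∈ Set.Ioo x Real.pi := Ioo_mem_nhdsGT hx.2
    have hslope : ∀ z, x < z → 0 ≤ inner ℝ (unitVec φ)
        (supportCentre r P (φ + σ * z) - supportCentre r P (φ + σ * x)) →
        slope (fun s => inner ℝ (unitVec φ)
      (supportCentre r P φ - supportCentre r P (φ + σ * s))) x z ≤ 0 := by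
      intro z hz h
      rw [slope_def_field]
      refine div_nonpos_of_nonpos_of_nonneg ?_ (by linarith)
      rw [← inner_sub_right]
      rw [show supportCentre r P φ - supportCentre r P (φ + σ * z) -
        (supportCentre r P φ - supportCentre r P (φ + σ * x)) =
        -(supportCentre r P (φ + σ * z) - supportCentre r P (φ + σ * x)) by abel, inner_neg_right]
      linarith
    -- As `z` decreases to `x`, one of finitely many alternatives recurs: the touching centre stays
    -- fixed (slope zero), or the support point does and the centre turns about it, which makes a
    -- cosine decrease.
    by_cases hfc : ∃ c ∈ C, ∃ᶠ z in 𝓝[>] x, supportCentre r P (φ + σ * z) = c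
    · obtain ⟨c, -, hc⟩ := hfc
      have hcl : supportCentre r P (φ + σ * x) = c := by
        have hclosed : IsClosed {z | supportCentre r P (φ + σ * z) = c} :=
          isClosed_eq (by fun_prop) continuous_const
        exact hclosed.closure_subset
          (mem_closure_iff_frequently.2 (hc.filter_mono nhdsWithin_le_nhds))
      refine (hc.and_eventually hev).mono fun z hz => hslope z hz.2.1 ?_
      rw [hz.1, hcl]; simp
    by_cases hfv : ∃ v ∈ V, ∃ᶠ z in 𝓝[>] x, supportPoint P (φ + σ * z) = v
    · obtain ⟨v, -, hv⟩ := hfv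
      have hcl : supportPoint P (φ + σ * x) = v := by
        have hclosed : IsClosed {z | supportPoint P (φ + σ * z) = v} :=
          isClosed_eq (by fun_prop) continuous_const
        exact hclosed.closure_subset
          (mem_closure_iff_frequently.2 (hv.filter_mono nhdsWithin_le_nhds))
      refine (hv.and_eventually hev).mono fun z hz => hslope z hz.2.1 ?_
      rw [supportCentre, supportCentre, hz.1, hcl, sub_sub_sub_cancel_left, ← smul_sub,
        inner_smul_right, inner_sub_right, inner_unitVec, inner_unitVec]
      have h1 : ∀ y, Real.cos (φ - (φ + σ * y)) = Real.cos y := by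
        intro y
        rcases hσ with rfl | rfl
        · rw [← Real.cos_neg]; congr 1; ring
        · congr 1; ring
      rw [h1, h1]
      have := Real.cos_le_cos_of_nonneg_of_le_pi hx.1 hz.2.2.le hz.2.1.le
      have : 0 ≤ Real.cos x - Real.cos z := by linarith
      positivity
    exfalso
    push Not at hfc hfv
    have e1 : ∀ᶠ z in 𝓝[>] x, ∀ c ∈ C, supportCentre r P (φ + σ * z) ≠ c :=
      (eventually_all_finite hC).2 fun c hc => by simpa using hfc c hc
    have e2 : ∀ᶠ z in 𝓝[>] x, ∀ c ∈ V, supportPoint P (φ + σ * z) ≠ c :=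
      (eventually_all_finite hV).2 fun c hc => by simpa using hfv c hc
    obtain ⟨z, h1, h2⟩ := (e1.and e2).exists
    rcases hCV (φ + σ * z) with h | h
    · exact h1 _ h rfl
    · exact h2 _ h rfl
  exact hbig.mono fun z hz => lt_of_le_of_lt hz hρ

lemma inner_supportCentre_le (hP : IsDiscPolygon r P) (hr : 0 < r) (φ θ : ℝ) :
    inner ℝ (unitVec φ) (supportCentre r P φ - supportCentre r P θ) ≤ 0 := by
  have hpi := Real.pi_pos
  obtain ⟨k, hk, -⟩ := existsUnique_add_zsmul_mem_Ioc (a := 2 * Real.pi) (by positivity) (θ - φ)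
    (-Real.pi)
  simp only [zsmul_eq_mul] at hk
  set s := θ - φ + k * (2 * Real.pi)
  have hθ : supportCentre r P θ = supportCentre r P (φ + s) := by
    refine supportCentre_congr ?_
    rw [show φ + s = θ + k * (2 * Real.pi) by simp only [s]; ring, unitVec_add_int_mul]
  rw [hθ]
  rcases le_total 0 s with h | h
  · simpa using hP.inner_supportCentre_le_aux hr φ 1 (Or.inl rfl) ⟨h, by linarith [hk.2]⟩
  · simpa using hP.inner_supportCentre_le_aux hr φ (-1) (Or.inr rfl) (s := -s)
      ⟨by linarith, by linarith [hk.1]⟩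

/-- Blaschke's rolling theorem for disc-polygons. -/
lemma subset_closedBall (hP : IsDiscPolygon r P) (hr : 0 < r) (θ : ℝ) :
    P ⊆ Metric.closedBall (supportCentre r P θ) r := by
  intro y hy
  obtain ⟨φ, -, hφ⟩ := exists_eq_norm_smul_unitVec (y - supportCentre r P θ)
  rw [mem_closedBall_iff_norm]
  have h1 := (hP.isSupportPoint φ).2 y hy
  have h2 := hP.inner_supportCentre_le hr φ θ
  have h3 : inner ℝ (unitVec φ) (y - supportCentre r P θ) = ‖y - supportCentre r P θ‖ := by
    nth_rewrite 1 [hφ]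
    rw [inner_smul_right, inner_unitVec]; simp
  -- The direction `φ` points from the centre of `θ` to `y`. Passing through the support point and
  -- the centre of `φ` splits the distance into two nonpositive terms and `r`.
  rw [← h3, show y - supportCentre r P θ = (y - supportPoint P φ) +
    (supportCentre r P φ - supportCentre r P θ) + r • unitVec φ by
      simp only [supportCentre]; abel, inner_add_right, inner_add_right, inner_smul_right,
      inner_unitVec]
  simp
  linarith

end IsDiscPolygon

lemma exists_nonneg_comb_unitVec {a b t : ℝ} (hat : a ≤ t) (htb : t ≤ b) (hab : b < a + Real.pi) :
    ∃ α β : ℝ, 0 ≤ α ∧ 0 ≤ β ∧ unitVec t = α • unitVec a + β • unitVec b := by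
  rcases eq_or_lt_of_le (hat.trans htb) with h | h
  · refine ⟨1, 0, zero_le_one, le_rfl, ?_⟩
    rw [show t = a by linarith]; simp
  have hs : 0 < Real.sin (b - a) := Real.sin_pos_of_pos_of_lt_pi (by linarith) (by linarith)
  have h1 : 0 ≤ Real.sin (b - t) := Real.sin_nonneg_of_nonneg_of_le_pi (by linarith) (by linarith)
  have h2 : 0 ≤ Real.sin (t - a) := Real.sin_nonneg_of_nonneg_of_le_pi (by linarith) (by linarith)
  -- The coefficients are those of the sine rule.
  refine ⟨Real.sin (b - t) / Real.sin (b - a), Real.sin (t - a) / Real.sin (b - a),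
    by positivity, by positivity, ?_⟩
  have ha := Real.sin_sq_add_cos_sq a
  have hb := Real.sin_sq_add_cos_sq b
  have ht := Real.sin_sq_add_cos_sq t
  apply Plane.ext'
  · simp only [PiLp.add_apply, PiLp.smul_apply, unitVec_zero_coord, smul_eq_mul]
    field_simp
    simp only [Real.sin_sub]
    ring
  · simp only [PiLp.add_apply, PiLp.smul_apply, unitVec_one_coord, smul_eq_mul]
    field_simp
    simp only [Real.sin_sub]
    ring

/-- A disc of radius `r` contains the short arcs of radius `r` between its points. -/
lemma closedBall_spindle {r : ℝ} (hr : 0 < r) {c c' w₁ w₂ w : Plane} {α β : ℝ}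
    (h₁ : ‖w₁‖ = 1) (h₂ : ‖w₂‖ = 1) (hw : ‖w‖ = 1) (hα : 0 ≤ α) (hβ : 0 ≤ β)
    (hc : w = α • w₁ + β • w₂) (hm₁ : c + r • w₁ ∈ Metric.closedBall c' r)
    (hm₂ : c + r • w₂ ∈ Metric.closedBall c' r) : c + r • w ∈ Metric.closedBall c' r := by
  have hαβ : 1 ≤ α + β := by
    have := norm_add_le (α • w₁) (β • w₂)
    rw [← hc, hw, norm_smul, norm_smul, h₁, h₂, Real.norm_of_nonneg hα, Real.norm_of_nonneg hβ]
      at this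
    linarith
  -- Membership of `c + r • u` is an affine condition on `u` with nonnegative constant term; since
  -- `1 ≤ α + β`, the combination of the two given conditions implies the third.
  have key : ∀ u : Plane, ‖u‖ = 1 → (c + r • u ∈ Metric.closedBall c' r ↔
      ‖c - c'‖ ^ 2 + 2 * r * inner ℝ (c - c') u ≤ 0) := by
    intro u hu
    rw [mem_closedBall_iff_norm, show c + r • u - c' = (c - c') + r • u by abel,
      ← pow_le_pow_iff_left₀ (norm_nonneg _) hr.le two_ne_zero, norm_add_sq_real, inner_smul_right,
      norm_smul, hu, Real.norm_of_nonneg hr.le]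
    constructor <;> intro h <;> linarith
  rw [key _ h₁] at hm₁
  rw [key _ h₂] at hm₂
  rw [key _ hw, hc, inner_add_right, inner_smul_right, inner_smul_right]
  have := sq_nonneg ‖c - c'‖
  nlinarith [mul_le_mul_of_nonneg_left hm₁ hα, mul_le_mul_of_nonneg_left hm₂ hβ]

namespace IsDiscPolygon

variable {r : ℝ} {P : Set Plane}

/-- `P` is the intersection of its touching discs: the nearest point of `P` to an outside point `x`
is extremal in the direction of `x`, and the touching disc there excludes `x`. -/
lemma mem_of_forall_mem_closedBall (hP : IsDiscPolygon r P) (hr : 0 < r) {x : Plane}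
    (hx : ∀ θ, x ∈ Metric.closedBall (supportCentre r P θ) r) : x ∈ P := by
  by_contra hxP
  obtain ⟨w, hw, hmin⟩ := exists_norm_eq_iInf_of_complete_convex
    (hP.interior_nonempty.mono interior_subset) hP.isCompact.isComplete hP.convex x
  have hproj := (norm_eq_iInf_iff_real_inner_le_zero hP.convex hw).1 hmin
  have hpos : 0 < ‖x - w‖ := by
    rw [norm_pos_iff, sub_ne_zero]; rintro rfl; exact hxP hw
  obtain ⟨θ, -, hθ⟩ := exists_eq_norm_smul_unitVec (x - w)
  have hsup : supportPoint P θ = w := hP.supportPoint_eq hr ⟨hw, fun y hy => by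
    have := hproj y hy
    rw [hθ, inner_smul_left] at this
    simp only [conj_trivial] at this
    exact nonpos_of_mul_nonpos_right this hpos⟩
  have := hx θ
  rw [mem_closedBall_iff_norm, supportCentre, hsup,
    show x - (w - r • unitVec θ) = (x - w) + r • unitVec θ by abel, hθ, ← add_smul, norm_smul,
    norm_unitVec, Real.norm_of_nonneg (by positivity)] at this
  linarith

/-- A disc-polygon contains the short arcs of radius `r` between its points. -/
lemma arc_mem (hP : IsDiscPolygon r P) (hr : 0 < r) {c : Plane} {a b t : ℝ} (hat : a ≤ t)
    (htb : t ≤ b) (hab : b < a + Real.pi) (ha : c + r • unitVec a ∈ P)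
    (hb : c + r • unitVec b ∈ P) : c + r • unitVec t ∈ P := by
  obtain ⟨α, β, hα, hβ, h⟩ := exists_nonneg_comb_unitVec hat htb hab
  exact hP.mem_of_forall_mem_closedBall hr fun θ => closedBall_spindle hr (norm_unitVec _)
    (norm_unitVec _) (norm_unitVec _) hα hβ h (hP.subset_closedBall hr θ ha)
    (hP.subset_closedBall hr θ hb)

lemma exists_closedBall_subset (hP : IsDiscPolygon r P) :
    ∃ o, ∃ ε > 0, Metric.closedBall o ε ⊆ P := by
  obtain ⟨o, ho⟩ := hP.interior_nonempty
  obtain ⟨ε, hε, h⟩ := Metric.nhds_basis_closedBall.mem_iff.1 (mem_interior_iff_mem_nhds.1 ho)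
  exact ⟨o, ε, hε, h⟩

end IsDiscPolygon

lemma IsSupportPoint.inner_le_neg {P : Set Plane} {θ : ℝ} {x o : Plane} {ε : ℝ} (hε : 0 ≤ ε)
    (h : IsSupportPoint P θ x) (ho : Metric.closedBall o ε ⊆ P) :
    inner ℝ (unitVec θ) (o - x) ≤ -ε := by
  have := h.2 (o + ε • unitVec θ) (ho (by simp [norm_smul, abs_of_nonneg hε]))
  rw [show o + ε • unitVec θ - x = (o - x) + ε • unitVec θ by abel, inner_add_right,
    inner_smul_right, inner_unitVec] at this
  simp at this
  linarith

lemma IsSupportPoint.between {P : Set Plane} {a b t : ℝ} {x : Plane} (ha : IsSupportPoint P a x)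
    (hb : IsSupportPoint P b x) (hat : a ≤ t) (htb : t ≤ b) (hab : b < a + Real.pi) :
    IsSupportPoint P t x := by
  obtain ⟨α, β, hα, hβ, h⟩ := exists_nonneg_comb_unitVec hat htb hab
  refine ⟨ha.1, fun y hy => ?_⟩
  rw [h, inner_add_left, real_inner_smul_left, real_inner_smul_left]
  nlinarith [mul_nonpos_of_nonneg_of_nonpos hα (ha.2 y hy),
    mul_nonpos_of_nonneg_of_nonpos hβ (hb.2 y hy)]

/-! ### Vertices, their arcs of normals and their edges -/

namespace IsDiscPolygon

variable {r : ℝ} {P : Set Plane}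

lemma supportPoint_between (hP : IsDiscPolygon r P) (hr : 0 < r) {a b t : ℝ} {x : Plane}
    (ha : supportPoint P a = x) (hb : supportPoint P b = x) (hat : a ≤ t) (htb : t ≤ b)
    (hab : b < a + Real.pi) : supportPoint P t = x :=
  hP.supportPoint_eq hr ((ha ▸ hP.isSupportPoint a).between (hb ▸ hP.isSupportPoint b) hat htb hab)

/-- A common extremal point for opposite directions would leave `P` no width in that direction. -/
lemma supportPoint_add_pi_ne (hP : IsDiscPolygon r P) (θ : ℝ) :
    supportPoint P (θ + Real.pi) ≠ supportPoint P θ := by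
  intro h
  obtain ⟨o, ε, hε, ho⟩ := hP.exists_closedBall_subset
  have h1 := (hP.isSupportPoint θ).inner_le_neg hε.le ho
  have h2 := (hP.isSupportPoint (θ + Real.pi)).inner_le_neg hε.le ho
  rw [h, unitVec_add_pi, inner_neg_left] at h2
  linarith

lemma mem_vertices_iff (hP : IsDiscPolygon r P) (hr : 0 < r) {x : Plane} :
    x ∈ vertices P ↔ ∃ a b, unitVec a ≠ unitVec b ∧ supportPoint P a = x ∧ supportPoint P b = x := by
  constructor
  · rintro ⟨hx, u, ⟨hu, hu'⟩, w, ⟨hw, hw'⟩, hne⟩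
    obtain ⟨a, -, rfl⟩ := exists_unitVec_eq hu
    obtain ⟨b, -, rfl⟩ := exists_unitVec_eq hw
    exact ⟨a, b, hne, hP.supportPoint_eq hr ⟨hx, hu'⟩, hP.supportPoint_eq hr ⟨hx, hw'⟩⟩
  · rintro ⟨a, b, hne, rfl, hb⟩
    exact ⟨hP.supportPoint_mem a, _, ⟨norm_unitVec a, (hP.isSupportPoint a).2⟩, _,
      ⟨norm_unitVec b, hb ▸ (hP.isSupportPoint b).2⟩, hne⟩

/-- The outer normals at a vertex form an arc of positive length less than `π`. -/
lemma exists_normal_arc (hP : IsDiscPolygon r P) (hr : 0 < r) {v : Plane} (hv : v ∈ vertices P) :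
    ∃ θ ω, 0 < ω ∧ ω < Real.pi ∧ (∀ φ ∈ Set.Icc θ (θ + ω), supportPoint P φ = v) ∧
      ∀ φ, supportPoint P φ = v → ∃ k : ℤ, φ + k * (2 * Real.pi) ∈ Set.Icc θ (θ + ω) := by
  obtain ⟨θ₁, θ₂, hne, h₁, h₂⟩ := (hP.mem_vertices_iff hr).1 hv
  have hpi := Real.pi_pos
  -- One period around `θ₁`. Its ends are opposite to `θ₁`, so they are not normals at `v`, and the
  -- extreme elements of `S` bound a single arc.
  set S := {φ | φ ∈ Set.Icc (θ₁ - Real.pi) (θ₁ + Real.pi) ∧ supportPoint P φ = v}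
  have hS : IsCompact S := isCompact_Icc.inter_right
    (isClosed_eq (hP.continuous_supportPoint hr) continuous_const)
  have h₁S : θ₁ ∈ S := ⟨⟨by linarith, by linarith⟩, h₁⟩
  obtain ⟨a, haS, ha⟩ := hS.exists_isLeast ⟨_, h₁S⟩
  obtain ⟨b, hbS, hb⟩ := hS.exists_isGreatest ⟨_, h₁S⟩
  have ha1 := ha h₁S
  have hb1 := hb h₁S
  have hshift : ∀ φ, supportPoint P φ = v → ∃ k : ℤ, φ + k * (2 * Real.pi) ∈ S := by
    intro φ hφ
    obtain ⟨k, hk, -⟩ := existsUnique_add_zsmul_mem_Ioc (a := 2 * Real.pi) (by positivity) φ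
      (θ₁ - Real.pi)
    rw [zsmul_eq_mul] at hk
    exact ⟨k, ⟨hk.1.le, by linarith [hk.2]⟩, by
      rw [supportPoint_congr (unitVec_add_int_mul φ k), hφ]⟩
  have ha2 : θ₁ - Real.pi < a := by
    refine lt_of_le_of_ne haS.1.1 fun h => hP.supportPoint_add_pi_ne a ?_
    rw [← h, sub_add_cancel, h₁, h, haS.2]
  have hb2 : b < θ₁ + Real.pi := by
    refine lt_of_le_of_ne hbS.1.2 fun h => hP.supportPoint_add_pi_ne θ₁ ?_
    rw [← h, h₁, hbS.2]
  have hab : ∀ φ ∈ Set.Icc a b, supportPoint P φ = v := by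
    intro φ hφ
    rcases le_total φ θ₁ with h | h
    · exact hP.supportPoint_between hr haS.2 h₁ hφ.1 h (by linarith)
    · exact hP.supportPoint_between hr h₁ hbS.2 h hφ.2 (by linarith)
  have hlt : a < b := by
    rcases eq_or_lt_of_le (ha1.trans hb1) with h | h
    · exfalso
      obtain ⟨k, hk⟩ := hshift θ₂ h₂
      have e1 := ha hk
      have e2 := hb hk
      apply hne
      rw [← unitVec_add_int_mul θ₂ k]
      congr 1; linarith
    · exact h
  refine ⟨a, b - a, by linarith, ?_, fun φ hφ => hab φ (by simpa using hφ), fun φ hφ => ?_⟩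
  · by_contra! h
    exact hP.supportPoint_add_pi_ne a
      (by rw [haS.2, hab _ ⟨by linarith, by linarith⟩])
  · obtain ⟨k, hk⟩ := hshift φ hφ
    exact ⟨k, ha hk, by linarith [hb hk]⟩

/-- A vertex that is no end point of a boundary arc would have an interval of normals with pairwise
different touching centres, all in a finite set. -/
lemma finite_vertices (hP : IsDiscPolygon r P) (hr : 0 < r) : (vertices P).Finite := by
  obtain ⟨C, V, hC, hV, hCV⟩ := hP.exists_finite_centres hr
  refine hV.subset fun v hv => ?_
  by_contra hvV
  obtain ⟨θ, ω, h0, hpi, hs, -⟩ := hP.exists_normal_arc hr hv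
  refine (Set.Icc_infinite (show θ < θ + ω by linarith)) ?_
  refine Set.Finite.of_finite_image (f := fun φ => v - r • unitVec φ) (hC.subset ?_) ?_
  · rintro _ ⟨φ, hφ, rfl⟩
    rcases hCV φ with h | h
    · rwa [supportCentre, hs φ hφ] at h
    · exact absurd (hs φ hφ ▸ h) hvV
  · intro x hx y hy hxy
    have : unitVec x = unitVec y := smul_right_injective _ hr.ne' (sub_right_injective hxy)
    obtain ⟨k, hk⟩ := exists_int_of_unitVec_eq this
    have h3 := hx.1; have h4 := hx.2; have h5 := hy.1; have h6 := hy.2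
    have hk0 : k = 0 := by
      by_contra hk0
      rcases lt_or_gt_of_ne hk0 with h | h
      · have : (k : ℝ) ≤ -1 := by exact_mod_cast (by omega : k ≤ -1)
        nlinarith
      · have : (1 : ℝ) ≤ k := by exact_mod_cast (by omega : 1 ≤ k)
        nlinarith
    simpa [hk0] using hk

/-- A point that is not a vertex has one normal, so the finitely many exceptional boundary points
add only finitely many centres. -/
lemma finite_supportCentre (hP : IsDiscPolygon r P) (hr : 0 < r) :
    (supportCentre r P '' {φ | supportPoint P φ ∉ vertices P}).Finite := by
  obtain ⟨C, V, hC, hV, hCV⟩ := hP.exists_finite_centres hr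
  refine (hC.union (hV.biUnion (t := fun w => supportCentre r P ''
    {φ | supportPoint P φ = w ∧ w ∉ vertices P}) fun w _ => Set.Subsingleton.finite ?_)).subset ?_
  · rintro _ ⟨a, ⟨ha, hw⟩, rfl⟩ _ ⟨b, ⟨hb, -⟩, rfl⟩
    refine supportCentre_congr ?_
    by_contra hne
    exact hw ((hP.mem_vertices_iff hr).2 ⟨a, b, hne, ha, hb⟩)
  · rintro _ ⟨φ, hφ, rfl⟩
    rcases hCV φ with h | h
    · exact Or.inl h
    · exact Or.inr (Set.mem_biUnion h ⟨φ, ⟨rfl, hφ⟩, rfl⟩)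

/-- The continuous image of an interval in a finite set is a single point. This says that between
vertices the touching disc does not move, that is, the boundary is one arc. -/
lemma supportCentre_const (hP : IsDiscPolygon r P) (hr : 0 < r) {a b : ℝ} (hab : a < b)
    (h : ∀ φ ∈ Set.Ioo a b, supportPoint P φ ∉ vertices P) {x y : ℝ} (hx : x ∈ Set.Icc a b)
    (hy : y ∈ Set.Icc a b) : supportCentre r P x = supportCentre r P y := by
  have hq := hP.continuous_supportCentre hr
  have hsub : (supportCentre r P '' Set.Ioo a b).Subsingleton :=
    ((hP.finite_supportCentre hr).subset (Set.image_mono h)).countable.isTotallyDisconnected _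
      subset_rfl (isPreconnected_Ioo.image _ hq.continuousOn)
  obtain ⟨m, hm⟩ : (Set.Ioo a b).Nonempty := Set.nonempty_Ioo.2 hab
  have hE : Set.EqOn (supportCentre r P) (fun _ => supportCentre r P m) (Set.Ioo a b) :=
    fun z hz => hsub ⟨z, hz, rfl⟩ ⟨m, hm, rfl⟩
  have := hE.closure hq continuous_const
  rw [closure_Ioo hab.ne] at this
  rw [this hx, this hy]

end IsDiscPolygon

/-- A vertex `v` together with a sense of rotation `σ`: its normals have the polar angles `φ₀ - σ η`,
`0 ≤ η ≤ ω`, and the two boundary arcs at `v` have angular length at least `τ`. -/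
structure IsDiscCorner (r : ℝ) (P : Set Plane) (v : Plane) (φ₀ σ ω τ : ℝ) : Prop where
  sign : σ = 1 ∨ σ = -1
  pos : 0 < ω
  lt_pi : ω < Real.pi
  τ_pos : 0 < τ
  supportPoint_eq : ∀ η ∈ Set.Icc 0 ω, supportPoint P (φ₀ - σ * η) = v
  edge : ∀ s ∈ Set.Icc 0 τ, v - r • unitVec φ₀ + r • unitVec (φ₀ + σ * s) ∈ P
  edge' : ∀ s ∈ Set.Icc 0 τ,
    v - r • unitVec (φ₀ - σ * ω) + r • unitVec (φ₀ - σ * ω - σ * s) ∈ P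

/-- Reversing the sense of rotation exchanges the two edges at `v`, so estimates are needed near the
first edge only. -/
lemma IsDiscCorner.symm {r : ℝ} {P : Set Plane} {v : Plane} {φ₀ σ ω τ : ℝ}
    (h : IsDiscCorner r P v φ₀ σ ω τ) : IsDiscCorner r P v (φ₀ - σ * ω) (-σ) ω τ where
  sign := by rcases h.sign with h | h <;> simp [h]
  pos := h.pos
  lt_pi := h.lt_pi
  τ_pos := h.τ_pos
  supportPoint_eq η hη := by
    rw [show φ₀ - σ * ω - -σ * η = φ₀ - σ * (ω - η) by ring]
    exact h.supportPoint_eq _ ⟨by linarith [hη.2], by linarith [hη.1]⟩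
  edge s hs := by
    have := h.edge' s hs
    rwa [show φ₀ - σ * ω + -σ * s = φ₀ - σ * ω - σ * s by ring]
  edge' s hs := by
    have := h.edge s hs
    rwa [show φ₀ - σ * ω - -σ * ω = φ₀ by ring, show φ₀ - -σ * s = φ₀ + σ * s by ring]

namespace IsDiscPolygon

variable {r : ℝ} {P : Set Plane}

lemma supportCentre_add_mem (hP : IsDiscPolygon r P) {a b : ℝ}
    (h : supportCentre r P a = supportCentre r P b) : supportCentre r P a + r • unitVec b ∈ P := by
  rw [h, supportCentre, sub_add_cancel]
  exact hP.supportPoint_mem b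

/-- Just beyond either end of the arc of normals no vertex is a support point: the others are
excluded by continuity and `v` by the choice of the arc. The touching centre is constant there, so
the edge runs along its circle. -/
lemma exists_isDiscCorner (hP : IsDiscPolygon r P) (hr : 0 < r) {v : Plane} (hv : v ∈ vertices P) :
    ∃ φ₀ ω τ, IsDiscCorner r P v φ₀ 1 ω τ ∧ ∀ φ, supportPoint P φ = v →
      ∃ k : ℤ, φ + k * (2 * Real.pi) ∈ Set.Icc (φ₀ - ω) φ₀ := by
  obtain ⟨θ, ω, h0, hpi, hs, hk⟩ := hP.exists_normal_arc hr hv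
  have hpi0 := Real.pi_pos
  have hU : IsOpen {φ | supportPoint P φ ∉ vertices P \ {v}} :=
    ((hP.finite_vertices hr).subset Set.sdiff_subset).isClosed.isOpen_compl.preimage
      (hP.continuous_supportPoint hr)
  obtain ⟨τ₁, hτ₁, hb₁⟩ := Metric.isOpen_iff.1 hU θ (by simp [hs θ ⟨le_rfl, by linarith⟩])
  obtain ⟨τ₂, hτ₂, hb₂⟩ := Metric.isOpen_iff.1 hU (θ + ω) (by simp [hs (θ + ω) ⟨by linarith, le_rfl⟩])
  set τ := min (min τ₁ τ₂) (Real.pi - ω)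
  have hτ : 0 < τ := lt_min (lt_min hτ₁ hτ₂) (by linarith)
  have t1 : τ ≤ τ₁ := (min_le_left _ _).trans (min_le_left _ _)
  have t2 : τ ≤ τ₂ := (min_le_left _ _).trans (min_le_right _ _)
  have t3 : τ ≤ Real.pi - ω := min_le_right _ _
  have hnot : ∀ φ, (θ + ω < φ ∧ φ < θ + ω + τ) ∨ (θ - τ < φ ∧ φ < θ) → supportPoint P φ ≠ v := by
    intro φ hφ hφv
    obtain ⟨k, h1, h2⟩ := hk φ hφv
    have hk0 : k = 0 := by
      by_contra hk0
      rcases lt_or_gt_of_ne hk0 with h | h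
      · have : (k : ℝ) ≤ -1 := by exact_mod_cast (by omega : k ≤ -1)
        rcases hφ with hφ | hφ <;> nlinarith
      · have : (1 : ℝ) ≤ k := by exact_mod_cast (by omega : 1 ≤ k)
        rcases hφ with hφ | hφ <;> nlinarith
    simp only [hk0, Int.cast_zero, zero_mul, add_zero] at h1 h2
    rcases hφ with hφ | hφ <;> linarith
  have c1 : ∀ s ∈ Set.Icc 0 τ, supportCentre r P (θ + ω) = supportCentre r P (θ + ω + s) := by
    intro s hs
    refine hP.supportCentre_const hr (a := θ + ω) (b := θ + ω + τ) (by linarith) ?_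
      ⟨le_rfl, by linarith⟩ ⟨by linarith [hs.1], by linarith [hs.2]⟩
    intro φ hφ hφv
    refine hb₂ (show φ ∈ Metric.ball (θ + ω) τ₂ from ?_) ⟨hφv, hnot φ (Or.inl hφ)⟩
    rw [Metric.mem_ball, Real.dist_eq, abs_of_pos] <;> linarith [hφ.1, hφ.2]
  have c2 : ∀ s ∈ Set.Icc 0 τ, supportCentre r P θ = supportCentre r P (θ - s) := by
    intro s hs
    refine hP.supportCentre_const hr (a := θ - τ) (b := θ) (by linarith) ?_
      ⟨by linarith, le_rfl⟩ ⟨by linarith [hs.2], by linarith [hs.1]⟩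
    intro φ hφ hφv
    refine hb₁ (show φ ∈ Metric.ball θ τ₁ from ?_) ⟨hφv, hnot φ (Or.inr hφ)⟩
    rw [Metric.mem_ball, Real.dist_eq, abs_of_neg] <;> linarith [hφ.1, hφ.2]
  refine ⟨θ + ω, ω, τ, ⟨Or.inl rfl, h0, hpi, hτ, ?_, ?_, ?_⟩, ?_⟩
  · intro η hη
    exact hs _ ⟨by linarith [hη.2], by linarith [hη.1]⟩
  · intro s hs'
    have := hP.supportCentre_add_mem (c1 s hs')
    rwa [supportCentre, hs (θ + ω) ⟨by linarith, le_rfl⟩, ← one_mul s] at this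
  · intro s hs'
    have := hP.supportCentre_add_mem (c2 s hs')
    rw [supportCentre, hs θ ⟨le_rfl, by linarith⟩] at this
    simpa using this
  · intro φ hφ
    obtain ⟨k, hk⟩ := hk φ hφ
    exact ⟨k, by simpa using hk⟩

/-- The length `τ` is uniform in `φ`. If vertices were support points within `τ` on both sides,
uniform continuity would bring them closer than distinct vertices can be. They would then be one
vertex, with `φ` between two of its normals. -/
lemma exists_edge_of_not_vertex (hP : IsDiscPolygon r P) (hr : 0 < r) :
    ∃ τ > 0, ∀ φ ∈ Set.Icc (-Real.pi) Real.pi, supportPoint P φ ∉ vertices P →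
      ∃ σ : ℝ, (σ = 1 ∨ σ = -1) ∧
        ∀ s ∈ Set.Icc 0 τ, supportCentre r P φ + r • unitVec (φ + σ * s) ∈ P := by
  have hpi0 := Real.pi_pos
  obtain ⟨δ, hδ, hsep⟩ : ∃ δ > 0, ∀ v ∈ vertices P, ∀ w ∈ vertices P, dist v w < δ → v = w := by
    by_cases hn : (vertices P).Nontrivial
    · refine ⟨(vertices P).infsep, (hP.finite_vertices hr).infsep_pos_iff_nontrivial.2 hn, ?_⟩
      intro v hv w hw h
      by_contra hne
      exact absurd h (not_lt.2 (Set.infsep_le_dist_of_mem hv hw hne))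
    · exact ⟨1, one_pos, fun v hv w hw _ => (Set.not_nontrivial_iff.1 hn) hv hw⟩
  have huc := (isCompact_Icc (a := -Real.pi - 1) (b := Real.pi + 1)).uniformContinuousOn_of_continuous
    (hP.continuous_supportPoint hr).continuousOn
  obtain ⟨ε, hε, hd⟩ := Metric.uniformContinuousOn_iff.1 huc δ hδ
  set τ := min (ε / 2) 1
  have hτ : 0 < τ := by positivity
  have t1 : τ ≤ ε / 2 := min_le_left _ _
  have t2 : τ ≤ 1 := min_le_right _ _
  refine ⟨τ, hτ, fun φ hφ hnv => ?_⟩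
  by_cases h1 : ∀ ψ ∈ Set.Ioo φ (φ + τ), supportPoint P ψ ∉ vertices P
  · refine ⟨1, Or.inl rfl, fun s hs => hP.supportCentre_add_mem ?_⟩
    exact hP.supportCentre_const hr (by linarith) h1 ⟨le_rfl, by linarith⟩
      ⟨by linarith [hs.1], by linarith [hs.2]⟩
  by_cases h2 : ∀ ψ ∈ Set.Ioo (φ - τ) φ, supportPoint P ψ ∉ vertices P
  · refine ⟨-1, Or.inr rfl, fun s hs => hP.supportCentre_add_mem ?_⟩
    exact hP.supportCentre_const hr (by linarith) h2 ⟨by linarith, le_rfl⟩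
      ⟨by linarith [hs.2], by linarith [hs.1]⟩
  exfalso
  push Not at h1 h2
  obtain ⟨a, ha, hav⟩ := h1
  obtain ⟨b, hb, hbv⟩ := h2
  have := hsep _ hav _ hbv (hd a ⟨by linarith [ha.1, hφ.1], by linarith [ha.2, hφ.2]⟩ b
    ⟨by linarith [hb.1, hφ.1], by linarith [hb.2, hφ.2]⟩ (by
      rw [Real.dist_eq, abs_of_pos] <;> linarith [ha.1, ha.2, hb.1, hb.2]))
  apply hnv
  rw [hP.supportPoint_between hr rfl this hb.2.le ha.1.le
    (by linarith [ha.1, ha.2, hb.1, hb.2, Real.pi_gt_three])]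
  exact hbv

end IsDiscPolygon

/-! ### The `r`-hull and its vertices -/

lemma mem_rHull_iff {r : ℝ} {X : Set Plane} {p : Plane} :
    p ∈ rHull r X ↔ ∀ c, X ⊆ Metric.closedBall c r → p ∈ Metric.closedBall c r := by
  simp [rHull]

lemma subset_rHull (r : ℝ) (X : Set Plane) : X ⊆ rHull r X :=
  fun _ hx => mem_rHull_iff.2 fun _ hc => hc hx

@[simp] lemma rHull_empty (r : ℝ) : rHull r ∅ = ∅ := by
  refine Set.eq_empty_of_forall_notMem fun p hp => ?_
  have := mem_rHull_iff.1 hp (p + (|r| + 1) • unitVec 0) (Set.empty_subset _)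
  rw [mem_closedBall_iff_norm] at this
  simp only [sub_add_cancel_left, norm_neg, norm_smul, norm_unitVec, mul_one, Real.norm_eq_abs]
    at this
  rw [abs_of_pos (by positivity)] at this
  linarith [le_abs_self r]

/-- Uniform convexity of the discs of radius `r`. -/
lemma add_smul_mem_closedBall {r : ℝ} (hr : 0 < r) {c p z u : Plane} {t : ℝ} (ht : t ∈ Set.Icc 0 1)
    (hu : ‖u‖ = 1) (hp : p ∈ Metric.closedBall c r) (hz : p + z ∈ Metric.closedBall c r) :
    p + t • z + (t * (1 - t) * ‖z‖ ^ 2 / (2 * r)) • u ∈ Metric.closedBall c r := by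
  rw [mem_closedBall_iff_norm] at *
  have hp2 : ‖p - c‖ ^ 2 ≤ r ^ 2 := pow_le_pow_left₀ (norm_nonneg _) hp 2
  have hz2 : ‖p + z - c‖ ^ 2 ≤ r ^ 2 := pow_le_pow_left₀ (norm_nonneg _) hz 2
  have e1 : ‖p + z - c‖ ^ 2 = ‖p - c‖ ^ 2 + 2 * inner ℝ (p - c) z + ‖z‖ ^ 2 := by
    rw [← norm_add_sq_real]; congr 2; abel
  have e2 : ‖p + t • z - c‖ ^ 2 = ‖p - c‖ ^ 2 + 2 * (t * inner ℝ (p - c) z) + t ^ 2 * ‖z‖ ^ 2 := by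
    rw [show p + t • z - c = (p - c) + t • z by abel, norm_add_sq_real, inner_smul_right, norm_smul,
      mul_pow, Real.norm_eq_abs, sq_abs]
  set h := t * (1 - t) * ‖z‖ ^ 2 / (2 * r) with hh
  have h1t : 0 ≤ 1 - t := by linarith [ht.2]
  have ht0 : 0 ≤ t := ht.1
  have hh0 : 0 ≤ h := by positivity
  have hh2 : 2 * r * h = t * (1 - t) * ‖z‖ ^ 2 := by rw [hh]; field_simp
  have e3 : ‖p + t • z - c‖ ^ 2 ≤ r ^ 2 - 2 * r * h := by
    rw [hh2, e2]
    nlinarith [mul_le_mul_of_nonneg_left hp2 h1t, mul_le_mul_of_nonneg_left hz2 ht0]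
  have hle : ‖p + t • z - c‖ ≤ r - h := by
    have hr2 : 0 ≤ r - h := by
      have : 0 ≤ r ^ 2 - 2 * r * h := (sq_nonneg _).trans e3
      nlinarith
    refine abs_le_of_sq_le_sq' (b := r - h) ?_ hr2 |>.2
    nlinarith
  calc ‖p + t • z + h • u - c‖ = ‖(p + t • z - c) + h • u‖ := by congr 1; abel
    _ ≤ ‖p + t • z - c‖ + ‖h • u‖ := norm_add_le _ _
    _ ≤ (r - h) + h := by
      rw [norm_smul, hu, mul_one, Real.norm_of_nonneg hh0]; gcongr
    _ = r := by ring

/-- The outer normals of an `r`-hull come from touching discs. -/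
lemma rHull_inner_le_of_outerNormals {r : ℝ} (hr : 0 < r) {X : Set Plane} {p u y : Plane}
    (hp : p ∈ rHull r X) (hu : u ∈ outerNormals (rHull r X) p) (hy : y ∈ rHull r X) :
    inner ℝ u (y - p) ≤ -(‖y - p‖ ^ 2 / (2 * r)) := by
  -- The hull contains `p + t • (y - p)` pushed in the direction `u` by the uniform convexity bound;
  -- dividing by `t` and letting `t` tend to `0` gives the claim.
  have key : ∀ t ∈ Set.Ioo (0 : ℝ) 1, inner ℝ u (y - p) + (1 - t) * (‖y - p‖ ^ 2 / (2 * r)) ≤ 0 := by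
    intro t ht
    have hmem : p + t • (y - p) + (t * (1 - t) * ‖y - p‖ ^ 2 / (2 * r)) • u ∈ rHull r X := by
      refine mem_rHull_iff.2 fun c hc => ?_
      refine add_smul_mem_closedBall hr (Set.Ioo_subset_Icc_self ht) hu.1 (mem_rHull_iff.1 hp c hc) ?_
      rw [add_sub_cancel]
      exact mem_rHull_iff.1 hy c hc
    have := hu.2 _ hmem
    rw [add_assoc, add_sub_cancel_left, inner_add_right, inner_smul_right, inner_smul_right,
      real_inner_self_eq_norm_sq, hu.1] at this
    have h2 : t * (inner ℝ u (y - p) + (1 - t) * (‖y - p‖ ^ 2 / (2 * r))) ≤ 0 := by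
      refine le_trans (le_of_eq ?_) this
      ring
    exact nonpos_of_mul_nonpos_right h2 ht.1
  have hlim : Filter.Tendsto (fun t : ℝ => inner ℝ u (y - p) + (1 - t) * (‖y - p‖ ^ 2 / (2 * r)))
      (nhdsWithin 0 (Set.Ioi 0)) (nhds (inner ℝ u (y - p) + (1 - 0) * (‖y - p‖ ^ 2 / (2 * r)))) := by
    apply Filter.Tendsto.mono_left _ nhdsWithin_le_nhds
    exact Continuous.tendsto (by fun_prop) 0
  have := le_of_tendsto hlim (by
    filter_upwards [Ioo_mem_nhdsGT (zero_lt_one' ℝ)] with t ht using key t ht)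
  linarith

/-- The quarter turn. -/
def Plane.perp (x : Plane) : Plane := !₂[-x 1, x 0]

@[simp] lemma Plane.inner_perp_self (x : Plane) : inner ℝ (Plane.perp x) x = 0 := by
  simp [Plane.inner_eq, Plane.perp]; ring

@[simp] lemma Plane.norm_perp (x : Plane) : ‖Plane.perp x‖ = ‖x‖ := by
  rw [EuclideanSpace.norm_eq, EuclideanSpace.norm_eq]
  congr 1
  simp [Plane.perp, Fin.sum_univ_two]; ring

/-- Two different normals at `p` leave room along their sum: with `s = ‖u + w‖ < 2` and `R` slightly
larger than `r`, the disc of radius `r` around `p - (R / s) • (u + w)` contains all other points but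
not `p`. The slack `m` comes from the point nearest to `p`. -/
lemma vertices_rHull_subset {r : ℝ} (hr : 0 < r) {X : Set Plane} (hX : X.Finite) {p : Plane}
    (hp : p ∈ vertices (rHull r X)) : p ∈ X ∧ p ∉ rHull r (X \ {p}) := by
  suffices h : p ∉ rHull r (X \ {p}) by
    refine ⟨?_, h⟩
    by_contra hpX
    rw [Set.sdiff_singleton_eq_self hpX] at h
    exact h hp.1
  intro hpY
  obtain ⟨hpK, u, hu, w, hw, hne⟩ := hp
  have hfin : (X \ {p}).Finite := hX.subset Set.sdiff_subset
  have hYne : (X \ {p}).Nonempty := by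
    by_contra h
    rw [Set.not_nonempty_iff_eq_empty.1 h] at hpY
    simp at hpY
  obtain ⟨y₀, hy₀, hmin⟩ := hfin.exists_minimalFor (fun y => ‖y - p‖) _ hYne
  have hmin' : ∀ y ∈ X \ {p}, ‖y₀ - p‖ ≤ ‖y - p‖ := fun y hy => by
    rcases le_total ‖y₀ - p‖ ‖y - p‖ with h | h
    · exact h
    · exact hmin hy h
  have hpos : 0 < ‖y₀ - p‖ := norm_pos_iff.2 (sub_ne_zero.2 hy₀.2)
  have hin : ∀ y ∈ X \ {p}, inner ℝ (u + w) (y - p) ≤ -(‖y - p‖ ^ 2 / r) := by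
    intro y hy
    have hyK := subset_rHull r X hy.1
    have h1 := rHull_inner_le_of_outerNormals hr hpK hu hyK
    have h2 := rHull_inner_le_of_outerNormals hr hpK hw hyK
    rw [inner_add_left]
    have : ‖y - p‖ ^ 2 / r = ‖y - p‖ ^ 2 / (2 * r) + ‖y - p‖ ^ 2 / (2 * r) := by
      field_simp; norm_num
    linarith
  have hs0 : 0 < ‖u + w‖ := by
    rw [norm_pos_iff]
    intro h0
    have := hin y₀ hy₀
    rw [h0, inner_zero_left] at this
    have : 0 < ‖y₀ - p‖ ^ 2 / r := by positivity
    linarith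
  have hs2 : ‖u + w‖ < 2 := by
    have h1 : ‖u + w‖ ^ 2 = 2 + 2 * inner ℝ u w := by
      rw [norm_add_sq_real, hu.1, hw.1]; ring
    have h2 : inner ℝ u w < 1 := by
      refine lt_of_le_of_ne ?_ ?_
      · have := real_inner_le_norm u w; rwa [hu.1, hw.1, one_mul] at this
      · intro h; exact hne ((inner_eq_one_iff_of_norm_eq_one hu.1 hw.1).1 h)
    nlinarith
  set s := ‖u + w‖
  set m := (2 / s - 1) * ‖y₀ - p‖ ^ 2
  have hs3 : 0 < 2 / s - 1 := by
    rw [sub_pos, lt_div_iff₀ hs0]; linarith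
  have hm : 0 < m := by positivity
  set R := √(r ^ 2 + m)
  have hR2 : R ^ 2 = r ^ 2 + m := Real.sq_sqrt (by positivity)
  have hR : r < R := by
    refine Real.lt_sqrt_of_sq_lt ?_
    linarith
  have hR0 : 0 < R := hr.trans hR
  have := mem_rHull_iff.1 hpY (p - (R / s) • (u + w)) (fun y hy => ?_)
  · rw [mem_closedBall_iff_norm, sub_sub_cancel, norm_smul, Real.norm_of_nonneg (by positivity),
      div_mul_cancel₀ _ hs0.ne'] at this
    linarith
  · rw [mem_closedBall_iff_norm, ← pow_le_pow_iff_left₀ (norm_nonneg _) hr.le two_ne_zero,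
      show y - (p - (R / s) • (u + w)) = (R / s) • (u + w) + (y - p) by abel, norm_add_sq_real,
      norm_smul, real_inner_smul_left, Real.norm_of_nonneg (by positivity : 0 ≤ R / s),
      div_mul_cancel₀ _ hs0.ne', hR2]
    have h1 := mul_le_mul_of_nonneg_left (hin y hy) (by positivity : 0 ≤ R / s)
    have h2 : R / s * -(‖y - p‖ ^ 2 / r) ≤ -(‖y - p‖ ^ 2 / s) := by
      have : ‖y - p‖ ^ 2 / s ≤ R / s * (‖y - p‖ ^ 2 / r) := by
        rw [show R / s * (‖y - p‖ ^ 2 / r) = (R / r) * (‖y - p‖ ^ 2 / s) by ring]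
        exact le_mul_of_one_le_left (by positivity) ((one_le_div hr).2 hR.le)
      linarith
    have h3 : m ≤ (2 / s - 1) * ‖y - p‖ ^ 2 := by
      have := hmin' y hy
      simp only [m]
      gcongr
    have h4 : (2 / s - 1) * ‖y - p‖ ^ 2 = 2 * (‖y - p‖ ^ 2 / s) - ‖y - p‖ ^ 2 := by ring
    linarith

/-- Sliding a disc that contains `Y` but not `p` towards one that has `p` in its interior, `p` is on
the boundary at some moment. `Y` stays covered because the admissible centres form a convex set. -/
lemma exists_norm_eq_of_mem_of_notMem {r : ℝ} {Y : Set Plane} {p c c₀ : Plane}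
    (hY : Y ⊆ Metric.closedBall c r) (hY₀ : Y ⊆ Metric.closedBall c₀ r)
    (hp : r < ‖p - c‖) (hp₀ : ‖p - c₀‖ < r) :
    ∃ t ∈ Set.Ioo (0 : ℝ) 1, ‖p - (c + t • (c₀ - c))‖ = r ∧
      Y ⊆ Metric.closedBall (c + t • (c₀ - c)) r := by
  have hcont : ContinuousOn (fun t : ℝ => ‖p - (c + t • (c₀ - c))‖) (Set.Icc 0 1) := by fun_prop
  obtain ⟨t, ht, hte⟩ := intermediate_value_Ioo' zero_le_one hcont
    (show r ∈ Set.Ioo _ _ by simp [hp, hp₀])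
  refine ⟨t, ht, hte, fun y hy => ?_⟩
  have h1 := hY hy
  have h2 := hY₀ hy
  rw [mem_closedBall_iff_norm'] at *
  have : c + t • (c₀ - c) - y = (1 - t) • (c - y) + t • (c₀ - y) := by module
  rw [this]
  refine (norm_add_le _ _).trans ?_
  rw [norm_smul, norm_smul, Real.norm_of_nonneg ht.1.le, Real.norm_of_nonneg (by linarith [ht.2])]
  nlinarith [ht.1, ht.2]

/-- Sliding a separating disc towards two targets, `c₀` and a small sideways shift of it, produces
two different discs through `p` that contain `X`, hence two normals. -/
lemma mem_vertices_rHull {r : ℝ} (hr : 0 < r) {X : Set Plane} (hX : X.Finite) {c₀ : Plane}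
    (hX₀ : X ⊆ Metric.ball c₀ r) {p : Plane} (hpX : p ∈ X) (hp : p ∉ rHull r (X \ {p})) :
    p ∈ vertices (rHull r X) := by
  refine ⟨subset_rHull r X hpX, ?_⟩
  rw [mem_rHull_iff] at hp
  push Not at hp
  obtain ⟨c, hYc, hpc⟩ := hp
  rw [mem_closedBall_iff_norm, not_le] at hpc
  have hnormal : ∀ a, ‖p - a‖ = r → X \ {p} ⊆ Metric.closedBall a r →
      r⁻¹ • (p - a) ∈ outerNormals (rHull r X) p := by
    intro a ha hYa
    refine ⟨by rw [norm_smul, ha, Real.norm_of_nonneg (by positivity), inv_mul_cancel₀ hr.ne'],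
      fun y hy => ?_⟩
    have hXa : X ⊆ Metric.closedBall a r := by
      intro x hx
      by_cases h : x = p
      · rw [h, mem_closedBall_iff_norm, ha]
      · exact hYa ⟨hx, h⟩
    have hya := mem_closedBall_iff_norm.1 (mem_rHull_iff.1 hy a hXa)
    rw [real_inner_smul_left]
    refine mul_nonpos_of_nonneg_of_nonpos (by positivity) ?_
    rw [show y - p = (y - a) - (p - a) by abel, inner_sub_right, real_inner_self_eq_norm_sq, ha]
    have := real_inner_le_norm (p - a) (y - a)
    rw [ha] at this
    nlinarith
  have hpc₀ : ‖p - c₀‖ < r := mem_ball_iff_norm.1 (hX₀ hpX)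
  have hcc : c ≠ c₀ := by rintro rfl; linarith
  set d := Plane.perp (c - c₀)
  have hd : 0 < ‖d‖ := by simpa [d, sub_eq_zero] using hcc
  have hev : ∀ᶠ s in nhds (0 : ℝ), ∀ x ∈ X, ‖x - (c₀ + s • d)‖ < r := by
    rw [Filter.eventually_all_finite hX]
    intro x hx
    have : ContinuousAt (fun s : ℝ => ‖x - (c₀ + s • d)‖) 0 := by fun_prop
    exact this.eventually_lt continuousAt_const (by simpa using mem_ball_iff_norm.1 (hX₀ hx))
  obtain ⟨s, hs, hs0⟩ := ((hev.filter_mono nhdsWithin_le_nhds).and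
    (self_mem_nhdsWithin : Set.Ioi (0 : ℝ) ∈ nhdsWithin 0 (Set.Ioi 0))).exists
  obtain ⟨t, ht, hte, htY⟩ := exists_norm_eq_of_mem_of_notMem hYc
    (Set.sdiff_subset.trans (hX₀.trans Metric.ball_subset_closedBall)) hpc hpc₀
  obtain ⟨t', ht', hte', htY'⟩ := exists_norm_eq_of_mem_of_notMem (c₀ := c₀ + s • d) hYc
    (fun x hx => mem_closedBall_iff_norm.2 (hs x hx.1).le) hpc (hs p hpX)
  refine ⟨_, hnormal _ hte htY, _, hnormal _ hte' htY', fun h => ?_⟩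
  have h2 := smul_right_injective Plane (inv_ne_zero hr.ne') h
  have h3 : t • (c₀ - c) = t' • (c₀ + s • d - c) := by
    have := sub_right_injective h2
    exact add_left_cancel this
  have h4 := congrArg (inner ℝ d) h3
  have h5 : inner ℝ d (c₀ - c) = 0 := by
    rw [← neg_sub, inner_neg_right, Plane.inner_perp_self, neg_zero]
  rw [inner_smul_right, inner_smul_right, h5, show c₀ + s • d - c = (c₀ - c) + s • d by abel,
    inner_add_right, h5, inner_smul_right, real_inner_self_eq_norm_sq] at h4
  have : 0 < t' * (0 + s * ‖d‖ ^ 2) := by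
    have := ht'.1
    have : 0 < s := hs0
    positivity
  linarith

/-- The vertices of the `r`-hull of finitely many points are the points outside the hull of the
others. -/
lemma f₀_rHull_range {r : ℝ} (hr : 0 < r) {m : ℕ} {x : Fin (m + 1) → Plane}
    (hx : Function.Injective x) {c₀ : Plane} (hc₀ : Set.range x ⊆ Metric.ball c₀ r) :
    (f₀ (rHull r (Set.range x)) : ℝ) = ∑ i, Set.indicator
      {x : Fin (m + 1) → Plane | x i ∉ rHull r (Set.range (i.removeNth x))} (fun _ => (1 : ℝ)) x := by
  classical
  have hr' : ∀ i, Set.range x \ {x i} = Set.range (i.removeNth x) := by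
    intro i
    have : i.removeNth x = x ∘ i.succAbove := rfl
    rw [this, Set.range_comp, Fin.range_succAbove, Set.image_compl_eq_range_sdiff_image hx,
      Set.image_singleton]
  have hv : vertices (rHull r (Set.range x)) =
      x '' {i | x i ∉ rHull r (Set.range (i.removeNth x))} := by
    ext p
    constructor
    · intro hp
      obtain ⟨⟨i, rfl⟩, h⟩ := vertices_rHull_subset hr (Set.finite_range x) hp
      exact ⟨i, by rwa [Set.mem_ofPred_eq, ← hr'], rfl⟩
    · rintro ⟨i, hi, rfl⟩
      refine mem_vertices_rHull hr (Set.finite_range x) hc₀ ⟨i, rfl⟩ ?_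
      rwa [hr']
  rw [f₀, hv, Set.ncard_image_of_injective _ hx]
  simp only [Set.indicator_apply, Set.mem_ofPred_eq]
  rw [Finset.sum_boole, Set.ncard_eq_toFinset_card']
  congr 2
  ext i; simp

/-! ### Discs through two points and the first edge at a missed point -/

/-- The centre of the disc of radius `r` whose boundary runs counterclockwise from `y` to `x` along
a short arc. -/
def arcCentre (r : ℝ) (y x : Plane) : Plane :=
  y + ((1 / 2 : ℝ) • (x - y) + (√(r ^ 2 - ‖x - y‖ ^ 2 / 4) / ‖x - y‖) • Plane.perp (x - y))

lemma Plane.continuous_perp : Continuous Plane.perp := by unfold Plane.perp; fun_prop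

@[fun_prop] lemma Plane.measurable_perp : Measurable Plane.perp :=
  Plane.continuous_perp.measurable

@[fun_prop] lemma Measurable.arcCentre {α : Type*} [MeasurableSpace α] (r : ℝ) {f g : α → Plane}
    (hf : Measurable f) (hg : Measurable g) : Measurable fun a => arcCentre r (f a) (g a) := by
  unfold _root_.arcCentre
  fun_prop

lemma Plane.perp_smul_unitVec (ρ α : ℝ) :
    Plane.perp (ρ • unitVec α) = ρ • unitVec (α + Real.pi / 2) := by
  apply Plane.ext' <;> simp [Plane.perp, Real.cos_add_pi_div_two, Real.sin_add_pi_div_two]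

lemma arcCentre_add (r : ℝ) (y w : Plane) : arcCentre r y (y + w) = y + arcCentre r 0 w := by
  simp [arcCentre]

lemma arcCentre_polar {r : ℝ} (hr : 0 < r) {κ : ℝ} (hκ : κ ∈ Set.Ico 0 (Real.pi / 2)) (y : Plane)
    (α : ℝ) : arcCentre r y (y + (2 * r * Real.cos κ) • unitVec α) = y + r • unitVec (α + κ) := by
  have hc : 0 < Real.cos κ := Real.cos_pos_of_mem_Ioo ⟨by linarith [hκ.1, Real.pi_pos], hκ.2⟩
  have hs : 0 ≤ Real.sin κ :=
    Real.sin_nonneg_of_nonneg_of_le_pi hκ.1 (by linarith [hκ.2, Real.pi_pos])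
  rw [arcCentre, add_sub_cancel_left, Plane.perp_smul_unitVec, norm_smul, norm_unitVec, mul_one,
    Real.norm_of_nonneg (by positivity),
    show r ^ 2 - (2 * r * Real.cos κ) ^ 2 / 4 = (r * Real.sin κ) ^ 2 by
      rw [mul_pow r, Real.sin_sq]; ring, Real.sqrt_sq (by positivity), unitVec_add α κ]
  rw [smul_smul, smul_smul, smul_add, smul_smul, smul_smul, div_mul_cancel₀ _ (by positivity)]
  congr 3
  ring

/-- Every short chord has the polar form used in `arcCentre_polar`. -/
lemma exists_chord_polar {r : ℝ} (hr : 0 < r) {z : Plane} (hz : z ≠ 0) (hz2 : ‖z‖ < 2 * r)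
    (θ : ℝ) : ∃ κ ∈ Set.Ioo 0 (Real.pi / 2), ∃ α, θ - α - Real.pi ∈ Set.Ioc (-Real.pi) Real.pi ∧
      z = (2 * r * Real.cos κ) • unitVec α := by
  obtain ⟨α, -, hα⟩ := exists_eq_norm_smul_unitVec z
  have h0 : 0 < ‖z‖ := norm_pos_iff.2 hz
  have h1 : ‖z‖ / (2 * r) < 1 := by rw [div_lt_one (by positivity)]; exact hz2
  have h2 : 0 < ‖z‖ / (2 * r) := by positivity
  obtain ⟨k, hk, -⟩ := existsUnique_add_zsmul_mem_Ioc (a := 2 * Real.pi)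
    (by linarith [Real.pi_pos]) (θ - α - Real.pi) (-Real.pi)
  rw [zsmul_eq_mul] at hk
  refine ⟨Real.arccos (‖z‖ / (2 * r)), ⟨Real.arccos_pos.2 h1, Real.arccos_lt_pi_div_two.2 h2⟩,
    α + (-k : ℤ) * (2 * Real.pi), ⟨?_, ?_⟩, ?_⟩
  · push_cast; linarith [hk.1]
  · push_cast; linarith [hk.2]
  · rw [unitVec_add_int_mul, Real.cos_arccos (by linarith) h1.le]
    field_simp
    exact hα

/-- The disc through `y` with outer normal `ψ` at `y` contains the other end of the chord exactly
when `ψ` is within `κ` of `α + π` modulo a full turn. -/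
lemma norm_chord_add_le_iff {r : ℝ} (hr : 0 < r) {κ : ℝ} (hκ : κ ∈ Set.Ioo 0 (Real.pi / 2))
    (α ψ : ℝ) : ‖(2 * r * Real.cos κ) • unitVec α + r • unitVec ψ‖ ≤ r ↔
      Real.cos κ ≤ Real.cos (ψ - α - Real.pi) := by
  have hc : 0 < Real.cos κ := Real.cos_pos_of_mem_Ioo ⟨by linarith [hκ.1, Real.pi_pos], hκ.2⟩
  rw [← pow_le_pow_iff_left₀ (norm_nonneg _) hr.le two_ne_zero, norm_add_sq_real, norm_smul,
    norm_smul, norm_unitVec, norm_unitVec, real_inner_smul_left, real_inner_smul_right,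
    inner_unitVec, Real.norm_of_nonneg (by positivity), Real.norm_of_nonneg hr.le, Real.cos_sub_pi,
    ← Real.cos_neg (α - ψ), neg_sub]
  have : (2 * r * Real.cos κ * 1) ^ 2 + 2 * (2 * r * Real.cos κ * (r * Real.cos (ψ - α))) +
      (r * 1) ^ 2 - r ^ 2 = (4 * r ^ 2 * Real.cos κ) * (Real.cos κ + Real.cos (ψ - α)) := by ring
  have h4 : 0 < 4 * r ^ 2 * Real.cos κ := by positivity
  constructor
  · intro h
    have : (4 * r ^ 2 * Real.cos κ) * (Real.cos κ + Real.cos (ψ - α)) ≤ 0 := by linarith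
    have := nonpos_of_mul_nonpos_right this h4
    linarith
  · intro h
    have := mul_nonpos_of_nonneg_of_nonpos h4.le (show Real.cos κ + Real.cos (ψ - α) ≤ 0 by linarith)
    linarith

lemma cos_le_cos_iff_of_mem {κ x : ℝ} (hκ : κ ∈ Set.Ioo 0 (Real.pi / 2))
    (hx : x ∈ Set.Ico (-κ) (Real.pi + κ)) : Real.cos κ ≤ Real.cos x ↔ x ≤ κ := by
  have h1 := hκ.1; have h2 := hκ.2; have h3 := hx.1; have h4 := hx.2
  constructor
  · intro h
    by_contra! hlt
    rcases le_total x Real.pi with h5 | h5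
    · exact absurd h (not_le.2 (Real.cos_lt_cos_of_nonneg_of_le_pi h1.le h5 hlt))
    · have : Real.cos x = Real.cos (2 * Real.pi - x) := by rw [Real.cos_two_pi_sub]
      rw [this] at h
      exact absurd h (not_le.2 (Real.cos_lt_cos_of_nonneg_of_le_pi h1.le (by linarith)
        (by linarith)))
  · intro h
    rw [← Real.cos_abs x]
    exact Real.cos_le_cos_of_nonneg_of_le_pi (abs_nonneg x) (by linarith) (abs_le.2 ⟨h3, h⟩)

section Hull

variable {r : ℝ} {ι : Type*} {y c₀ : Plane} {x : ι → Plane}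

lemma norm_sub_arcCentre {r : ℝ} (hr : 0 < r) {y x : Plane} (hne : x ≠ y) (h2 : ‖x - y‖ < 2 * r) :
    ‖y - arcCentre r y x‖ = r ∧ ‖x - arcCentre r y x‖ = r := by
  obtain ⟨κ, hκ, α, -, hz⟩ := exists_chord_polar hr (sub_ne_zero.2 hne) h2 0
  have hx : x = y + (2 * r * Real.cos κ) • unitVec α := by rw [← hz]; abel
  rw [hx, arcCentre_polar hr ⟨hκ.1.le, hκ.2⟩]
  constructor
  · rw [sub_add_cancel_left, norm_neg, norm_smul, norm_unitVec, Real.norm_of_nonneg hr.le, mul_one]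
  · rw [add_sub_add_left_eq_sub]
    have : (2 * r * Real.cos κ) • unitVec α - r • unitVec (α + κ) = r • unitVec (α - κ) := by
      apply Plane.ext' <;> simp [Real.cos_sub, Real.cos_add, Real.sin_sub, Real.sin_add] <;> ring
    rw [this, norm_smul, norm_unitVec, Real.norm_of_nonneg hr.le, mul_one]

/-- The discs through `y` that contain `x k` have their outer normals at `y` in an arc; its upper
end `b k` is the normal of the disc given by `arcCentre`. The disc of `x j` contains `x k` iff `b j
≤ b k`, so the minimum of `b` is the first edge, and general position excludes ties. -/
lemma exists_unique_arcCentre [Finite ι] (hr : 0 < r) (hy : y ∈ Metric.ball c₀ r)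
    (hx : ∀ k, x k ∈ Metric.ball c₀ r) (hne : ∀ k, x k ≠ y) [Nonempty ι]
    (hgen : ∀ j k, j ≠ k → ‖x k - arcCentre r y (x j)‖ ≠ r)
    (hyx : y ∉ rHull r (Set.range x)) :
    ∃! j, ∀ k, x k ∈ Metric.closedBall (arcCentre r y (x j)) r := by
  rw [mem_rHull_iff] at hyx
  push Not at hyx
  obtain ⟨c, hc, hyc⟩ := hyx
  rw [mem_closedBall_iff_norm, not_le] at hyc
  have hx₀ : Set.range x ⊆ Metric.closedBall c₀ r := by
    rintro _ ⟨k, rfl⟩; exact Metric.ball_subset_closedBall (hx k)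
  -- One disc through `y` containing the sample supplies a normal `θ` common to all these arcs;
  -- angles measured from it can be compared as real numbers.
  obtain ⟨t, -, hta, htX⟩ := exists_norm_eq_of_mem_of_notMem hc hx₀ hyc (mem_ball_iff_norm.1 hy)
  set a := c + t • (c₀ - c)
  obtain ⟨θ, -, hθ⟩ := exists_eq_norm_smul_unitVec (y - a)
  rw [hta] at hθ
  have hz2 : ∀ k, ‖x k - y‖ < 2 * r := by
    intro k
    have h1 := hx k
    rw [mem_ball_iff_norm] at h1 hy
    calc ‖x k - y‖ = ‖(x k - c₀) - (y - c₀)‖ := by congr 1; abel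
      _ ≤ ‖x k - c₀‖ + ‖y - c₀‖ := norm_sub_le _ _
      _ < 2 * r := by linarith
  choose κ hκ α hα hz using fun k => exists_chord_polar hr (sub_ne_zero.2 (hne k)) (hz2 k) θ
  have hxk : ∀ k, x k = y + (2 * r * Real.cos (κ k)) • unitVec (α k) := by
    intro k; rw [← hz]; abel
  have hpi := Real.pi_pos
  have hθκ : ∀ k, |θ - α k - Real.pi| ≤ κ k := by
    intro k
    have h1 : ‖x k - a‖ ≤ r := mem_closedBall_iff_norm.1 (htX ⟨k, rfl⟩)
    rw [hxk, show y + (2 * r * Real.cos (κ k)) • unitVec (α k) - a =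
      (2 * r * Real.cos (κ k)) • unitVec (α k) + (y - a) by abel, hθ,
      norm_chord_add_le_iff hr (hκ k)] at h1
    by_contra! h
    have h2 : |θ - α k - Real.pi| ≤ Real.pi := abs_le.2 ⟨(hα k).1.le, (hα k).2⟩
    have := Real.cos_lt_cos_of_nonneg_of_le_pi (hκ k).1.le h2 h
    rw [Real.cos_abs] at this
    linarith
  set b : ι → ℝ := fun k => α k + Real.pi + κ k with hb
  have hcen : ∀ k, arcCentre r y (x k) = y - r • unitVec (b k) := by
    intro k
    rw [hxk, arcCentre_polar hr ⟨(hκ k).1.le, (hκ k).2⟩, hb]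
    simp only
    rw [show α k + Real.pi + κ k = α k + κ k + Real.pi by ring, unitVec_add_pi]
    simp
  have hmem : ∀ j k, x k ∈ Metric.closedBall (arcCentre r y (x j)) r ↔ b j ≤ b k := by
    intro j k
    have hj := abs_le.1 (hθκ j)
    have hk := abs_le.1 (hθκ k)
    rw [mem_closedBall_iff_norm, hcen, hxk, show y + (2 * r * Real.cos (κ k)) • unitVec (α k) -
      (y - r • unitVec (b j)) = (2 * r * Real.cos (κ k)) • unitVec (α k) + r • unitVec (b j) by abel,
      norm_chord_add_le_iff hr (hκ k), cos_le_cos_iff_of_mem (hκ k)]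
    · simp only [hb]; constructor <;> intro h <;> linarith
    · simp only [hb]
      constructor <;> linarith [(hκ j).1, (hκ j).2, (hκ k).1]
  obtain ⟨j, hj⟩ := Finite.exists_min b
  refine ⟨j, fun k => (hmem j k).2 (hj k), fun j' hj' => ?_⟩
  by_contra hne'
  have h1 := (hmem j' j).1 (hj' j)
  have h2 : b j = b j' := le_antisymm (hj j') h1
  refine hgen j j' (Ne.symm hne') ?_
  rw [hcen, h2, ← hcen]
  exact (norm_sub_arcCentre hr (hne j') (hz2 j')).2

/-- Shifting the disc slightly in the direction from `y` to `x j` keeps `x j`, keeps the other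
points, which are in the interior by general position, and loses `y`. -/
lemma notMem_rHull_of_arcCentre [Finite ι] (hr : 0 < r) (hne : ∀ k, x k ≠ y)
    (hz2 : ∀ k, ‖x k - y‖ < 2 * r) (hgen : ∀ j k, j ≠ k → ‖x k - arcCentre r y (x j)‖ ≠ r) {j : ι}
    (hj : ∀ k, x k ∈ Metric.closedBall (arcCentre r y (x j)) r) :
    y ∉ rHull r (Set.range x) := by
  obtain ⟨hyc, hxc⟩ := norm_sub_arcCentre hr (hne j) (hz2 j)
  set c := arcCentre r y (x j)
  set w := x j - y with hw
  have hw0 : 0 < ‖w‖ := norm_pos_iff.2 (sub_ne_zero.2 (hne j))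
  have hwx : 2 * inner ℝ (x j - c) w = ‖w‖ ^ 2 := by
    have : ‖y - c‖ ^ 2 = ‖(x j - c) - w‖ ^ 2 := by congr 2; simp only [hw]; abel
    rw [norm_sub_sq_real (x j - c) w, hxc, hyc] at this
    linarith
  have hwy : 2 * inner ℝ (y - c) w = -‖w‖ ^ 2 := by
    have : ‖x j - c‖ ^ 2 = ‖(y - c) + w‖ ^ 2 := by congr 2; simp only [hw]; abel
    rw [norm_add_sq_real (y - c) w, hxc, hyc] at this
    linarith
  have hev : ∀ᶠ s in nhds (0 : ℝ), ∀ k, k ≠ j → ‖x k - (c + s • w)‖ < r := by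
    rw [Filter.eventually_all]
    intro k
    by_cases hk : k = j
    · simp [hk]
    simp only [ne_eq, hk, not_false_eq_true, forall_const]
    have : ContinuousAt (fun s : ℝ => ‖x k - (c + s • w)‖) 0 := by fun_prop
    refine this.eventually_lt continuousAt_const ?_
    simpa using lt_of_le_of_ne (mem_closedBall_iff_norm.1 (hj k)) (hgen j k (Ne.symm hk))
  obtain ⟨s, hs, hs0, hs1⟩ := ((hev.filter_mono nhdsWithin_le_nhds).and
    (Ioo_mem_nhdsGT (zero_lt_one' ℝ))).exists
  intro hy
  have h1 := mem_rHull_iff.1 hy (c + s • w) (by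
    rintro _ ⟨k, rfl⟩
    rw [mem_closedBall_iff_norm]
    by_cases hk : k = j
    · subst hk
      rw [← pow_le_pow_iff_left₀ (norm_nonneg _) hr.le two_ne_zero, ← sub_sub, norm_sub_sq_real,
        norm_smul, inner_smul_right, hxc, mul_pow, Real.norm_eq_abs, sq_abs]
      nlinarith [sq_nonneg ‖w‖, mul_pos hs0 (pow_pos hw0 2)]
    · exact (hs k hk).le)
  rw [mem_closedBall_iff_norm, ← pow_le_pow_iff_left₀ (norm_nonneg _) hr.le two_ne_zero, ← sub_sub,
    norm_sub_sq_real, norm_smul, inner_smul_right, hyc, mul_pow, Real.norm_eq_abs, sq_abs] at h1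
  nlinarith [mul_pos hs0 (pow_pos hw0 2), mul_pos (pow_pos hs0 2) (pow_pos hw0 2)]

end Hull

/-! ### The probability of missing a point -/

/-- The pairs of a point and a sample whose `r`-hull misses the point. -/
def missSet (r : ℝ) (m : ℕ) : Set (Plane × (Fin m → Plane)) :=
  {q | q.1 ∉ rHull r (Set.range q.2)}

/-- The existence of an excluding disc is a projection. Centres can be confined to a compact ball
around the first sample point, and the strict inequality is a countable union of closed conditions,
so each projection is closed. The hull of no points is empty, hence the separate case. -/
lemma measurableSet_missSet (r : ℝ) (m : ℕ) : MeasurableSet (missSet r m) := by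
  rcases m with _ | m
  · convert MeasurableSet.univ
    ext q
    simp [missSet, Set.range_eq_empty]
  have : missSet r (m + 1) = ⋃ n : ℕ, Prod.snd ''
      {q : Metric.closedBall (0 : Plane) r × (Plane × (Fin (m + 1) → Plane)) |
        (∀ k, ‖q.2.2 k - (q.2.2 0 + q.1)‖ ≤ r) ∧
          r + 1 / ((n : ℝ) + 1) ≤ ‖q.2.1 - (q.2.2 0 + q.1)‖} := by
    ext ⟨y, x⟩
    simp only [missSet, Set.mem_ofPred_eq, mem_rHull_iff, not_forall, Set.mem_iUnion, Set.mem_image,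
      Prod.exists, exists_eq_right]
    constructor
    · rintro ⟨c, hc, hy⟩
      rw [mem_closedBall_iff_norm, not_le] at hy
      obtain ⟨n, hn⟩ := exists_nat_one_div_lt (sub_pos.2 hy)
      refine ⟨n, ⟨⟨c - x 0, ?_⟩, fun k => ?_, ?_⟩⟩
      · have := hc ⟨0, rfl⟩
        rw [mem_closedBall_iff_norm'] at this
        rwa [mem_closedBall_zero_iff]
      · simpa using mem_closedBall_iff_norm.1 (hc ⟨k, rfl⟩)
      · simp only [add_sub_cancel]; linarith
    · rintro ⟨n, ⟨⟨b, hb⟩, h1, h2⟩⟩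
      refine ⟨x 0 + b, ?_, ?_⟩
      · rintro _ ⟨k, rfl⟩
        exact mem_closedBall_iff_norm.2 (h1 k)
      · rw [mem_closedBall_iff_norm, not_le]
        have : (0 : ℝ) < 1 / ((n : ℝ) + 1) := by positivity
        simp only at h2
        linarith
  rw [this]
  refine MeasurableSet.iUnion fun n => IsClosed.measurableSet ?_
  have : CompactSpace (Metric.closedBall (0 : Plane) r) :=
    isCompact_iff_compactSpace.1 (isCompact_closedBall 0 r)
  refine isClosedMap_snd_of_compactSpace _ ?_
  simp only [Set.ofPred_and, Set.ofPred_forall]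
  refine (isClosed_iInter fun k => isClosed_le ?_ continuous_const).inter
    (isClosed_le continuous_const ?_)
  · fun_prop
  · fun_prop

lemma ae_pi_pair_notMem {m : ℕ} (μ : Measure Plane) [IsProbabilityMeasure μ]
    {S : Set (Plane × Plane)} (hS : MeasurableSet S) (h : ∀ a, μ (Prod.mk a ⁻¹' S) = 0)
    {i j : Fin m} (hij : i ≠ j) :
    ∀ᵐ x ∂(Measure.pi fun _ : Fin m => μ), (x i, x j) ∉ S := by
  rcases m with _ | m
  · exact i.elim0
  obtain ⟨k, rfl⟩ := Fin.exists_succAbove_eq hij.symm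
  have hmp := measurePreserving_piFinSuccAbove (fun _ : Fin (m + 1) => μ) i
  have : ∀ᵐ q ∂(μ.prod (Measure.pi fun _ : Fin m => μ)), (q.1, q.2 k) ∉ S := by
    rw [Measure.ae_prod_iff_ae_ae]
    · refine Filter.Eventually.of_forall fun a => ?_
      have hev := measurePreserving_eval (fun _ : Fin m => μ) k
      exact hev.quasiMeasurePreserving.ae (p := fun b => (a, b) ∉ S) (by
        rw [ae_iff]; convert h a using 2; ext; simp)
    · have : Measurable fun q : Plane × (Fin m → Plane) => (q.1, q.2 k) := by fun_prop
      exact (this hS).compl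
  exact hmp.quasiMeasurePreserving.ae this

section

variable {r : ℝ} {c₀ : Plane} (μ : Measure Plane) [IsProbabilityMeasure μ]

lemma measurable_measure_closedBall (r : ℝ) :
    Measurable fun c => μ (Metric.closedBall c r) := by
  have hS : MeasurableSet {q : Plane × Plane | dist q.2 q.1 ≤ r} :=
    (isClosed_le (by fun_prop) continuous_const).measurableSet
  exact measurable_measure_prodMk_left hS

/-- Given two points, a third one falls on the circle of their disc with probability zero. -/
lemma ae_general_position (hr : 0 < r) (hμ : μ ≪ volume) (hb : ∀ᵐ x ∂μ, x ∈ Metric.ball c₀ r) (m : ℕ) :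
    ∀ᵐ q ∂(μ.prod (Measure.pi fun _ : Fin m => μ)), (q.1 ∈ Metric.ball c₀ r ∧
      (∀ k, q.2 k ∈ Metric.ball c₀ r)) ∧ (∀ k, q.2 k ≠ q.1) ∧
      ∀ j k, j ≠ k → ‖q.2 k - arcCentre r q.1 (q.2 j)‖ ≠ r := by
  refine Filter.Eventually.and (Filter.Eventually.and ?_ ?_) (Filter.Eventually.and ?_ ?_)
  · exact (Measure.quasiMeasurePreserving_fst).ae hb
  · rw [ae_all_iff]
    intro k
    exact ((measurePreserving_eval (fun _ : Fin m => μ) k).quasiMeasurePreserving.comp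
      Measure.quasiMeasurePreserving_snd).ae hb
  · rw [ae_all_iff]
    intro k
    rw [Measure.ae_prod_iff_ae_ae]
    · refine Filter.Eventually.of_forall fun a => ?_
      refine (measurePreserving_eval (fun _ : Fin m => μ) k).quasiMeasurePreserving.ae
        (p := fun b => b ≠ a) (hμ.ae_le ?_)
      exact measure_eq_zero_iff_ae_notMem.1 (measure_singleton a)
    · exact (measurableSet_eq_fun (by fun_prop) (by fun_prop)).compl
  · rw [ae_all_iff]
    intro j
    rw [ae_all_iff]
    intro k
    by_cases hjk : j = k
    · simp [hjk]
    simp only [ne_eq, hjk, not_false_eq_true, forall_const]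
    rw [Measure.ae_prod_iff_ae_ae]
    · refine Filter.Eventually.of_forall fun y => ?_
      refine ae_pi_pair_notMem μ (S := {p | ‖p.2 - arcCentre r y p.1‖ = r}) ?_ ?_ hjk
      · exact measurableSet_eq_fun (by fun_prop) (by fun_prop)
      · intro a
        refine hμ ?_
        have : Prod.mk a ⁻¹' {p : Plane × Plane | ‖p.2 - arcCentre r y p.1‖ = r} =
            Metric.sphere (arcCentre r y a) r := by
          ext b; simp
        rw [this]
        exact Measure.addHaar_sphere_of_ne_zero _ _ hr.ne'
    · exact (measurableSet_eq_fun (by fun_prop) (by fun_prop)).compl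

/-- The probability that the `r`-hull of a sample misses a random point, by the first edge at that
point. -/
lemma measure_missSet (hr : 0 < r) (hμ : μ ≪ volume) (hb : ∀ᵐ x ∂μ, x ∈ Metric.ball c₀ r) (m : ℕ) :
    (μ.prod (Measure.pi fun _ : Fin (m + 1) => μ)) (missSet r (m + 1)) =
      (m + 1) * ∫⁻ y, ∫⁻ z, (μ (Metric.closedBall (arcCentre r y z) r)) ^ m ∂μ ∂μ := by
  classical
  set ν := Measure.pi fun _ : Fin (m + 1) => μ
  set T : Fin (m + 1) → Set (Plane × (Fin (m + 1) → Plane)) := fun j =>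
    {q | ∀ k, ‖q.2 k - arcCentre r q.1 (q.2 j)‖ ≤ r} with hT
  have hTm : ∀ j, MeasurableSet (T j) := fun j => by
    simp only [hT, Set.ofPred_forall]
    exact MeasurableSet.iInter fun k => measurableSet_le (by fun_prop) (by fun_prop)
  -- Uniqueness of the first edge makes the events `T j` almost surely a partition of the miss
  -- event.
  have hind : ∀ᵐ q ∂(μ.prod ν), (missSet r (m + 1)).indicator (1 : Plane × (Fin (m + 1) → Plane) → ENNReal) q =
      ∑ j, (T j).indicator (1 : Plane × (Fin (m + 1) → Plane) → ENNReal) q := by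
    filter_upwards [ae_general_position μ hr hμ hb (m + 1)] with q ⟨⟨h1, h2⟩, h3, h4⟩
    by_cases hq : q ∈ missSet r (m + 1)
    · obtain ⟨j, hj, huniq⟩ := exists_unique_arcCentre hr h1 h2 h3 h4 hq
      rw [Set.indicator_of_mem hq, Finset.sum_eq_single j]
      · rw [Set.indicator_of_mem]
        exact fun k => mem_closedBall_iff_norm.1 (hj k)
      · intro i _ hij
        rw [Set.indicator_of_notMem]
        intro hi
        exact hij (huniq i fun k => mem_closedBall_iff_norm.2 (hi k))
      · simp
    · rw [Set.indicator_of_notMem hq, Finset.sum_eq_zero]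
      intro j _
      rw [Set.indicator_of_notMem]
      intro hj
      refine hq (notMem_rHull_of_arcCentre hr h3 ?_ h4 (fun k => mem_closedBall_iff_norm.2 (hj k)))
      intro k
      have e1 := h2 k
      rw [mem_ball_iff_norm] at e1 h1
      calc ‖q.2 k - q.1‖ = ‖(q.2 k - c₀) - (q.1 - c₀)‖ := by congr 1; abel
        _ ≤ ‖q.2 k - c₀‖ + ‖q.1 - c₀‖ := norm_sub_le _ _
        _ < 2 * r := by linarith
  have hTj : ∀ j, (μ.prod ν) (T j) =
      ∫⁻ y, ∫⁻ z, (μ (Metric.closedBall (arcCentre r y z) r)) ^ m ∂μ ∂μ := by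
    intro j
    rw [Measure.prod_apply (hTm j)]
    refine lintegral_congr_ae ?_
    filter_upwards [hb] with y hy
    have hmp := measurePreserving_piFinSuccAbove (fun _ : Fin (m + 1) => μ) j
    set U : Set (Plane × (Fin m → Plane)) := {q | ‖q.1 - arcCentre r y q.1‖ ≤ r ∧
      ∀ k, ‖q.2 k - arcCentre r y q.1‖ ≤ r} with hU
    have hUm : MeasurableSet U := by
      simp only [hU, Set.ofPred_and, Set.ofPred_forall]
      exact (measurableSet_le (by fun_prop) (by fun_prop)).inter
        (MeasurableSet.iInter fun k => measurableSet_le (by fun_prop) (by fun_prop))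
    have hpre : Prod.mk y ⁻¹' T j = (MeasurableEquiv.piFinSuccAbove (fun _ => Plane) j) ⁻¹' U := by
      ext x
      simp only [hT, hU, Set.mem_preimage, Set.mem_ofPred_eq, MeasurableEquiv.piFinSuccAbove_apply,
        Fin.insertNthEquiv_symm_apply]
      rw [Fin.forall_iff_succAbove j]
      rfl
    rw [hpre, hmp.measure_preimage hUm.nullMeasurableSet, Measure.prod_apply hUm]
    refine lintegral_congr_ae ?_
    have hne : ∀ᵐ z ∂μ, z ≠ y :=
      hμ.ae_le (measure_eq_zero_iff_ae_notMem.1 (measure_singleton y))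
    filter_upwards [hb, hne] with z hz hzy
    have h2 : ‖z - y‖ < 2 * r := by
      rw [mem_ball_iff_norm] at hz hy
      calc ‖z - y‖ = ‖(z - c₀) - (y - c₀)‖ := by congr 1; abel
        _ ≤ ‖z - c₀‖ + ‖y - c₀‖ := norm_sub_le _ _
        _ < 2 * r := by linarith
    -- The point `x j` lies on the boundary of its own disc, so only the other `m` points are
    -- constrained; this is the exponent `m`.
    have hsec : Prod.mk z ⁻¹' U =
        Set.univ.pi fun _ => Metric.closedBall (arcCentre r y z) r := by
      ext x
      simp only [hU, Set.mem_preimage, Set.mem_ofPred_eq, Set.mem_univ_pi, mem_closedBall_iff_norm,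
        and_iff_right_iff_imp]
      exact fun _ => (norm_sub_arcCentre hr hzy h2).2.le
    rw [hsec, Measure.pi_pi]
    simp
  rw [← lintegral_indicator_one (measurableSet_missSet r (m + 1)), lintegral_congr_ae hind,
    lintegral_finsetSum _ fun j _ => measurable_one.indicator (hTm j)]
  simp_rw [lintegral_indicator_one (hTm _), hTj]
  simp

/-! ### From pairs of points to centres of discs -/

/-- The measure of the chords of the circle of radius `r` around `c` with both end points in `P`. -/
def chordMeasure (r : ℝ) (P : Set Plane) (c : Plane) : ENNReal :=
  volume {w : Plane | ‖w‖ < 2 * r ∧ c - arcCentre r 0 w ∈ P ∧ c - arcCentre r 0 w + w ∈ P}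

lemma measurableSet_chords {P : Set Plane} (hP : MeasurableSet P) :
    MeasurableSet {q : Plane × Plane | ‖q.2‖ < 2 * r ∧ q.1 - arcCentre r 0 q.2 ∈ P ∧
      q.1 - arcCentre r 0 q.2 + q.2 ∈ P} := by
  have h1 : Measurable fun q : Plane × Plane => q.1 - arcCentre r 0 q.2 := by fun_prop
  have h2 : Measurable fun q : Plane × Plane => q.1 - arcCentre r 0 q.2 + q.2 := by fun_prop
  exact (measurableSet_lt measurable_snd.norm measurable_const).inter ((h1 hP).inter (h2 hP))

lemma measurable_chordMeasure {P : Set Plane} (hP : MeasurableSet P) :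
    Measurable (chordMeasure r P) :=
  measurable_measure_prodMk_left (measurableSet_chords (r := r) hP)

/-- Integration over pairs of points of `P`, as integration over the centres of discs. -/
lemma lintegral_pairs (hr : 0 < r) {P : Set Plane} (hP : MeasurableSet P)
    (hb : P ⊆ Metric.closedBall c₀ r) {F : Plane → ENNReal} (hF : Measurable F) :
    ∫⁻ y in P, ∫⁻ z in P, F (arcCentre r y z) = ∫⁻ c, F c * chordMeasure r P c := by
  set S := {q : Plane × Plane | ‖q.2‖ < 2 * r ∧ q.1 - arcCentre r 0 q.2 ∈ P ∧
      q.1 - arcCentre r 0 q.2 + q.2 ∈ P} with hS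
  have hSm : MeasurableSet S := measurableSet_chords hP
  have h1 : ∀ y ∈ P, ∫⁻ z in P, F (arcCentre r y z) =
      ∫⁻ w, P.indicator (fun _ => F (y + arcCentre r 0 w)) (y + w) := by
    intro y _
    rw [← lintegral_indicator hP, ← lintegral_add_left_eq_self _ y]
    refine lintegral_congr fun w => ?_
    by_cases h : y + w ∈ P
    · simp only [Set.indicator_of_mem h, arcCentre_add]
    · simp only [Set.indicator_of_notMem h]
  have hind : ∀ y w, P.indicator (fun _ => P.indicator (fun _ => F (y + arcCentre r 0 w)) (y + w)) y
      = (P ∩ (fun v => v + w) ⁻¹' P).indicator (fun v => F (v + arcCentre r 0 w)) y := by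
    intro y w
    by_cases h1 : y ∈ P <;> by_cases h2 : y + w ∈ P <;> simp [h1, h2, Set.indicator]
  have hmeas : Measurable (Function.uncurry fun y w : Plane =>
      P.indicator (fun _ => P.indicator (fun _ => F (y + arcCentre r 0 w)) (y + w)) y) := by
    have e1 : Measurable fun q : Plane × Plane => F (q.1 + arcCentre r 0 q.2) := by fun_prop
    have e2 : Measurable fun q : Plane × Plane => q.1 + q.2 := by fun_prop
    have : (Function.uncurry fun y w : Plane =>
      P.indicator (fun _ => P.indicator (fun _ => F (y + arcCentre r 0 w)) (y + w)) y) =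
      (Prod.fst ⁻¹' P ∩ (fun q : Plane × Plane => q.1 + q.2) ⁻¹' P).indicator
        (fun q => F (q.1 + arcCentre r 0 q.2)) := by
      ext ⟨y, w⟩
      by_cases h1 : y ∈ P <;> by_cases h2 : y + w ∈ P <;> simp [h1, h2, Set.indicator]
    rw [this]
    exact e1.indicator ((measurable_fst hP).inter (e2 hP))
  rw [setLIntegral_congr_fun hP h1, ← lintegral_indicator hP]
  have h2 : ∀ y, P.indicator (fun y => ∫⁻ w, P.indicator (fun _ => F (y + arcCentre r 0 w)) (y + w)) y
      = ∫⁻ w, P.indicator (fun _ => P.indicator (fun _ => F (y + arcCentre r 0 w)) (y + w)) y := by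
    intro y
    by_cases h : y ∈ P <;> simp [h]
  simp_rw [h2]
  rw [lintegral_lintegral_swap hmeas.aemeasurable]
  -- Chords that are diameters are a null set; `chordMeasure` leaves them out.
  have hn : ∀ᵐ w : Plane, ‖w‖ ≠ 2 * r := by
    rw [ae_iff]
    have : {w : Plane | ¬‖w‖ ≠ 2 * r} = Metric.sphere 0 (2 * r) := by ext; simp
    rw [this]
    exact Measure.addHaar_sphere_of_ne_zero _ _ (by positivity)
  have h3 : ∀ᵐ w : Plane, ∫⁻ y,
      P.indicator (fun _ => P.indicator (fun _ => F (y + arcCentre r 0 w)) (y + w)) y =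
      ∫⁻ c, S.indicator (fun q => F q.1) (c, w) := by
    filter_upwards [hn] with w hw
    -- For fixed `w` the centre is `y` plus a constant vector, so the change of variables is a
    -- translation.
    rw [← lintegral_sub_right_eq_self _ (arcCentre r 0 w)]
    refine lintegral_congr fun c => ?_
    by_cases h1 : c - arcCentre r 0 w ∈ P
    · by_cases h2 : c - arcCentre r 0 w + w ∈ P
      · have hlt : ‖w‖ < 2 * r := by
          refine lt_of_le_of_ne ?_ hw
          have e1 := mem_closedBall_iff_norm.1 (hb h1)
          have e2 := mem_closedBall_iff_norm.1 (hb h2)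
          calc ‖w‖ = ‖(c - arcCentre r 0 w + w - c₀) - (c - arcCentre r 0 w - c₀)‖ := by
                congr 1; abel
            _ ≤ _ := norm_sub_le _ _
            _ ≤ 2 * r := by linarith
        have : (c, w) ∈ S := ⟨hlt, h1, h2⟩
        simp [h1, h2, this]
      · have : (c, w) ∉ S := fun h => h2 h.2.2
        simp [h1, h2, this]
    · have : (c, w) ∉ S := fun h => h1 h.2.1
      simp [h1, this]
  rw [lintegral_congr_ae h3, lintegral_lintegral_swap]
  · refine lintegral_congr fun c => ?_
    have : ∀ w, S.indicator (fun q => F q.1) (c, w) = (Prod.mk c ⁻¹' S).indicator (fun _ => F c) w :=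
      fun w => rfl
    simp_rw [this]
    rw [lintegral_indicator (measurable_prodMk_left hSm), setLIntegral_const]
    rfl
  · refine Measurable.aemeasurable ?_
    have : Measurable (S.indicator fun q => F q.1) := (hF.comp measurable_fst).indicator hSm
    exact this.comp measurable_swap

end

/-! ### The chords of an arc -/

lemma setLIntegral_ofReal_eq_sub {F f : ℝ → ℝ} {a b : ℝ} (hab : a ≤ b)
    (hF : ∀ x ∈ Set.Icc a b, HasDerivAt F (f x) x) (hf : ContinuousOn f (Set.Icc a b))
    (hf0 : ∀ x ∈ Set.Icc a b, 0 ≤ f x) :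
    ∫⁻ x in Set.Ioc a b, ENNReal.ofReal (f x) = ENNReal.ofReal (F b - F a) := by
  have hint : IntervalIntegrable f volume a b := by
    apply ContinuousOn.intervalIntegrable
    rwa [Set.uIcc_of_le hab]
  rw [← intervalIntegral.integral_eq_sub_of_hasDerivAt (f := F) (by rwa [Set.uIcc_of_le hab]) hint,
    intervalIntegral.integral_of_le hab, ofReal_integral_eq_lintegral_ofReal hint.1]
  exact (ae_restrict_iff' measurableSet_Ioc).2 (Filter.Eventually.of_forall fun x hx =>
    hf0 x (Set.Ioc_subset_Icc_self hx))

section Chords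

variable {r : ℝ} {P : Set Plane}

/-- A chord of length `ρ` subtends half the angle `arcsin (ρ / (2 * r))`, and the direction of its
midpoint is a quarter turn from its own; `t` measures this midpoint direction from `φ`. -/
lemma sub_arcCentre_polar (hr : 0 < r) (c : Plane) (φ t : ℝ) {ρ : ℝ} (hρ : ρ ∈ Set.Ioo 0 (2 * r)) :
    c - arcCentre r 0 (ρ • unitVec (φ + Real.pi / 2 + t)) =
        c + r • unitVec (φ + (t - Real.arcsin (ρ / (2 * r)))) ∧
      c - arcCentre r 0 (ρ • unitVec (φ + Real.pi / 2 + t)) + ρ • unitVec (φ + Real.pi / 2 + t) =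
        c + r • unitVec (φ + (t + Real.arcsin (ρ / (2 * r)))) := by
  have h1 : ρ / (2 * r) ≤ 1 := by rw [div_le_one (by linarith)]; exact hρ.2.le
  have h0 : 0 < ρ / (2 * r) := by have := hρ.1; positivity
  set δ := Real.arcsin (ρ / (2 * r)) with hδ
  have hsin : Real.sin δ = ρ / (2 * r) := Real.sin_arcsin (by linarith) h1
  have hδ0 : 0 < δ := Real.arcsin_pos.2 h0
  have hδ1 : δ ≤ Real.pi / 2 := Real.arcsin_le_pi_div_two _
  have hρ' : ρ = 2 * r * Real.cos (Real.pi / 2 - δ) := by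
    rw [Real.cos_pi_div_two_sub, hsin]; field_simp
  have e := arcCentre_polar hr (κ := Real.pi / 2 - δ) ⟨by linarith, by linarith⟩ 0
    (φ + Real.pi / 2 + t)
  rw [zero_add, zero_add, ← hρ'] at e
  rw [e, show φ + Real.pi / 2 + t + (Real.pi / 2 - δ) = φ + (t - δ) + Real.pi by ring,
    unitVec_add_pi]
  refine ⟨by simp, ?_⟩
  rw [show φ + Real.pi / 2 + t = φ + t + Real.pi / 2 by ring, hρ', Real.cos_pi_div_two_sub,
    ← add_sub_assoc, ← add_assoc]
  apply Plane.ext' <;> simp [Real.cos_add, Real.sin_add, Real.cos_sub, Real.sin_sub] <;> ring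

lemma chordMeasure_eq (hr : 0 < r) (hP : MeasurableSet P) (c : Plane) (φ : ℝ) :
    chordMeasure r P c = ∫⁻ t in Set.Ioo (-Real.pi) Real.pi, ∫⁻ ρ in Set.Ioo 0 (2 * r),
      ENNReal.ofReal ρ * {q : ℝ × ℝ | c + r • unitVec (φ + (q.1 - Real.arcsin (q.2 / (2 * r)))) ∈ P ∧
        c + r • unitVec (φ + (q.1 + Real.arcsin (q.2 / (2 * r)))) ∈ P}.indicator 1 (t, ρ) := by
  have hS := measurable_prodMk_left (x := c) (measurableSet_chords (r := r) hP)
  rw [chordMeasure, show {w : Plane | ‖w‖ < 2 * r ∧ c - arcCentre r 0 w ∈ P ∧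
    c - arcCentre r 0 w + w ∈ P} = Prod.mk c ⁻¹' {q : Plane × Plane | ‖q.2‖ < 2 * r ∧
      q.1 - arcCentre r 0 q.2 ∈ P ∧ q.1 - arcCentre r 0 q.2 + q.2 ∈ P} from rfl, ← lintegral_indicator_one hS,
    lintegral_polar 0 (φ + Real.pi / 2) (measurable_one.indicator hS)]
  refine lintegral_congr fun t => ?_
  rw [← Set.Ioi_inter_Iio, Set.inter_comm, ← Measure.restrict_restrict measurableSet_Iio,
    ← lintegral_indicator measurableSet_Iio]
  refine setLIntegral_congr_fun measurableSet_Ioi fun ρ hρ => ?_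
  have hρ0 : 0 < ρ := hρ
  have hn : ‖ρ • unitVec (φ + Real.pi / 2 + t)‖ = ρ := by
    rw [norm_smul, norm_unitVec, mul_one, Real.norm_of_nonneg hρ0.le]
  by_cases h : ρ < 2 * r
  · obtain ⟨e1, e2⟩ := sub_arcCentre_polar hr c φ t ⟨hρ0, h⟩
    have hiff : 0 + ρ • unitVec (φ + Real.pi / 2 + t) ∈ Prod.mk c ⁻¹' {q : Plane × Plane |
        ‖q.2‖ < 2 * r ∧ q.1 - arcCentre r 0 q.2 ∈ P ∧ q.1 - arcCentre r 0 q.2 + q.2 ∈ P} ↔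
        (t, ρ) ∈ {q : ℝ × ℝ | c + r • unitVec (φ + (q.1 - Real.arcsin (q.2 / (2 * r)))) ∈ P ∧
        c + r • unitVec (φ + (q.1 + Real.arcsin (q.2 / (2 * r)))) ∈ P} := by
      rw [Set.mem_preimage, Set.mem_ofPred_eq, Set.mem_ofPred_eq, zero_add, hn, e2, e1]
      simp only [h, true_and]
    rw [Set.indicator_of_mem (show ρ ∈ Set.Iio (2 * r) from h)]
    congr 1
    by_cases hm : (t, ρ) ∈ {q : ℝ × ℝ |
        c + r • unitVec (φ + (q.1 - Real.arcsin (q.2 / (2 * r)))) ∈ P ∧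
        c + r • unitVec (φ + (q.1 + Real.arcsin (q.2 / (2 * r)))) ∈ P}
    · rw [Set.indicator_of_mem hm, Set.indicator_of_mem (hiff.2 hm)]; rfl
    · rw [Set.indicator_of_notMem hm, Set.indicator_of_notMem (fun hh => hm (hiff.1 hh))]
  · rw [Set.indicator_of_notMem (show ρ ∉ Set.Iio (2 * r) from h), Set.indicator_of_notMem, mul_zero]
    intro hm
    rw [Set.mem_preimage, Set.mem_ofPred_eq, zero_add, hn] at hm
    exact h hm.1

/-- An upper bound for the chords of an arc of length at most `w₁ + w₂`. -/
lemma chordMeasure_le (hr : 0 < r) (hP : MeasurableSet P) (c : Plane) (φ : ℝ) {w₁ w₂ : ℝ}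
    (h₁ : w₁ ∈ Set.Ico 0 (Real.pi / 2)) (h₂ : w₂ ∈ Set.Ico 0 (Real.pi / 2))
    (h : ∀ t ∈ Set.Ioc (-Real.pi) Real.pi, c + r • unitVec (φ + t) ∈ P → t ∈ Set.Icc (-w₁) w₂) :
    chordMeasure r P c ≤ ENNReal.ofReal (r ^ 2 * (w₁ + w₂) ^ 3 / 6) := by
  set w := w₁ + w₂ with hw
  have hw0 : 0 ≤ w := by linarith [h₁.1, h₂.1]
  have hpi := Real.pi_pos
  -- Since `x ≤ arcsin x`, this region contains all parameters of chords with both ends in the arc,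
  -- and its integral is elementary.
  set R : Set (ℝ × ℝ) := {q | q.2 ∈ Set.Ioc 0 (r * w) ∧
    -w₁ + q.2 / (2 * r) ≤ q.1 ∧ q.1 ≤ w₂ - q.2 / (2 * r)} with hR
  have hRm : MeasurableSet R := by
    refine (measurable_snd measurableSet_Ioc).inter ?_
    exact (measurableSet_le (f := fun q : ℝ × ℝ => -w₁ + q.2 / (2 * r)) (by fun_prop)
      measurable_fst).inter (measurableSet_le (g := fun q : ℝ × ℝ => w₂ - q.2 / (2 * r))
        measurable_fst (by fun_prop))
  rw [chordMeasure_eq hr hP c φ]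
  calc _ ≤ ∫⁻ t in Set.Ioo (-Real.pi) Real.pi, ∫⁻ ρ in Set.Ioo 0 (2 * r),
        R.indicator (fun q => ENNReal.ofReal q.2) (t, ρ) := by
        refine setLIntegral_mono' measurableSet_Ioo fun t ht =>
          setLIntegral_mono' measurableSet_Ioo fun ρ hρ => ?_
        by_cases hm : (t, ρ) ∈ {q : ℝ × ℝ |
          c + r • unitVec (φ + (q.1 - Real.arcsin (q.2 / (2 * r)))) ∈ P ∧
          c + r • unitVec (φ + (q.1 + Real.arcsin (q.2 / (2 * r)))) ∈ P}
        swap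
        · rw [Set.indicator_of_notMem hm]; simp
        have hx0 : 0 < ρ / (2 * r) := by have := hρ.1; positivity
        have hx1 : ρ / (2 * r) ≤ 1 := by rw [div_le_one (by linarith)]; exact hρ.2.le
        have hge : ρ / (2 * r) ≤ Real.arcsin (ρ / (2 * r)) := by
          conv_lhs => rw [← Real.sin_arcsin (by linarith) hx1]
          exact Real.sin_le (Real.arcsin_nonneg.2 hx0.le)
        have hle := Real.arcsin_le_pi_div_two (ρ / (2 * r))
        -- End angles can leave the fundamental interval; wrapping them around would force an angle
        -- beyond `3π/2` in absolute value, since `w₁` and `w₂` are below `π/2`.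
        have hmod : ∀ t', t' ∈ Set.Ioo (-(3 * Real.pi / 2)) (3 * Real.pi / 2) →
            c + r • unitVec (φ + t') ∈ P → t' ∈ Set.Icc (-w₁) w₂ := by
          intro t' ht' hmem
          rcases lt_or_ge Real.pi t' with h3 | h3
          · have := h (t' - 2 * Real.pi) ⟨by linarith, by linarith [ht'.2]⟩ (by
              rwa [← add_sub_assoc, unitVec_sub_two_pi])
            linarith [this.1, h₁.2, ht'.2]
          rcases le_or_gt t' (-Real.pi) with h4 | h4
          · have := h (t' + 2 * Real.pi) ⟨by linarith [ht'.1], by linarith⟩ (by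
              rwa [← add_assoc, unitVec_add_two_pi])
            linarith [this.2, h₂.2, ht'.1]
          · exact h t' ⟨h4, h3⟩ hmem
        have e1 := hmod _ ⟨by linarith [ht.1], by linarith [ht.2]⟩ hm.1
        have e2 := hmod _ ⟨by linarith [ht.1], by linarith [ht.2]⟩ hm.2
        have hmemR : (t, ρ) ∈ R := by
          have h5 : -w₁ + ρ / (2 * r) ≤ t := by linarith [e1.1]
          have h6 : t ≤ w₂ - ρ / (2 * r) := by linarith [e2.2]
          refine ⟨⟨hρ.1, ?_⟩, h5, h6⟩
          have h7 : ρ / (2 * r) + ρ / (2 * r) ≤ w := by linarith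
          rw [show ρ / (2 * r) + ρ / (2 * r) = ρ / r by field_simp; norm_num, div_le_iff₀ hr] at h7
          linarith
        rw [Set.indicator_of_mem hm, Set.indicator_of_mem hmemR]
        simp
    _ ≤ ∫⁻ t, ∫⁻ ρ, R.indicator (fun q => ENNReal.ofReal q.2) (t, ρ) :=
        (setLIntegral_le_lintegral _ _).trans (lintegral_mono fun t => setLIntegral_le_lintegral _ _)
    _ = ∫⁻ ρ, ∫⁻ t, R.indicator (fun q => ENNReal.ofReal q.2) (t, ρ) :=
        lintegral_lintegral_swap (by
          have : Measurable (R.indicator fun q => ENNReal.ofReal q.2) :=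
            Measurable.indicator (by fun_prop) hRm
          exact this.aemeasurable)
    _ = ∫⁻ ρ in Set.Ioc 0 (r * w), ENNReal.ofReal (ρ * (w - ρ / r)) := by
        rw [← lintegral_indicator measurableSet_Ioc]
        refine lintegral_congr fun ρ => ?_
        by_cases hρ : ρ ∈ Set.Ioc 0 (r * w)
        · rw [Set.indicator_of_mem hρ]
          have : ∀ t, R.indicator (fun q => ENNReal.ofReal q.2) (t, ρ) =
              (Set.Icc (-w₁ + ρ / (2 * r)) (w₂ - ρ / (2 * r))).indicator
                (fun _ => ENNReal.ofReal ρ) t := by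
            intro t
            simp only [hR, Set.indicator_apply, Set.mem_ofPred_eq, hρ, true_and, Set.mem_Icc]
          simp_rw [this]
          rw [lintegral_indicator measurableSet_Icc, setLIntegral_const, Real.volume_Icc,
            ← ENNReal.ofReal_mul hρ.1.le]
          congr 2
          rw [hw]; field_simp; ring
        · rw [Set.indicator_of_notMem hρ]
          have : ∀ t, R.indicator (fun q => ENNReal.ofReal q.2) (t, ρ) = 0 := by
            intro t
            rw [Set.indicator_of_notMem]
            exact fun hm => hρ hm.1
          simp [this]
    _ = ENNReal.ofReal (r ^ 2 * w ^ 3 / 6) := by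
        rw [setLIntegral_ofReal_eq_sub (F := fun ρ => w * ρ ^ 2 / 2 - ρ ^ 3 / (3 * r)) (by positivity)]
        · congr 1
          field_simp
          ring
        · intro x _
          have := ((hasDerivAt_pow 2 x).const_mul w).div_const 2 |>.sub
            ((hasDerivAt_pow 3 x).div_const (3 * r))
          refine this.congr_deriv ?_
          norm_num
          field_simp
        · fun_prop
        · intro x hx
          have : x / r ≤ w := by rw [div_le_iff₀ hr]; linarith [hx.2]
          exact mul_nonneg hx.1 (by linarith)

/-- A lower bound for the chords of an arc of length at least `w`. -/
lemma le_chordMeasure (hr : 0 < r) (hP : MeasurableSet P) (c : Plane) (φ : ℝ) {w k x₀ : ℝ}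
    (hk : 1 ≤ k) (hx₀ : x₀ ≤ 1) (harc : ∀ x ∈ Set.Icc 0 x₀, Real.arcsin x ≤ k * x)
    (hw0 : 0 < w) (hw : w ≤ 2 * k * x₀) (hwpi : w < Real.pi)
    (h : ∀ t ∈ Set.Icc 0 w, c + r • unitVec (φ + t) ∈ P) :
    ENNReal.ofReal (r ^ 2 * w ^ 3 / (6 * k ^ 2)) ≤ chordMeasure r P c := by
  have hpi := Real.pi_pos
  have hk0 : 0 < k := by linarith
  -- Replacing `arcsin x` by its upper bound `k * x` shrinks the region of chords; this costs the
  -- factor `k ^ 2`.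
  set R : Set (ℝ × ℝ) := {q | q.2 ∈ Set.Ioc 0 (r * w / k) ∧
    k * (q.2 / (2 * r)) ≤ q.1 ∧ q.1 ≤ w - k * (q.2 / (2 * r))} with hR
  have hRm : MeasurableSet R := by
    refine (measurable_snd measurableSet_Ioc).inter ?_
    exact (measurableSet_le (f := fun q : ℝ × ℝ => k * (q.2 / (2 * r))) (by fun_prop)
      measurable_fst).inter (measurableSet_le (g := fun q : ℝ × ℝ => w - k * (q.2 / (2 * r)))
        measurable_fst (by fun_prop))
  have hle : r * w / k ≤ 2 * r * x₀ := by
    rw [div_le_iff₀ hk0]; nlinarith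
  have hmem : ∀ t ρ, (t, ρ) ∈ R → t ∈ Set.Ioo (-Real.pi) Real.pi ∧ ρ ∈ Set.Ioc 0 (2 * r) := by
    rintro t ρ ⟨⟨h1, h2⟩, h3, h4⟩
    simp only at h1 h2 h3 h4
    have h5 : 0 < k * (ρ / (2 * r)) := by positivity
    exact ⟨⟨by linarith, by linarith⟩, h1, by nlinarith⟩
  rw [chordMeasure_eq hr hP c φ]
  calc ENNReal.ofReal (r ^ 2 * w ^ 3 / (6 * k ^ 2))
      = ∫⁻ ρ in Set.Ioc 0 (r * w / k), ENNReal.ofReal (ρ * (w - k * ρ / r)) := by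
        rw [setLIntegral_ofReal_eq_sub (F := fun ρ => w * ρ ^ 2 / 2 - k * ρ ^ 3 / (3 * r))
          (by positivity)]
        · congr 1
          field_simp
          ring
        · intro x _
          have := ((hasDerivAt_pow 2 x).const_mul w).div_const 2 |>.sub
            (((hasDerivAt_pow 3 x).const_mul k).div_const (3 * r))
          refine this.congr_deriv ?_
          norm_num
          field_simp
        · fun_prop
        · intro x hx
          have : k * x / r ≤ w := by
            rw [div_le_iff₀ hr]
            have := hx.2
            rw [le_div_iff₀ hk0] at this
            linarith
          exact mul_nonneg hx.1 (by linarith)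
    _ = ∫⁻ ρ, ∫⁻ t, R.indicator (fun q => ENNReal.ofReal q.2) (t, ρ) := by
        rw [← lintegral_indicator measurableSet_Ioc]
        refine lintegral_congr fun ρ => ?_
        by_cases hρ : ρ ∈ Set.Ioc 0 (r * w / k)
        · rw [Set.indicator_of_mem hρ]
          have : ∀ t, R.indicator (fun q => ENNReal.ofReal q.2) (t, ρ) =
              (Set.Icc (k * (ρ / (2 * r))) (w - k * (ρ / (2 * r)))).indicator
                (fun _ => ENNReal.ofReal ρ) t := by
            intro t
            simp only [hR, Set.indicator_apply, Set.mem_ofPred_eq, hρ, true_and, Set.mem_Icc]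
          simp_rw [this]
          rw [lintegral_indicator measurableSet_Icc, setLIntegral_const, Real.volume_Icc,
            ← ENNReal.ofReal_mul hρ.1.le]
          congr 2
          field_simp; ring
        · rw [Set.indicator_of_notMem hρ]
          have : ∀ t, R.indicator (fun q => ENNReal.ofReal q.2) (t, ρ) = 0 := by
            intro t
            rw [Set.indicator_of_notMem]
            exact fun hm => hρ hm.1
          simp [this]
    _ = ∫⁻ t, ∫⁻ ρ, R.indicator (fun q => ENNReal.ofReal q.2) (t, ρ) :=
        (lintegral_lintegral_swap (by
          have : Measurable (R.indicator fun q => ENNReal.ofReal q.2) :=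
            Measurable.indicator (by fun_prop) hRm
          exact this.aemeasurable)).symm
    _ = ∫⁻ t in Set.Ioo (-Real.pi) Real.pi, ∫⁻ ρ in Set.Ioc 0 (2 * r),
          R.indicator (fun q => ENNReal.ofReal q.2) (t, ρ) := by
        rw [← lintegral_indicator measurableSet_Ioo]
        refine lintegral_congr fun t => ?_
        by_cases ht : t ∈ Set.Ioo (-Real.pi) Real.pi
        · rw [Set.indicator_of_mem ht, ← lintegral_indicator measurableSet_Ioc]
          refine lintegral_congr fun ρ => ?_
          by_cases hρ : ρ ∈ Set.Ioc 0 (2 * r)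
          · rw [Set.indicator_of_mem hρ]
          · rw [Set.indicator_of_notMem hρ, Set.indicator_of_notMem fun hm => hρ (hmem t ρ hm).2]
        · rw [Set.indicator_of_notMem ht]
          have : ∀ ρ, R.indicator (fun q => ENNReal.ofReal q.2) (t, ρ) = 0 := fun ρ =>
            Set.indicator_of_notMem (fun hm => ht (hmem t ρ hm).1) _
          simp [this]
    _ ≤ _ := by
        refine lintegral_mono fun t => ?_
        rw [restrict_Ioo_eq_restrict_Ioc]
        refine setLIntegral_mono' measurableSet_Ioc fun ρ hρ => ?_
        by_cases hm : (t, ρ) ∈ R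
        swap
        · rw [Set.indicator_of_notMem hm]; simp
        obtain ⟨⟨h1, h2⟩, h3, h4⟩ := hm
        simp only at h1 h2 h3 h4
        have hx0 : 0 < ρ / (2 * r) := by positivity
        have hx1 : ρ / (2 * r) ≤ x₀ := by rw [div_le_iff₀ (by positivity)]; linarith
        have ha := harc _ ⟨hx0.le, hx1⟩
        have ha0 : 0 ≤ Real.arcsin (ρ / (2 * r)) := Real.arcsin_nonneg.2 hx0.le
        rw [Set.indicator_of_mem, Set.indicator_of_mem]
        · simp
        · exact ⟨h _ ⟨by linarith, by linarith⟩, h _ ⟨by linarith, by linarith⟩⟩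
        · exact ⟨⟨h1, h2⟩, h3, h4⟩

end Chords

/-! ### Caps as integrals over moving circles -/

section Caps

variable {r : ℝ} {P : Set Plane}

/-- The length of the projection to the tangent of the part in `P` of the half circle of radius `r`
around `c` that is centred at direction `φ`. -/
def halfCircleLength (r : ℝ) (P : Set Plane) (φ : ℝ) (c : Plane) : ENNReal :=
  volume {h : ℝ | h ∈ Set.Icc (-r) r ∧
    c + √(r ^ 2 - h ^ 2) • unitVec φ + h • unitVec (φ + Real.pi / 2) ∈ P}

lemma norm_frame_sq (φ a h : ℝ) :
    ‖a • unitVec φ + h • unitVec (φ + Real.pi / 2)‖ ^ 2 = a ^ 2 + h ^ 2 := by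
  rw [norm_add_sq_real, norm_smul, norm_smul, real_inner_smul_left, real_inner_smul_right,
    inner_unitVec, norm_unitVec, norm_unitVec]
  simp

/-- The cap cut off from `P` by a moving disc, as an integral over the motion. -/
lemma volume_cap (hP : MeasurableSet P) {q : Plane} (hq : P ⊆ Metric.closedBall q r) (φ : ℝ)
    {l : ℝ} (hl0 : 0 ≤ l) :
    volume (P \ Metric.closedBall (q - l • unitVec φ) r) =
      ∫⁻ l' in Set.Ico 0 l, halfCircleLength r P φ (q - l' • unitVec φ) := by
  set c := q - l • unitVec φ with hc
  have hm : MeasurableSet (P \ Metric.closedBall c r) := hP.diff measurableSet_closedBall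
  set W : Set (ℝ × ℝ) := {p | p.1 ∈ Set.Ico 0 l ∧ p.2 ∈ Set.Icc (-r) r ∧
    q - p.1 • unitVec φ + √(r ^ 2 - p.2 ^ 2) • unitVec φ + p.2 • unitVec (φ + Real.pi / 2) ∈ P} with hW
  have hWm : MeasurableSet W := by
    refine (measurable_fst measurableSet_Ico).inter ((measurable_snd measurableSet_Icc).inter ?_)
    have : Measurable fun p : ℝ × ℝ => q - p.1 • unitVec φ + √(r ^ 2 - p.2 ^ 2) • unitVec φ +
      p.2 • unitVec (φ + Real.pi / 2) := by fun_prop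
    exact this hP
  rw [← lintegral_indicator_one hm, lintegral_frame c φ (measurable_one.indicator hm),
    Measure.volume_eq_prod, lintegral_prod_symm]
  swap
  · exact ((measurable_one.indicator hm).comp (by fun_prop)).aemeasurable
  calc _ = ∫⁻ h, ∫⁻ l', W.indicator 1 (l', h) := by
        refine lintegral_congr fun h => ?_
        -- In the frame at `φ` a point of the cap is labelled by its height `h` and by the shift
        -- `l'` at which the moving half circle passes through it. Being in the disc around `q`
        -- gives `0 ≤ l'`; being outside the last disc gives `l' < l`.
        rw [← lintegral_sub_left_eq_self _ (√(r ^ 2 - h ^ 2) + l)]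
        refine lintegral_congr fun l' => ?_
        have hiff : c + (√(r ^ 2 - h ^ 2) + l - l') • unitVec φ + h • unitVec (φ + Real.pi / 2) ∈
            P \ Metric.closedBall c r ↔ (l', h) ∈ W := by
          have e1 : c + (√(r ^ 2 - h ^ 2) + l - l') • unitVec φ + h • unitVec (φ + Real.pi / 2) =
              q - l' • unitVec φ + √(r ^ 2 - h ^ 2) • unitVec φ + h • unitVec (φ + Real.pi / 2) := by
            rw [hc]; module
          have n1 : ∀ a : ℝ, (c + a • unitVec φ + h • unitVec (φ + Real.pi / 2) ∈
              Metric.closedBall c r ↔ 0 ≤ r ∧ a ^ 2 + h ^ 2 ≤ r ^ 2) := by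
            intro a
            rw [mem_closedBall_iff_norm, add_assoc, add_sub_cancel_left, ← norm_frame_sq φ]
            constructor
            · intro hh
              exact ⟨(norm_nonneg _).trans hh, pow_le_pow_left₀ (norm_nonneg _) hh 2⟩
            · rintro ⟨h0, hh⟩
              exact (pow_le_pow_iff_left₀ (norm_nonneg _) h0 two_ne_zero).1 hh
          constructor
          · rintro ⟨hmem, hnot⟩
            have hb := hq hmem
            rw [mem_closedBall_iff_norm, show c + (√(r ^ 2 - h ^ 2) + l - l') • unitVec φ +
              h • unitVec (φ + Real.pi / 2) - q = (√(r ^ 2 - h ^ 2) - l') • unitVec φ +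
              h • unitVec (φ + Real.pi / 2) by rw [hc]; module] at hb
            have hr0 : 0 ≤ r := (norm_nonneg _).trans hb
            have hb2 := pow_le_pow_left₀ (norm_nonneg _) hb 2
            rw [norm_frame_sq] at hb2
            have hh : h ^ 2 ≤ r ^ 2 := by nlinarith [sq_nonneg (√(r ^ 2 - h ^ 2) - l')]
            have hsq : √(r ^ 2 - h ^ 2) ^ 2 = r ^ 2 - h ^ 2 := Real.sq_sqrt (by linarith)
            have hs0 := Real.sqrt_nonneg (r ^ 2 - h ^ 2)
            have hl1 : (√(r ^ 2 - h ^ 2) - l') ^ 2 ≤ √(r ^ 2 - h ^ 2) ^ 2 := by linarith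
            have hl2 := abs_le_of_sq_le_sq' hl1 hs0
            rw [n1] at hnot
            have hnot' : √(r ^ 2 - h ^ 2) ^ 2 < (√(r ^ 2 - h ^ 2) + l - l') ^ 2 := by
              by_contra! hcon
              exact hnot ⟨hr0, by linarith⟩
            refine ⟨⟨by linarith, ?_⟩, abs_le.1 (abs_le_of_sq_le_sq hh hr0), by rwa [e1] at hmem⟩
            by_contra! hcon
            simp only at hcon
            nlinarith
          · rintro ⟨⟨h1, h2⟩, h3, h4⟩
            simp only at h1 h2 h3 h4
            refine ⟨by rwa [e1], fun hmem => ?_⟩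
            rw [n1] at hmem
            have hh : h ^ 2 ≤ r ^ 2 := by nlinarith [h3.1, h3.2]
            have hsq : √(r ^ 2 - h ^ 2) ^ 2 = r ^ 2 - h ^ 2 := Real.sq_sqrt (by linarith)
            have hs0 := Real.sqrt_nonneg (r ^ 2 - h ^ 2)
            nlinarith
        by_cases hmem : (l', h) ∈ W
        · rw [Set.indicator_of_mem hmem, Set.indicator_of_mem (hiff.2 hmem)]; rfl
        · rw [Set.indicator_of_notMem hmem, Set.indicator_of_notMem (fun hh => hmem (hiff.1 hh))]
    _ = ∫⁻ l', ∫⁻ h, W.indicator 1 (l', h) :=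
        lintegral_lintegral_swap
          (((measurable_one.indicator hWm).comp measurable_swap).aemeasurable)
    _ = _ := by
        rw [← lintegral_indicator measurableSet_Ico]
        refine lintegral_congr fun l' => ?_
        by_cases hl : l' ∈ Set.Ico 0 l
        · rw [Set.indicator_of_mem hl]
          have : ∀ h, W.indicator (1 : ℝ × ℝ → ENNReal) (l', h) =
              (Prod.mk l' ⁻¹' W).indicator 1 h := fun h => rfl
          simp_rw [this]
          rw [lintegral_indicator_one (measurable_prodMk_left hWm)]
          congr 1
          ext h
          simp [hW, hl.1, hl.2]
        · rw [Set.indicator_of_notMem hl]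
          have : ∀ h, W.indicator (1 : ℝ × ℝ → ENNReal) (l', h) = 0 := fun h =>
            Set.indicator_of_notMem (fun hm => hl hm.1) _
          simp [this]

end Caps

/-! ### Estimates of arcs and caps from points of `P` near an edge -/

lemma exists_small_angle {k : ℝ} (hk : 1 < k) : ∃ x₀ ∈ Set.Ioc (0 : ℝ) 1, ∀ x ∈ Set.Icc 0 x₀,
    x ≤ k * Real.sin x ∧ Real.arcsin x ≤ k * x ∧ 1 ≤ k * Real.cos x := by
  obtain ⟨x₁, hx₁, h1⟩ : ∃ x₁ ∈ Set.Ioc (0 : ℝ) 1, 1 ≤ k * (1 - x₁ ^ 2 / 2) := by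
    refine ⟨min 1 ((k - 1) / k), ⟨by have : 0 < (k - 1) / k := div_pos (by linarith) (by linarith)
                                     positivity, min_le_left _ _⟩, ?_⟩
    set y := min 1 ((k - 1) / k)
    have hy1 : y ≤ 1 := min_le_left _ _
    have hy2 : y ≤ (k - 1) / k := min_le_right _ _
    have hy0 : 0 ≤ y := le_min zero_le_one (div_nonneg (by linarith) (by linarith))
    rw [le_div_iff₀ (by linarith)] at hy2
    nlinarith [mul_nonneg hy0 (sub_nonneg.2 hy1)]
  have hsin : ∀ x ∈ Set.Icc 0 x₁, x ≤ k * Real.sin x := by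
    intro x hx
    rcases eq_or_lt_of_le hx.1 with h | h
    · simp [← h]
    have h2 := Real.sin_gt_sub_cube h
    have h3 : x ^ 2 ≤ x₁ ^ 2 := pow_le_pow_left₀ hx.1 hx.2 2
    have h4 : 1 ≤ k * (1 - x ^ 2 / 4) := by nlinarith [sq_nonneg x]
    have h5 := mul_le_mul_of_nonneg_left h4 h.le
    have h6 := mul_lt_mul_of_pos_left h2 (by linarith : 0 < k)
    nlinarith
  refine ⟨x₁ / 2, ⟨by linarith [hx₁.1], by linarith [hx₁.2]⟩, fun x hx => ⟨?_, ?_, ?_⟩⟩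
  · exact hsin x ⟨hx.1, by linarith [hx.2, hx₁.1]⟩
  · have hs := Real.sin_arcsin (x := x) (by linarith [hx.1]) (by linarith [hx.2, hx₁.2])
    have h0 := Real.arcsin_nonneg.2 hx.1
    have h2 := Real.mul_le_sin h0 (Real.arcsin_le_pi_div_two x)
    rw [hs] at h2
    have h3 : Real.arcsin x ≤ x₁ := by
      have h4 : Real.arcsin x = Real.pi / 2 * (2 / Real.pi * Real.arcsin x) := by
        field_simp [Real.pi_pos.ne']
      have h5 : Real.arcsin x ≤ Real.pi / 2 * x := by
        rw [h4]; exact mul_le_mul_of_nonneg_left h2 (by positivity)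
      nlinarith [Real.pi_lt_four, hx.1, hx.2]
    have := hsin _ ⟨h0, h3⟩
    rwa [hs] at this
  · have h2 := Real.one_sub_sq_div_two_le_cos (x := x)
    have h3 : x ^ 2 ≤ x₁ ^ 2 := pow_le_pow_left₀ hx.1 (by linarith [hx.2, hx₁.1]) 2
    nlinarith

section Geometry

variable {r : ℝ} {P : Set Plane}

/-- Expanding the norm gives `2 r² sin t sin ξ + 2 r² (1 - cos t)(1 - cos ξ) + 2 r l (1 - cos t -
cos ξ) + l² ≤ 0`. Applied to the discs touching at `v` with the extreme normals, it bounds the arc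
of the moved circle inside `P`. -/
lemma sin_mul_sin_le {v : Plane} {φ t ξ l : ℝ} (hr : 0 < r) (hl : 0 ≤ l)
    (h : v - r • unitVec φ - l • unitVec φ + r • unitVec (φ + t) ∈
      Metric.closedBall (v - r • unitVec (φ + ξ)) r) : r * (Real.sin t * Real.sin ξ) ≤ l := by
  rw [mem_closedBall_iff_norm] at h
  have h2 := pow_le_pow_left₀ (norm_nonneg _) h 2
  rw [show v - r • unitVec φ - l • unitVec φ + r • unitVec (φ + t) - (v - r • unitVec (φ + ξ)) =
    r • unitVec (φ + t) + r • unitVec (φ + ξ) - (r + l) • unitVec φ by module, norm_sub_sq_real,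
    norm_add_sq_real, inner_add_left] at h2
  simp only [norm_smul, norm_unitVec, real_inner_smul_left, real_inner_smul_right, inner_unitVec,
    mul_one, Real.norm_eq_abs, sq_abs, add_sub_add_left_eq_sub, add_sub_cancel_left] at h2
  rw [Real.cos_sub] at h2
  have h3 := Real.cos_le_one t
  have h4 := Real.cos_le_one ξ
  have h5 : 2 * r * (r * (Real.sin t * Real.sin ξ)) ≤ 2 * r * l := by
    nlinarith [mul_nonneg (mul_nonneg hr.le hr.le)
      (mul_nonneg (sub_nonneg.2 h3) (sub_nonneg.2 h4)), mul_nonneg (mul_nonneg hr.le hl)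
      (sub_nonneg.2 h3), mul_nonneg (mul_nonneg hr.le hl) (sub_nonneg.2 h4), sq_nonneg l]
  exact le_of_mul_le_mul_left h5 (by positivity)

lemma norm_add_le_of_closedBall_subset {o q : Plane} {ε : ℝ} (hε : 0 ≤ ε)
    (h : Metric.closedBall o ε ⊆ Metric.closedBall q r) : ‖o - q‖ + ε ≤ r := by
  obtain ⟨θ, -, hθ⟩ := exists_eq_norm_smul_unitVec (o - q)
  have := h (show o + ε • unitVec θ ∈ _ by simp [norm_smul, abs_of_nonneg hε])
  rw [mem_closedBall_iff_norm, show o + ε • unitVec θ - q = (o - q) + ε • unitVec θ by abel, hθ,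
    ← add_smul, norm_smul, norm_unitVec, mul_one, Real.norm_of_nonneg (by positivity)] at this
  exact this

/-- A point of `P` outside the moved disc is joined to a deep point by a segment that meets the
boundary of the moved disc soon. -/
lemma exists_crossing (hP : IsDiscPolygon r P) (hr : 0 < r) {o : Plane} {ε : ℝ} (hε : 0 < ε)
    (ho : Metric.closedBall o ε ⊆ P) {φ l : ℝ} (hl : 0 < l) (hl2 : l ≤ ε / 16) {x : Plane}
    (hx : x ∈ P) (hxv : ‖x - supportPoint P φ‖ ≤ r / 4)
    (hxc : r ≤ ‖x - (supportCentre r P φ - l • unitVec φ)‖) :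
    ∃ μ ∈ Set.Icc 0 (l / ε), ∃ t ∈ Set.Ioo (-(Real.pi / 2)) (Real.pi / 2), 1 / 2 ≤ Real.cos t ∧
      x + μ • (o - x) = supportCentre r P φ - l • unitVec φ + r • unitVec (φ + t) := by
  have hpi := Real.pi_pos
  set q := supportCentre r P φ with hq
  set c := q - l • unitVec φ with hc
  have hPq := hP.subset_closedBall hr φ
  have hoq := norm_add_le_of_closedBall_subset hε.le (ho.trans hPq)
  have hxq := mem_closedBall_iff_norm.1 (hPq hx)
  have hox : ‖o - x‖ ≤ 2 * r := by
    calc ‖o - x‖ = ‖(o - q) - (x - q)‖ := by congr 1; abel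
      _ ≤ _ := norm_sub_le _ _
      _ ≤ 2 * r := by linarith
  have hshift : ∀ y, ‖y - c‖ ≤ ‖y - q‖ + l := by
    intro y
    calc ‖y - c‖ = ‖(y - q) + l • unitVec φ‖ := by congr 1; rw [hc]; abel
      _ ≤ _ := norm_add_le _ _
      _ = _ := by rw [norm_smul, norm_unitVec, Real.norm_of_nonneg hl.le, mul_one]
  have hle : l / ε ≤ 1 / 16 := by rw [div_le_iff₀ hε]; linarith
  have hle0 : 0 < l / ε := by positivity
  have hcont : ContinuousOn (fun μ : ℝ => ‖x + μ • (o - x) - c‖) (Set.Icc 0 (l / ε)) := by fun_prop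
  -- At parameter `l / ε` the point is inside the moved disc: `x` is at distance at most `r + l`
  -- from the centre, `o` at most `r - ε + l`, and the mean is at most `r`.
  obtain ⟨μ, hμ, hμr⟩ := intermediate_value_Icc' hle0.le hcont (show r ∈ Set.Icc _ _ by
    refine ⟨?_, by simpa using hxc⟩
    rw [show x + (l / ε) • (o - x) - c = (1 - l / ε) • (x - c) + (l / ε) • (o - c) by module]
    refine (norm_add_le _ _).trans ?_
    rw [norm_smul, norm_smul, Real.norm_of_nonneg hle0.le, Real.norm_of_nonneg (by linarith)]
    have h1 := hshift x
    have h2 := hshift o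
    have h3 : (1 - l / ε) * ‖x - c‖ ≤ (1 - l / ε) * (r + l) :=
      mul_le_mul_of_nonneg_left (by linarith) (by linarith)
    have h4 : (l / ε) * ‖o - c‖ ≤ (l / ε) * (r - ε + l) :=
      mul_le_mul_of_nonneg_left (by linarith) hle0.le
    have h5 : l / ε * ε = l := div_mul_cancel₀ _ hε.ne'
    nlinarith)
  simp only at hμr
  obtain ⟨ψ, -, hψ⟩ := exists_eq_norm_smul_unitVec (x + μ • (o - x) - c)
  rw [hμr] at hψ
  obtain ⟨k, hk, -⟩ := existsUnique_add_zsmul_mem_Ioc (a := 2 * Real.pi) (by positivity) (ψ - φ)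
    (-Real.pi)
  rw [zsmul_eq_mul] at hk
  set t := ψ - φ + k * (2 * Real.pi) with ht
  have hut : unitVec (φ + t) = unitVec ψ := by
    rw [ht, show φ + (ψ - φ + k * (2 * Real.pi)) = ψ + k * (2 * Real.pi) by ring,
      unitVec_add_int_mul]
  have hyv : ‖x + μ • (o - x) - supportPoint P φ‖ ≤ 3 * r / 8 := by
    calc ‖x + μ • (o - x) - supportPoint P φ‖ = ‖(x - supportPoint P φ) + μ • (o - x)‖ := by
          congr 1; abel
      _ ≤ _ := norm_add_le _ _
      _ ≤ r / 4 + (1 / 16) * (2 * r) := by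
          rw [norm_smul, Real.norm_of_nonneg hμ.1]
          have := hμ.2
          gcongr
          linarith
      _ = 3 * r / 8 := by ring
  have hcos : r * Real.cos t = inner ℝ (unitVec φ) (x + μ • (o - x) - c) := by
    rw [hψ, ← hut, inner_smul_right, inner_unitVec, sub_add_cancel_left, Real.cos_neg]
  -- The crossing point is still close to the support point, so it lies on the half circle facing
  -- `φ`.
  have hcos2 : 1 / 2 ≤ Real.cos t := by
    have h1 : x + μ • (o - x) - c = (x + μ • (o - x) - supportPoint P φ) + (r + l) • unitVec φ := by
      rw [hc, hq, supportCentre]; module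
    rw [h1, inner_add_right, inner_smul_right, inner_unitVec, sub_self, Real.cos_zero] at hcos
    have h2 := abs_real_inner_le_norm (unitVec φ) (x + μ • (o - x) - supportPoint P φ)
    rw [norm_unitVec, one_mul] at h2
    have h3 := (abs_le.1 h2).1
    nlinarith
  refine ⟨μ, hμ, t, ⟨?_, ?_⟩, hcos2, ?_⟩
  · by_contra! hcon
    have := Real.cos_nonpos_of_pi_div_two_le_of_le (x := -t) (by linarith) (by linarith [hk.1])
    rw [Real.cos_neg] at this
    linarith
  · by_contra! hcon
    have := Real.cos_nonpos_of_pi_div_two_le_of_le hcon (by linarith [hk.2])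
    linarith
  · rw [hut, ← hψ]; abel

/-- `P` contains the short arc between two of its points on the circle, and the projection of that
arc to the tangent has length `r` times the difference of the sines. -/
lemma le_halfCircleLength (hP : IsDiscPolygon r P) (hr : 0 < r) {c : Plane} {φ a b : ℝ}
    (ha : a ∈ Set.Ioo (-(Real.pi / 2)) (Real.pi / 2))
    (hb : b ∈ Set.Ioo (-(Real.pi / 2)) (Real.pi / 2)) (hac : c + r • unitVec (φ + a) ∈ P)
    (hbc : c + r • unitVec (φ + b) ∈ P) :
    ENNReal.ofReal (r * (Real.sin b - Real.sin a)) ≤ halfCircleLength r P φ c := by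
  rw [show r * (Real.sin b - Real.sin a) = r * Real.sin b - r * Real.sin a by ring,
    ← Real.volume_Icc]
  refine measure_mono fun h hh => ?_
  have hsb := Real.sin_le_one b
  have hsa := Real.neg_one_le_sin a
  have h1 : -1 ≤ h / r := by
    rw [le_div_iff₀ hr]; nlinarith [hh.1]
  have h2 : h / r ≤ 1 := by
    rw [div_le_iff₀ hr]; nlinarith [hh.2]
  refine ⟨⟨?_, ?_⟩, ?_⟩
  · rw [le_div_iff₀ hr] at h1; linarith
  · rw [div_le_iff₀ hr] at h2; linarith
  set t := Real.arcsin (h / r) with ht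
  have hst : h = r * Real.sin t := by rw [ht, Real.sin_arcsin h1 h2]; field_simp
  have hct : √(r ^ 2 - h ^ 2) = r * Real.cos t := by
    rw [hst, show r ^ 2 - (r * Real.sin t) ^ 2 = (r * Real.cos t) ^ 2 by
      rw [mul_pow, mul_pow, Real.cos_sq']; ring]
    exact Real.sqrt_sq (mul_nonneg hr.le (Real.cos_arcsin_nonneg _))
  have key : c + √(r ^ 2 - h ^ 2) • unitVec φ + h • unitVec (φ + Real.pi / 2) =
      c + r • unitVec (φ + t) := by
    rw [hct, unitVec_add φ t]
    nth_rewrite 1 [hst]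
    module
  rw [key]
  refine hP.arc_mem hr (a := φ + a) (b := φ + b) ?_ ?_ (by linarith [ha.1, hb.2]) hac hbc
  · have : a ≤ t := by
      rw [ht]
      refine (Real.le_arcsin_iff_sin_le (x := a) (y := h / r) ⟨ha.1.le, ha.2.le⟩ ⟨h1, h2⟩).2 ?_
      rw [le_div_iff₀ hr]; linarith [hh.1]
    linarith
  · have : t ≤ b := by
      rw [ht]
      refine (Real.arcsin_le_iff_le_sin ⟨h1, h2⟩ ⟨hb.1.le, hb.2.le⟩).2 ?_
      rw [div_le_iff₀ hr]; linarith [hh.2]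
    linarith

/-- The point at angular distance `s` from `v` on the boundary arc at `v` that starts with normal
angle `φ₀` lies outside the moved disc. -/
lemma le_norm_edge_sub {v : Plane} {φ₀ σ η s l : ℝ} (hσ : σ = 1 ∨ σ = -1) (hr : 0 < r)
    (hη : η ∈ Set.Icc 0 Real.pi) (hs : s ∈ Set.Icc 0 Real.pi)
    (h : r * s * η ≤ l * (1 + Real.cos (s + η) - Real.cos η)) :
    r ≤ ‖v - r • unitVec φ₀ + r • unitVec (φ₀ + σ * s) -
      (v - r • unitVec (φ₀ - σ * η) - l • unitVec (φ₀ - σ * η))‖ := by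
  rw [← pow_le_pow_iff_left₀ hr.le (norm_nonneg _) two_ne_zero,
    show v - r • unitVec φ₀ + r • unitVec (φ₀ + σ * s) -
      (v - r • unitVec (φ₀ - σ * η) - l • unitVec (φ₀ - σ * η)) =
      r • unitVec (φ₀ + σ * s) + (r + l) • unitVec (φ₀ - σ * η) - r • unitVec φ₀ by module,
    norm_sub_sq_real, norm_add_sq_real, inner_add_left]
  simp only [norm_smul, norm_unitVec, real_inner_smul_left, real_inner_smul_right, inner_unitVec,
    mul_one, Real.norm_eq_abs, sq_abs, add_sub_cancel_left]
  rw [show φ₀ + σ * s - (φ₀ - σ * η) = σ * (s + η) by ring, show φ₀ - σ * η - φ₀ = -(σ * η) by ring,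
    Real.cos_neg]
  have hc : ∀ x, Real.cos (σ * x) = Real.cos x := by
    rcases hσ with h | h <;> simp [h]
  rw [hc, hc, hc]
  have key : -(s * η) ≤ 1 - Real.cos s - Real.cos η + Real.cos (s + η) := by
    have e : 1 - Real.cos s - Real.cos η + Real.cos (s + η) =
        -(4 * (Real.sin (s / 2) * Real.sin (η / 2)) * Real.cos ((s + η) / 2)) := by
      have h1 : Real.cos s = 1 - 2 * Real.sin (s / 2) ^ 2 := by
        have := Real.cos_two_mul (s / 2)
        rw [show 2 * (s / 2) = s by ring] at this
        linarith [Real.sin_sq_add_cos_sq (s / 2)]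
      have h2 : Real.cos η = 1 - 2 * Real.sin (η / 2) ^ 2 := by
        have := Real.cos_two_mul (η / 2)
        rw [show 2 * (η / 2) = η by ring] at this
        linarith [Real.sin_sq_add_cos_sq (η / 2)]
      have h3 : Real.sin s = 2 * Real.sin (s / 2) * Real.cos (s / 2) := by
        rw [← Real.sin_two_mul]; congr 1; ring
      have h4 : Real.sin η = 2 * Real.sin (η / 2) * Real.cos (η / 2) := by
        rw [← Real.sin_two_mul]; congr 1; ring
      rw [Real.cos_add, add_div, Real.cos_add, h1, h2, h3, h4]
      ring
    rw [e]
    have a1 : 0 ≤ Real.sin (s / 2) := Real.sin_nonneg_of_nonneg_of_le_pi (by linarith [hs.1])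
      (by linarith [hs.2, Real.pi_pos])
    have a2 : 0 ≤ Real.sin (η / 2) := Real.sin_nonneg_of_nonneg_of_le_pi (by linarith [hη.1])
      (by linarith [hη.2, Real.pi_pos])
    have a3 : Real.sin (s / 2) ≤ s / 2 := Real.sin_le (by linarith [hs.1])
    have a4 : Real.sin (η / 2) ≤ η / 2 := Real.sin_le (by linarith [hη.1])
    have a5 := Real.cos_le_one ((s + η) / 2)
    have a6 : Real.sin (s / 2) * Real.sin (η / 2) ≤ (s / 2) * (η / 2) :=
      mul_le_mul a3 a4 a2 (by linarith [hs.1])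
    nlinarith [mul_nonneg (mul_nonneg a1 a2) (sub_nonneg.2 a5)]
  have k2 := mul_le_mul_of_nonneg_left key (by positivity : 0 ≤ 2 * r ^ 2)
  have k3 := mul_le_mul_of_nonneg_left h (by positivity : 0 ≤ 2 * r)
  nlinarith [sq_nonneg l]

end Geometry

lemma norm_unitVec_sub_le (a b : ℝ) : ‖unitVec a - unitVec b‖ ≤ |a - b| := by
  rw [← pow_le_pow_iff_left₀ (norm_nonneg _) (abs_nonneg _) two_ne_zero, norm_sub_sq_real,
    norm_unitVec, norm_unitVec, inner_unitVec, sq_abs]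
  have := Real.one_sub_sq_div_two_le_cos (x := a - b)
  linarith

lemma abs_cos_sub_cos_le (a b : ℝ) : |Real.cos a - Real.cos b| ≤ |a - b| := by
  refine le_trans ?_ (norm_unitVec_sub_le a b)
  have := abs_real_inner_le_norm (unitVec a - unitVec b) (unitVec 0)
  rwa [norm_unitVec, mul_one, inner_sub_left, inner_unitVec, inner_unitVec, sub_zero, sub_zero]
    at this

/-- Splits a permitted loss `k` into `n` equal losses, one for each approximation. -/
lemma exists_pow_le {k : ℝ} (hk : 1 < k) {n : ℕ} (hn : n ≠ 0) : ∃ k₁ : ℝ, 1 < k₁ ∧ k₁ ^ n = k :=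
  ⟨k ^ ((n : ℝ)⁻¹), Real.one_lt_rpow hk (by positivity),
    Real.rpow_inv_natCast_pow (by linarith) hn⟩

section Geometry

variable {r : ℝ} {P : Set Plane}

lemma Plane.inner_perp (x y : Plane) : inner ℝ x (Plane.perp y) = -inner ℝ (Plane.perp x) y := by
  simp [Plane.inner_eq, Plane.perp]

lemma Plane.perp_unitVec (a : ℝ) : Plane.perp (unitVec a) = unitVec (a + Real.pi / 2) := by
  simpa using Plane.perp_smul_unitVec 1 a

lemma Plane.perp_sub (x y : Plane) : Plane.perp (x - y) = Plane.perp x - Plane.perp y := by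
  apply Plane.ext' <;> simp [Plane.perp]; ring

lemma Plane.perp_smul (a : ℝ) (x : Plane) : Plane.perp (a • x) = a • Plane.perp x := by
  apply Plane.ext' <;> simp [Plane.perp]

lemma norm_sub_le_two_mul_of_mem (hP : IsDiscPolygon r P) (hr : 0 < r) {x y : Plane} (hx : x ∈ P)
    (hy : y ∈ P) : ‖x - y‖ ≤ 2 * r := by
  have h1 := mem_closedBall_iff_norm.1 (hP.subset_closedBall hr 0 hx)
  have h2 := mem_closedBall_iff_norm.1 (hP.subset_closedBall hr 0 hy)
  calc ‖x - y‖ = ‖(x - supportCentre r P 0) - (y - supportCentre r P 0)‖ := by congr 1; abel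
    _ ≤ _ := norm_sub_le _ _
    _ ≤ 2 * r := by linarith

/-- Where the cosine is at least `1/2` the sine is a coordinate on the circle with bounded
distortion; this turns the distance of two crossing points into a length of arc. -/
lemma norm_unitVec_sub_le_of_half_le_cos {a b : ℝ} (ha : 1 / 2 ≤ Real.cos a) (hb : 1 / 2 ≤ Real.cos b) :
    ‖unitVec a - unitVec b‖ ≤ 3 * |Real.sin a - Real.sin b| := by
  rw [← pow_le_pow_iff_left₀ (norm_nonneg _) (by positivity) two_ne_zero, mul_pow, sq_abs,
    EuclideanSpace.norm_sq_eq]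
  simp only [Fin.sum_univ_two, PiLp.sub_apply, unitVec_zero_coord, unitVec_one_coord,
    Real.norm_eq_abs, sq_abs]
  have h1 : (Real.cos a - Real.cos b) * (Real.cos a + Real.cos b) =
      -(Real.sin a - Real.sin b) * (Real.sin a + Real.sin b) := by
    nlinarith [Real.sin_sq_add_cos_sq a, Real.sin_sq_add_cos_sq b]
  have h2 : (Real.sin a + Real.sin b) ^ 2 ≤ 4 := by
    nlinarith [Real.sin_le_one a, Real.sin_le_one b, Real.neg_one_le_sin a, Real.neg_one_le_sin b]
  have h3 : (Real.cos a - Real.cos b) ^ 2 * (Real.cos a + Real.cos b) ^ 2 =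
      (Real.sin a - Real.sin b) ^ 2 * (Real.sin a + Real.sin b) ^ 2 := by
    rw [← mul_pow, h1]; ring
  have h4 : 1 ≤ (Real.cos a + Real.cos b) ^ 2 := by nlinarith
  have h5 : (Real.cos a - Real.cos b) ^ 2 ≤ (Real.cos a - Real.cos b) ^ 2 * (Real.cos a + Real.cos b) ^ 2 :=
    le_mul_of_one_le_right (sq_nonneg _) h4
  have h6 : (Real.sin a - Real.sin b) ^ 2 * (Real.sin a + Real.sin b) ^ 2 ≤
      (Real.sin a - Real.sin b) ^ 2 * 4 := mul_le_mul_of_nonneg_left h2 (sq_nonneg _)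
  nlinarith [sq_nonneg (Real.sin a - Real.sin b)]

set_option maxHeartbeats 1000000 in
/-- A lower bound for the arc of the moved disc inside `P`, at all scales. -/
lemma le_halfCircleLength_of_edge (hP : IsDiscPolygon r P) (hr : 0 < r) {o : Plane} {ε : ℝ}
    (hε : 0 < ε) (ho : Metric.closedBall o ε ⊆ P) {v : Plane} {φ₀ σ η s l : ℝ}
    (hσ : σ = 1 ∨ σ = -1) (hv₀ : supportPoint P φ₀ = v) (hv : supportPoint P (φ₀ - σ * η) = v)
    (hη : η ∈ Set.Icc 0 Real.pi) (hl : 0 < l) (hl2 : l ≤ ε / 16) (hs : 0 ≤ s) (hs4 : s ≤ 1 / 4)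
    (hsε : s ≤ ε / (4 * r)) (hE : v - r • unitVec φ₀ + r • unitVec (φ₀ + σ * s) ∈ P)
    (hc : r * s * η ≤ l / 2) :
    ENNReal.ofReal (ε * s / 15) ≤ halfCircleLength r P (φ₀ - σ * η)
      (supportCentre r P (φ₀ - σ * η) - l • unitVec (φ₀ - σ * η)) := by
  set φ := φ₀ - σ * η with hφ
  set c := supportCentre r P φ - l • unitVec φ with hcdef
  set x := v - r • unitVec φ₀ + r • unitVec (φ₀ + σ * s) with hx
  have hcen : supportCentre r P φ = v - r • unitVec φ := by rw [supportCentre, hv]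
  have hσabs : |σ| = 1 := by rcases hσ with h | h <;> simp [h]
  have hoP : o ∈ P := ho (Metric.mem_closedBall_self hε.le)
  have hvP : v ∈ P := hv ▸ hP.supportPoint_mem φ
  have hxv : ‖x - v‖ ≤ r * s := by
    rw [hx, show v - r • unitVec φ₀ + r • unitVec (φ₀ + σ * s) - v =
      r • (unitVec (φ₀ + σ * s) - unitVec φ₀) by module, norm_smul, Real.norm_of_nonneg hr.le]
    have := norm_unitVec_sub_le (φ₀ + σ * s) φ₀
    rw [add_sub_cancel_left, abs_mul, hσabs, one_mul, abs_of_nonneg hs] at this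
    gcongr
  have hxc : r ≤ ‖x - c‖ := by
    rw [hcdef, hcen]
    refine le_norm_edge_sub hσ hr hη ⟨hs, by linarith [Real.pi_gt_three]⟩ (hc.trans ?_)
    have := abs_cos_sub_cos_le (s + η) η
    rw [add_sub_cancel_right, abs_of_nonneg hs] at this
    have := (abs_le.1 this).1
    nlinarith
  have hvc : r ≤ ‖v - c‖ := by
    rw [hcdef, hcen, show v - (v - r • unitVec φ - l • unitVec φ) = (r + l) • unitVec φ by module,
      norm_smul, norm_unitVec, mul_one, Real.norm_of_nonneg (by positivity)]
    linarith
  obtain ⟨μ, hμ, ta, hta, hcta, hA⟩ := exists_crossing hP hr hε ho hl hl2 hE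
    (by rw [hv]; nlinarith) hxc
  obtain ⟨ν, hν, tb, htb, hctb, hB⟩ := exists_crossing hP hr hε ho hl hl2 hvP
    (by rw [hv]; simp; positivity) hvc
  rw [← hcdef] at hA hB
  have hle : l / ε ≤ 1 / 16 := by rw [div_le_iff₀ hε]; linarith
  have hconv : ∀ y ∈ P, ∀ μ ∈ Set.Icc 0 (l / ε), y + μ • (o - y) ∈ P := fun y hy μ hμ =>
    hP.convex.add_smul_sub_mem hy hoP ⟨hμ.1, by linarith [hμ.2]⟩
  have hAP := hA ▸ hconv x hE μ hμ
  have hBP := hB ▸ hconv v hvP ν hν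
  set w := v - o with hw
  have hwle : ‖w‖ ≤ 2 * r := norm_sub_le_two_mul_of_mem hP hr hvP hoP
  -- the component of the crossing points orthogonal to `v - o`
  have hdet : r * inner ℝ (unitVec (φ + ta) - unitVec (φ + tb)) (Plane.perp w) =
      (1 - μ) * inner ℝ (x - v) (Plane.perp w) := by
    have e0 : inner ℝ w (Plane.perp w) = (0 : ℝ) := by
      rw [real_inner_comm, Plane.inner_perp_self]
    have e1 : r • (unitVec (φ + ta) - unitVec (φ + tb)) = (1 - μ) • (x - v) + (ν - μ) • w := by
      have : r • (unitVec (φ + ta) - unitVec (φ + tb)) =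
          (c + r • unitVec (φ + ta)) - (c + r • unitVec (φ + tb)) := by module
      rw [this, ← hA, ← hB, hw]; module
    rw [← real_inner_smul_left, e1, inner_add_left, real_inner_smul_left, real_inner_smul_left, e0]
    ring
  have hin : inner ℝ (x - v) (Plane.perp w) =
      r * (σ * Real.sin s * inner ℝ (unitVec φ₀) w +
        (1 - Real.cos s) * inner ℝ (unitVec (φ₀ + Real.pi / 2)) w) := by
    have hcs : Real.cos (σ * s) = Real.cos s := by rcases hσ with h | h <;> simp [h]
    have hss : Real.sin (σ * s) = σ * Real.sin s := by rcases hσ with h | h <;> simp [h]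
    rw [Plane.inner_perp, show x - v = r • (unitVec (φ₀ + σ * s) - unitVec φ₀) by rw [hx]; module,
      Plane.perp_smul, Plane.perp_sub, Plane.perp_unitVec, Plane.perp_unitVec,
      show φ₀ + σ * s + Real.pi / 2 = φ₀ + (σ * s + Real.pi / 2) by ring,
      unitVec_add φ₀ (σ * s + Real.pi / 2), Real.cos_add_pi_div_two, Real.sin_add_pi_div_two,
      hcs, hss, real_inner_smul_left, inner_sub_left, inner_add_left, real_inner_smul_left,
      real_inner_smul_left]
    ring
  have hA1 : ε ≤ inner ℝ (unitVec φ₀) w := by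
    have := (hP.isSupportPoint φ₀).inner_le_neg hε.le ho
    rw [hv₀, ← neg_sub, inner_neg_right] at this
    linarith
  have hB1 : |inner ℝ (unitVec (φ₀ + Real.pi / 2)) w| ≤ 2 * r := by
    have := abs_real_inner_le_norm (unitVec (φ₀ + Real.pi / 2)) w
    rw [norm_unitVec, one_mul] at this
    linarith
  have hsin : 3 / 4 * s ≤ Real.sin s := by
    rcases eq_or_lt_of_le hs with h | h
    · simp [← h]
    have := Real.sin_gt_sub_cube h
    nlinarith [mul_pos h h]
  have hcos0 : 0 ≤ 1 - Real.cos s := by linarith [Real.cos_le_one s]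
  have hcos1 : 1 - Real.cos s ≤ s ^ 2 / 2 := by linarith [Real.one_sub_sq_div_two_le_cos (x := s)]
  -- The displacement along the edge has a component of order `r s ε` orthogonal to `v - o`, because
  -- `o` is at depth `ε` below the tangent; the quadratic term is absorbed by `s ≤ ε / (4 * r)`.
  have hlow : r * (s * ε / 2) ≤ |inner ℝ (x - v) (Plane.perp w)| := by
    rw [hin, abs_mul, abs_of_pos hr]
    refine mul_le_mul_of_nonneg_left ?_ hr.le
    have h1 := abs_sub_abs_le_abs_sub (σ * Real.sin s * inner ℝ (unitVec φ₀) w)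
      (-((1 - Real.cos s) * inner ℝ (unitVec (φ₀ + Real.pi / 2)) w))
    rw [sub_neg_eq_add, abs_neg, abs_mul, abs_mul, abs_mul, hσabs, one_mul, abs_of_nonneg hcos0,
      abs_of_nonneg (by linarith : 0 ≤ Real.sin s), abs_of_nonneg (by linarith :
        0 ≤ inner ℝ (unitVec φ₀) w)] at h1
    have h2 : 3 / 4 * s * ε ≤ Real.sin s * inner ℝ (unitVec φ₀) w :=
      mul_le_mul hsin hA1 hε.le (by linarith)
    have h3 : (1 - Real.cos s) * |inner ℝ (unitVec (φ₀ + Real.pi / 2)) w| ≤ s ^ 2 / 2 * (2 * r) :=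
      mul_le_mul hcos1 hB1 (abs_nonneg _) (by positivity)
    have h4 : s ^ 2 / 2 * (2 * r) ≤ s * ε / 4 := by
      have : s * (4 * r) ≤ ε := (le_div_iff₀ (by positivity)).1 hsε
      nlinarith
    linarith
  have hup : |inner ℝ (unitVec (φ + ta) - unitVec (φ + tb)) (Plane.perp w)| ≤
      3 * |Real.sin ta - Real.sin tb| * (2 * r) := by
    refine (abs_real_inner_le_norm _ _).trans ?_
    rw [Plane.norm_perp]
    refine mul_le_mul ?_ hwle (norm_nonneg _) (by positivity)
    have : ‖unitVec (φ + ta) - unitVec (φ + tb)‖ = ‖unitVec ta - unitVec tb‖ := by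
      rw [← pow_left_inj₀ (norm_nonneg _) (norm_nonneg _) two_ne_zero, norm_sub_sq_real,
        norm_sub_sq_real]
      simp [inner_unitVec]
    rw [this]
    exact norm_unitVec_sub_le_of_half_le_cos hcta hctb
  have hfin : ε * s / 15 ≤ r * |Real.sin ta - Real.sin tb| := by
    have h1 := congrArg abs hdet
    rw [abs_mul, abs_mul, abs_of_pos hr, abs_of_nonneg (by linarith [hμ.2] : 0 ≤ 1 - μ)] at h1
    have h2 : (15 / 16) * (r * (s * ε / 2)) ≤ (1 - μ) * |inner ℝ (x - v) (Plane.perp w)| :=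
      mul_le_mul (by linarith [hμ.2]) hlow (by positivity) (by linarith [hμ.2])
    have h3 := mul_le_mul_of_nonneg_left hup hr.le
    have h4 : r * (15 / 32 * (s * ε)) ≤ r * (6 * (r * |Real.sin ta - Real.sin tb|)) := by
      calc _ = (15 / 16) * (r * (s * ε / 2)) := by ring
        _ ≤ _ := h2
        _ = _ := h1.symm
        _ ≤ _ := h3
        _ = _ := by ring
    have h5 := le_of_mul_le_mul_left h4 hr
    have h6 := mul_nonneg hs hε.le
    have h7 : ε * s / 15 = s * ε / 15 := by ring
    rw [h7]
    generalize r * |Real.sin ta - Real.sin tb| = X at h5 ⊢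
    generalize s * ε = Y at h5 h6 ⊢
    linarith
  rcases le_total (Real.sin ta) (Real.sin tb) with h | h
  · rw [abs_of_nonpos (by linarith)] at hfin
    refine le_trans (ENNReal.ofReal_le_ofReal ?_) (le_halfCircleLength hP hr hta htb hAP hBP)
    linarith
  · rw [abs_of_nonneg (by linarith)] at hfin
    refine le_trans (ENNReal.ofReal_le_ofReal hfin) (le_halfCircleLength hP hr htb hta hBP hAP)

/-- The arc bound is integrated over shifts in the upper half of `[0, l]`, with the edge point at
angle `κ₁ * (b / 2)`. The condition `b * η ≤ l` keeps that point outside the disc throughout. -/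
lemma le_volume_cap_of_edge (hP : IsDiscPolygon r P) (hr : 0 < r) {o : Plane} {ε κ₁ τ : ℝ}
    (hε : 0 < ε) (ho : Metric.closedBall o ε ⊆ P) (hκ₁0 : 0 < κ₁) (k1 : κ₁ ≤ 1 / 4)
    (k2 : κ₁ ≤ ε / (4 * r)) (k3 : κ₁ ≤ τ) (k4 : κ₁ * (2 * r) ≤ 1) {v : Plane} {φ₀ σ η l b : ℝ}
    (hσ : σ = 1 ∨ σ = -1) (hv₀ : supportPoint P φ₀ = v) (hv : supportPoint P (φ₀ - σ * η) = v)
    (hη : η ∈ Set.Icc 0 Real.pi)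
    (hE : ∀ s ∈ Set.Icc 0 τ, v - r • unitVec φ₀ + r • unitVec (φ₀ + σ * s) ∈ P)
    (hl : l ∈ Set.Ioc 0 (ε / 16)) (hb : b ∈ Set.Icc (0 : ℝ) 1) (hbl : b * η ≤ l) :
    ENNReal.ofReal (ε * κ₁ / 60 * l * b) ≤ volume (P \ Metric.closedBall
        (supportCentre r P (φ₀ - σ * η) - l • unitVec (φ₀ - σ * η)) r) := by
  rw [volume_cap hP.isCompact.measurableSet (hP.subset_closedBall hr _) _ hl.1.le]
  have hs0 : 0 ≤ κ₁ * (b / 2) := mul_nonneg hκ₁0.le (by linarith [hb.1])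
  have hs1 : κ₁ * (b / 2) ≤ κ₁ := mul_le_of_le_one_right hκ₁0.le (by linarith [hb.2])
  have e0 : ENNReal.ofReal (ε * κ₁ / 60 * l * b) =
      ENNReal.ofReal (ε * (κ₁ * (b / 2)) / 15) * volume (Set.Ico (l / 2) l) := by
    rw [Real.volume_Ico, ← ENNReal.ofReal_mul (by positivity)]
    congr 1; ring
  rw [e0, ← setLIntegral_const]
  refine le_trans (setLIntegral_mono' measurableSet_Ico fun l' hl' => ?_)
    (lintegral_mono_set (Set.Ico_subset_Ico_left (by linarith [hl.1])))
  refine le_halfCircleLength_of_edge hP hr hε ho hσ hv₀ hv hη (by linarith [hl'.1, hl.1])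
    (by linarith [hl'.2, hl.2]) hs0 (hs1.trans k1) (hs1.trans k2) (hE _ ⟨hs0, hs1.trans k3⟩) ?_
  have e1 : r * (κ₁ * (b / 2)) * η = (κ₁ * (2 * r)) * (b * η) / 4 := by ring
  have e2 : (κ₁ * (2 * r)) * (b * η) ≤ 1 * l :=
    mul_le_mul k4 hbl (mul_nonneg hb.1 hη.1) zero_le_one
  linarith [hl'.1]

/-- A lower bound for the caps of `P`, at all scales. -/
lemma exists_le_volume_cap (hP : IsDiscPolygon r P) (hr : 0 < r) {τ : ℝ} (hτ : 0 < τ) :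
    ∃ κ > 0, ∀ (v : Plane) (φ₀ σ η : ℝ), (σ = 1 ∨ σ = -1) → supportPoint P φ₀ = v →
      supportPoint P (φ₀ - σ * η) = v → η ∈ Set.Icc 0 Real.pi →
      (∀ s ∈ Set.Icc 0 τ, v - r • unitVec φ₀ + r • unitVec (φ₀ + σ * s) ∈ P) →
      ∀ l ∈ Set.Ioc 0 (2 * r), ∀ b ∈ Set.Icc (0 : ℝ) 1, b * η ≤ l →
      ENNReal.ofReal (κ * l * b) ≤ volume (P \ Metric.closedBall
        (supportCentre r P (φ₀ - σ * η) - l • unitVec (φ₀ - σ * η)) r) := by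
  obtain ⟨o, ε, hε, ho⟩ := hP.exists_closedBall_subset
  have hεr : ε ≤ r := by
    have := norm_add_le_of_closedBall_subset hε.le (ho.trans (hP.subset_closedBall hr 0))
    linarith [norm_nonneg (o - supportCentre r P 0)]
  obtain ⟨κ₁, hκ₁0, k1, k2, k3, k4⟩ : ∃ κ₁ : ℝ, 0 < κ₁ ∧ κ₁ ≤ 1 / 4 ∧ κ₁ ≤ ε / (4 * r) ∧ κ₁ ≤ τ ∧
      κ₁ * (2 * r) ≤ 1 :=
    ⟨min (min (1 / 4) (ε / (4 * r))) (min τ (1 / (2 * r))), by positivity,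
      (min_le_left _ _).trans (min_le_left _ _), (min_le_left _ _).trans (min_le_right _ _),
      (min_le_right _ _).trans (min_le_left _ _), (le_div_iff₀ (by positivity)).1
        ((min_le_right _ _).trans (min_le_right _ _))⟩
  obtain ⟨l₀, hl₀⟩ : ∃ l₀, l₀ = ε / 16 := ⟨_, rfl⟩
  have hl₀0 : 0 < l₀ := by rw [hl₀]; positivity
  have hl₀r : l₀ ≤ 2 * r := by linarith
  have hq1 : l₀ / (2 * r) ≤ 1 := (div_le_one (by positivity)).2 hl₀r
  have hq0 : 0 < l₀ / (2 * r) := by positivity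
  refine ⟨ε * κ₁ / 60 * (l₀ / (2 * r)) ^ 2, by positivity, ?_⟩
  intro v φ₀ σ η hσ hv₀ hv hη hE l hl b hb hbl
  have hsmall : ∀ l ∈ Set.Ioc 0 l₀, ∀ b ∈ Set.Icc (0 : ℝ) 1, b * η ≤ l →
      ENNReal.ofReal (ε * κ₁ / 60 * l * b) ≤ volume (P \ Metric.closedBall
        (supportCentre r P (φ₀ - σ * η) - l • unitVec (φ₀ - σ * η)) r) := fun l hl b hb hbl =>
    le_volume_cap_of_edge hP hr hε ho hκ₁0 k1 k2 k3 k4 hσ hv₀ hv hη hE (hl₀ ▸ hl) hb hbl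
  rcases le_total l l₀ with h | h
  · refine le_trans (ENNReal.ofReal_le_ofReal ?_) (hsmall l ⟨hl.1, h⟩ b hb hbl)
    have : (l₀ / (2 * r)) ^ 2 ≤ 1 := pow_le_one₀ hq0.le hq1
    have h2 : 0 ≤ ε * κ₁ / 60 * l * b := by have := hl.1; have := hb.1; positivity
    have h3 := mul_le_mul_of_nonneg_left this h2
    linarith
  -- For large `l` the cap contains the one for `l₀`; reducing `b` by the factor `l₀ / (2 * r)`
  -- restores the condition on `b * η`.
  · have hb' : b * (l₀ / (2 * r)) ∈ Set.Icc (0 : ℝ) 1 :=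
      ⟨mul_nonneg hb.1 hq0.le, mul_le_one₀ hb.2 hq0.le hq1⟩
    have hbl' : b * (l₀ / (2 * r)) * η ≤ l₀ := by
      rw [mul_right_comm]
      calc b * η * (l₀ / (2 * r)) ≤ (2 * r) * (l₀ / (2 * r)) :=
            mul_le_mul_of_nonneg_right (hbl.trans hl.2) hq0.le
        _ = l₀ := by field_simp
    have h1 := hsmall l₀ ⟨hl₀0, le_rfl⟩ _ hb' hbl'
    rw [volume_cap hP.isCompact.measurableSet (hP.subset_closedBall hr _) _ hl₀0.le] at h1
    rw [volume_cap hP.isCompact.measurableSet (hP.subset_closedBall hr _) _ hl.1.le]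
    refine le_trans (ENNReal.ofReal_le_ofReal ?_)
      (h1.trans (lintegral_mono_set (Set.Ico_subset_Ico_right h)))
    have e2 : ε * κ₁ / 60 * l₀ * (b * (l₀ / (2 * r))) =
        ε * κ₁ / 60 * (l₀ / (2 * r)) ^ 2 * (2 * r) * b := by
      field_simp
    rw [e2]
    exact mul_le_mul_of_nonneg_right (mul_le_mul_of_nonneg_left hl.2 (by positivity)) hb.1

set_option maxHeartbeats 1000000 in
/-- The arc of the moved disc inside `P` close to an edge, asymptotically. -/
lemma exists_arc_sharp (hP : IsDiscPolygon r P) (hr : 0 < r) {τ k : ℝ} (hτ : 0 < τ) (hk : 1 < k) :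
    ∃ δ > 0, ∀ (v : Plane) (φ₀ σ η : ℝ), (σ = 1 ∨ σ = -1) →
      supportPoint P (φ₀ - σ * η) = v → η ∈ Set.Ioc 0 δ →
      (∀ s ∈ Set.Icc 0 τ, v - r • unitVec φ₀ + r • unitVec (φ₀ + σ * s) ∈ P) →
      ∀ l ∈ Set.Ioc 0 (δ * η), ∃ a ∈ Set.Ioo (-(Real.pi / 2)) (Real.pi / 2),
        ∃ b ∈ Set.Ioo (-(Real.pi / 2)) (Real.pi / 2),
        supportCentre r P (φ₀ - σ * η) - l • unitVec (φ₀ - σ * η) +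
          r • unitVec (φ₀ - σ * η + a) ∈ P ∧
        supportCentre r P (φ₀ - σ * η) - l • unitVec (φ₀ - σ * η) +
          r • unitVec (φ₀ - σ * η + b) ∈ P ∧
        l / (r * η) / k ≤ Real.sin b - Real.sin a := by
  obtain ⟨o, ε, hε, ho⟩ := hP.exists_closedBall_subset
  -- Four losses: one in choosing `s` below `u`, two in the difference of sines, one for moving the
  -- points to the circle.
  obtain ⟨k₁, hk₁, rfl⟩ := exists_pow_le hk (n := 4) (by norm_num)
  have hk₁0 : 0 < k₁ := by linarith
  obtain ⟨x₀, hx₀, hsmall⟩ := exists_small_angle hk₁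
  have hd1 : 0 < 1 - 1 / k₁ := by rw [sub_pos, div_lt_one hk₁0]; exact hk₁
  have hd2 : 0 < ε * (1 / k₁ ^ 3 * (1 - 1 / k₁)) / (4 * r) := by positivity
  set δ := min (min (min 1 (x₀ / 2)) (min (r * (x₀ / 2)) (r * (1 / 4))))
    (min (min (r * τ) (r * (1 - 1 / k₁))) (min (ε / 16) (ε * (1 / k₁ ^ 3 * (1 - 1 / k₁)) / (4 * r))))
    with hδ
  have hx₀0 := hx₀.1
  have hδ0 : 0 < δ := by positivity
  have d1 : δ ≤ 1 := (min_le_left _ _).trans ((min_le_left _ _).trans (min_le_left _ _))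
  have d2 : δ ≤ x₀ / 2 := (min_le_left _ _).trans ((min_le_left _ _).trans (min_le_right _ _))
  have d3 : δ ≤ r * (x₀ / 2) := (min_le_left _ _).trans ((min_le_right _ _).trans (min_le_left _ _))
  have d4 : δ ≤ r * (1 / 4) := (min_le_left _ _).trans ((min_le_right _ _).trans (min_le_right _ _))
  have d5 : δ ≤ r * τ := (min_le_right _ _).trans ((min_le_left _ _).trans (min_le_left _ _))
  have d6 : δ ≤ r * (1 - 1 / k₁) :=
    (min_le_right _ _).trans ((min_le_left _ _).trans (min_le_right _ _))
  have d7 : δ ≤ ε / 16 := (min_le_right _ _).trans ((min_le_right _ _).trans (min_le_left _ _))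
  have d8 : δ ≤ ε * (1 / k₁ ^ 3 * (1 - 1 / k₁)) / (4 * r) :=
    (min_le_right _ _).trans ((min_le_right _ _).trans (min_le_right _ _))
  refine ⟨δ, hδ0, ?_⟩
  intro v φ₀ σ η hσ hv hη hE l hl
  have hη0 := hη.1
  have hl0 := hl.1
  set φ := φ₀ - σ * η with hφ
  set c := supportCentre r P φ - l • unitVec φ with hcdef
  set u := l / (r * η) with hu
  have hu0 : 0 < u := by positivity
  have hur : u * r ≤ δ := by
    rw [hu, div_mul_eq_mul_div, div_le_iff₀ (by positivity)]
    nlinarith [hl.2]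
  -- `u` is the limiting length of the arc. At the slightly smaller angle `s` the edge point is
  -- still outside the moved disc, and the circle crosses the segment from it to `o`.
  set s := u / k₁ with hs
  have hs0 : 0 < s := by positivity
  have hsu : s ≤ u := div_le_self hu0.le hk₁.le
  have hsr : s * r ≤ δ := (mul_le_mul_of_nonneg_right hsu hr.le).trans hur
  have s1 : s ≤ x₀ / 2 := by nlinarith
  have s2 : s ≤ 1 / 4 := by nlinarith
  have s3 : s ≤ τ := by nlinarith
  have s4 : s ≤ 1 - 1 / k₁ := by nlinarith
  have hl16 : l ≤ ε / 16 := by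
    have : δ * η ≤ δ * 1 := mul_le_mul_of_nonneg_left (hη.2.trans d1) hδ0.le
    linarith [hl.2]
  set x := v - r • unitVec φ₀ + r • unitVec (φ₀ + σ * s) with hx
  have hxP : x ∈ P := hE s ⟨hs0.le, s3⟩
  have hcen : supportCentre r P φ = v - r • unitVec φ := by rw [supportCentre, hv]
  have hσabs : |σ| = 1 := by rcases hσ with h | h <;> simp [h]
  have hσσ : σ * σ = 1 := by rcases hσ with h | h <;> simp [h]
  have hoP : o ∈ P := ho (Metric.mem_closedBall_self hε.le)
  have hvP : v ∈ P := hv ▸ hP.supportPoint_mem φ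
  have hxv : ‖x - v‖ ≤ r * s := by
    rw [hx, show v - r • unitVec φ₀ + r • unitVec (φ₀ + σ * s) - v =
      r • (unitVec (φ₀ + σ * s) - unitVec φ₀) by module, norm_smul, Real.norm_of_nonneg hr.le]
    have := norm_unitVec_sub_le (φ₀ + σ * s) φ₀
    rw [add_sub_cancel_left, abs_mul, hσabs, one_mul, abs_of_nonneg hs0.le] at this
    gcongr
  have hxc : r ≤ ‖x - c‖ := by
    rw [hcdef, hcen]
    refine le_norm_edge_sub hσ hr ⟨hη0.le, by linarith [Real.pi_gt_three, hη.2]⟩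
      ⟨hs0.le, by linarith [Real.pi_gt_three]⟩ ?_
    have := abs_cos_sub_cos_le (s + η) η
    rw [add_sub_cancel_right, abs_of_nonneg hs0.le] at this
    have h1 := (abs_le.1 this).1
    have h2 : r * s * η = l * (1 / k₁) := by rw [hs, hu]; field_simp
    rw [h2]
    refine mul_le_mul_of_nonneg_left ?_ hl0.le
    linarith
  have hvc : r ≤ ‖v - c‖ := by
    rw [hcdef, hcen, show v - (v - r • unitVec φ - l • unitVec φ) = (r + l) • unitVec φ by module,
      norm_smul, norm_unitVec, mul_one, Real.norm_of_nonneg (by positivity)]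
    linarith
  obtain ⟨μ, hμ, ta, hta, -, hA⟩ := exists_crossing hP hr hε ho hl0 hl16 hxP
    (by rw [hv]; nlinarith) hxc
  obtain ⟨ν, hν, tb, htb, -, hB⟩ := exists_crossing hP hr hε ho hl0 hl16 hvP
    (by rw [hv]; simp; positivity) hvc
  rw [← hcdef] at hA hB
  have hle : l / ε ≤ 1 / 16 := by rw [div_le_iff₀ hε]; linarith
  have hconv : ∀ y ∈ P, ∀ μ ∈ Set.Icc 0 (l / ε), y + μ • (o - y) ∈ P := fun y hy μ hμ =>
    hP.convex.add_smul_sub_mem hy hoP ⟨hμ.1, by linarith [hμ.2]⟩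
  have hAP := hA ▸ hconv x hxP μ hμ
  have hBP := hB ▸ hconv v hvP ν hν
  -- Moving a point to the circle shifts its tangential coordinate by at most `(l / ε) * (2 * r)`,
  -- which is of order `η * u` and negligible for small `η`.
  have herr : ∀ y ∈ P, ∀ μ ∈ Set.Icc 0 (l / ε),
      |μ * inner ℝ (o - y) (unitVec (φ + Real.pi / 2))| ≤ (l / ε) * (2 * r) := by
    intro y hy μ hμ
    rw [abs_mul, abs_of_nonneg hμ.1]
    have h1 := abs_real_inner_le_norm (o - y) (unitVec (φ + Real.pi / 2))
    rw [norm_unitVec, mul_one] at h1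
    exact mul_le_mul hμ.2 (h1.trans (norm_sub_le_two_mul_of_mem hP hr hoP hy)) (abs_nonneg _) (by positivity)
  have hsinx : ∀ a, r * Real.sin a = inner ℝ (c + r • unitVec (φ + a) - v) (unitVec (φ + Real.pi / 2))
      := by
    intro a
    rw [show c + r • unitVec (φ + a) - v = r • unitVec (φ + a) - (r + l) • unitVec φ by
      rw [hcdef, hcen]; module, inner_sub_left, real_inner_smul_left, real_inner_smul_left,
      inner_unitVec, inner_unitVec, add_sub_add_left_eq_sub, Real.cos_sub_pi_div_two]
    simp
  have hsA := hsinx ta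
  have hsB := hsinx tb
  rw [← hA, show x + μ • (o - x) - v = (x - v) + μ • (o - x) by abel, inner_add_left,
    real_inner_smul_left] at hsA
  rw [← hB, add_sub_cancel_left, real_inner_smul_left] at hsB
  have hxe : inner ℝ (x - v) (unitVec (φ + Real.pi / 2)) =
      σ * (r * (Real.sin (s + η) - Real.sin η)) := by
    rw [show x - v = r • unitVec (φ₀ + σ * s) - r • unitVec φ₀ by rw [hx]; module, inner_sub_left,
      real_inner_smul_left, real_inner_smul_left, inner_unitVec, inner_unitVec,
      show φ₀ + σ * s - (φ + Real.pi / 2) = σ * (s + η) - Real.pi / 2 by rw [hφ]; ring,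
      show φ₀ - (φ + Real.pi / 2) = σ * η - Real.pi / 2 by rw [hφ]; ring, Real.cos_sub_pi_div_two,
      Real.cos_sub_pi_div_two]
    rcases hσ with h | h <;> simp [h, Real.sin_add] <;> ring
  rw [hxe] at hsA
  have hEA := herr x hxP μ hμ
  have hEB := herr v hvP ν hν
  set eA := μ * inner ℝ (o - x) (unitVec (φ + Real.pi / 2))
  set eB := ν * inner ℝ (o - v) (unitVec (φ + Real.pi / 2))
  have hgap : s / k₁ ^ 2 ≤ Real.sin (s + η) - Real.sin η := by
    rw [Real.sin_sub_sin, show (s + η - η) / 2 = s / 2 by ring]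
    have h1 := (hsmall (s / 2) ⟨by positivity, by linarith⟩).1
    have h2 := (hsmall ((s + η + η) / 2) ⟨by positivity, by linarith [hη.2]⟩).2.2
    have h3 : s / 2 * 1 ≤ (k₁ * Real.sin (s / 2)) * (k₁ * Real.cos ((s + η + η) / 2)) :=
      mul_le_mul h1 h2 zero_le_one ((by positivity : (0:ℝ) ≤ s / 2).trans h1)
    rw [div_le_iff₀ (by positivity)]
    linarith
  have hmain : u / k₁ ^ 4 ≤ (Real.sin (s + η) - Real.sin η) - 4 * (l / ε) := by
    have h1 : l = u * (r * η) := by rw [hu]; field_simp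
    have h2 : 4 * (l / ε) ≤ u * (1 / k₁ ^ 3 * (1 - 1 / k₁)) := by
      rw [h1, show 4 * (u * (r * η) / ε) = u * (η * (4 * r) / ε) by ring]
      refine mul_le_mul_of_nonneg_left ?_ hu0.le
      rw [div_le_iff₀ hε]
      have := (le_div_iff₀ (by positivity)).1 (hη.2.trans d8)
      linarith
    have h3 : s / k₁ ^ 2 = u * (1 / k₁ ^ 3) := by rw [hs]; field_simp
    have h4 : u / k₁ ^ 4 = u * (1 / k₁ ^ 3) - u * (1 / k₁ ^ 3 * (1 - 1 / k₁)) := by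
      field_simp; ring
    linarith
  have hA2 := abs_le.1 hEA
  have hB2 := abs_le.1 hEB
  have hfin : r * (u / k₁ ^ 4) ≤ σ * (r * Real.sin ta - r * Real.sin tb) := by
    rw [hsA, hsB]
    have h1 : σ * (σ * (r * (Real.sin (s + η) - Real.sin η)) + eA - eB) =
        r * (Real.sin (s + η) - Real.sin η) + σ * (eA - eB) := by
      linear_combination (r * (Real.sin (s + η) - Real.sin η)) * hσσ
    rw [h1]
    have h2 : -(4 * r * (l / ε)) ≤ σ * (eA - eB) := by
      have h3 : |σ * (eA - eB)| ≤ 4 * r * (l / ε) := by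
        rw [abs_mul, hσabs, one_mul]
        refine (abs_sub _ _).trans ?_
        linarith
      exact (abs_le.1 h3).1
    have h4 := mul_le_mul_of_nonneg_left hmain hr.le
    linarith
  rcases hσ with h | h
  · refine ⟨tb, htb, ta, hta, hBP, hAP, ?_⟩
    rw [h, one_mul, ← mul_sub] at hfin
    exact le_of_mul_le_mul_left hfin hr
  · refine ⟨ta, hta, tb, htb, hAP, hBP, ?_⟩
    rw [h, neg_one_mul, neg_sub, ← mul_sub] at hfin
    exact le_of_mul_le_mul_left hfin hr

end Geometry

/-! ### Caps and chords at a corner -/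

section Geometry

variable {r : ℝ} {P : Set Plane}

/-- Rules out the far half of the moved circle. The two extreme discs at `v` meet in a lens whose
points are within `2 r cos (ω / 2)` of `v`, while a point with negative cosine and small sine is
farther away. -/
lemma cos_pos_of_mem_lens {v : Plane} {φ₀ σ ω η t l : ℝ} (hσ : σ = 1 ∨ σ = -1) (hr : 0 < r)
    (hω : ω ∈ Set.Ioo 0 Real.pi) (hl : 0 ≤ l) (hs : |Real.sin t| < Real.sin (ω / 2))
    (h₁ : v - r • unitVec (φ₀ - σ * η) - l • unitVec (φ₀ - σ * η) + r • unitVec (φ₀ - σ * η + t) ∈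
      Metric.closedBall (v - r • unitVec φ₀) r)
    (h₂ : v - r • unitVec (φ₀ - σ * η) - l • unitVec (φ₀ - σ * η) + r • unitVec (φ₀ - σ * η + t) ∈
      Metric.closedBall (v - r • unitVec (φ₀ - σ * ω)) r) : 0 < Real.cos t := by
  set φ := φ₀ - σ * η
  set y := r • unitVec (φ + t) - (r + l) • unitVec φ with hy
  rw [mem_closedBall_iff_norm] at h₁ h₂
  rw [show v - r • unitVec φ - l • unitVec φ + r • unitVec (φ + t) - (v - r • unitVec φ₀) =
    y + r • unitVec φ₀ by rw [hy]; module] at h₁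
  rw [show v - r • unitVec φ - l • unitVec φ + r • unitVec (φ + t) - (v - r • unitVec (φ₀ - σ * ω)) =
    y + r • unitVec (φ₀ - σ * ω) by rw [hy]; module] at h₂
  have h1 := pow_le_pow_left₀ (norm_nonneg _) h₁ 2
  have h2 := pow_le_pow_left₀ (norm_nonneg _) h₂ 2
  rw [norm_add_sq_real, norm_smul, norm_unitVec, mul_one, Real.norm_of_nonneg hr.le,
    real_inner_smul_right] at h1 h2
  have hS : unitVec φ₀ + unitVec (φ₀ - σ * ω) = (2 * Real.cos (ω / 2)) • unitVec (φ₀ - σ * ω / 2) := by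
    have hc : Real.cos (σ * ω / 2) = Real.cos (ω / 2) := by
      rcases hσ with h | h <;> simp [h, neg_div]
    have e1 := unitVec_add (φ₀ - σ * ω / 2) (σ * ω / 2)
    have e2 := unitVec_add (φ₀ - σ * ω / 2) (-(σ * ω / 2))
    rw [show φ₀ - σ * ω / 2 + σ * ω / 2 = φ₀ by ring] at e1
    rw [show φ₀ - σ * ω / 2 + -(σ * ω / 2) = φ₀ - σ * ω by ring, Real.cos_neg, Real.sin_neg] at e2
    rw [e1, e2, hc]; module
  have hC0 : 0 < Real.cos (ω / 2) := Real.cos_pos_of_mem_Ioo ⟨by linarith [hω.1, Real.pi_pos], by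
    linarith [hω.2]⟩
  have hs0 : 0 < Real.sin (ω / 2) := (abs_nonneg _).trans_lt hs
  have hC1 : Real.cos (ω / 2) < 1 := by nlinarith [Real.sin_sq_add_cos_sq (ω / 2)]
  have h3 : ‖y‖ ^ 2 + r * (2 * Real.cos (ω / 2)) * inner ℝ y (unitVec (φ₀ - σ * ω / 2)) ≤ 0 := by
    rw [mul_assoc, ← real_inner_smul_right, ← hS, inner_add_right]
    nlinarith
  have h4 := abs_real_inner_le_norm y (unitVec (φ₀ - σ * ω / 2))
  rw [norm_unitVec, mul_one] at h4
  have h5 : ‖y‖ ^ 2 ≤ r * (2 * Real.cos (ω / 2)) * ‖y‖ := by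
    have := mul_le_mul_of_nonneg_left (neg_le_of_abs_le h4)
      (by positivity : 0 ≤ r * (2 * Real.cos (ω / 2)))
    linarith
  have h6 : ‖y‖ ^ 2 ≤ (r * (2 * Real.cos (ω / 2))) ^ 2 := by
    nlinarith [norm_nonneg y, mul_pos hr hC0, sq_nonneg (‖y‖ - r * (2 * Real.cos (ω / 2)))]
  have h7 : ‖y‖ ^ 2 = r ^ 2 + (r + l) ^ 2 - 2 * r * (r + l) * Real.cos t := by
    rw [hy, norm_sub_sq_real, norm_smul, norm_smul, norm_unitVec, norm_unitVec,
      real_inner_smul_left, real_inner_smul_right, inner_unitVec, add_sub_cancel_left,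
      Real.norm_of_nonneg hr.le, Real.norm_of_nonneg (by positivity)]
    ring
  by_contra hneg
  push Not at hneg
  have h8 : Real.cos t < -Real.cos (ω / 2) := by
    have e : Real.sin t ^ 2 < Real.sin (ω / 2) ^ 2 := by
      rw [← sq_abs]; exact pow_lt_pow_left₀ hs (abs_nonneg _) two_ne_zero
    have e2 : Real.cos (ω / 2) ^ 2 < Real.cos t ^ 2 := by
      linarith [Real.sin_sq_add_cos_sq (ω / 2), Real.sin_sq_add_cos_sq t]
    have := sq_lt_sq.1 e2
    rwa [abs_of_pos hC0, abs_of_nonpos hneg, lt_neg] at this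
  have h9 : r ^ 2 * (2 + 2 * Real.cos (ω / 2)) ≤ ‖y‖ ^ 2 := by
    rw [h7]
    have e1 : r * (r + l) * Real.cos (ω / 2) ≤ r * (r + l) * -Real.cos t :=
      mul_le_mul_of_nonneg_left (by linarith) (by positivity)
    have e2 : r * r * Real.cos (ω / 2) ≤ r * (r + l) * Real.cos (ω / 2) := by
      apply mul_le_mul_of_nonneg_right _ hC0.le
      nlinarith
    nlinarith [mul_nonneg hr.le hl, sq_nonneg l]
  have h10 : 0 < r ^ 2 * ((1 - Real.cos (ω / 2)) * (1 + 2 * Real.cos (ω / 2))) := by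
    have : 0 < 1 - Real.cos (ω / 2) := by linarith
    positivity
  nlinarith

lemma IsDiscCorner.supportCentre_eq {v : Plane} {φ₀ σ ω τ : ℝ} (h : IsDiscCorner r P v φ₀ σ ω τ)
    {η : ℝ} (hη : η ∈ Set.Icc 0 ω) :
    supportCentre r P (φ₀ - σ * η) = v - r • unitVec (φ₀ - σ * η) := by
  rw [supportCentre, h.supportPoint_eq η hη]

lemma IsDiscCorner.subset_closedBall {v : Plane} {φ₀ σ ω τ : ℝ} (h : IsDiscCorner r P v φ₀ σ ω τ)
    (hP : IsDiscPolygon r P) (hr : 0 < r) {η : ℝ} (hη : η ∈ Set.Icc 0 ω) :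
    P ⊆ Metric.closedBall (v - r • unitVec (φ₀ - σ * η)) r :=
  h.supportCentre_eq hη ▸ hP.subset_closedBall hr _

/-- The discs touching at `v` with the two extreme normals bound the arc of the moved circle on
either side. -/
lemma IsDiscCorner.sin_le {v : Plane} {φ₀ σ ω τ : ℝ} (h : IsDiscCorner r P v φ₀ σ ω τ)
    (hP : IsDiscPolygon r P) (hr : 0 < r) {η l t : ℝ} (hη : 0 < η) (hηω : η < ω) (hl : 0 ≤ l)
    (hx : v - r • unitVec (φ₀ - σ * η) - l • unitVec (φ₀ - σ * η) +
      r • unitVec (φ₀ - σ * η + t) ∈ P) :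
    σ * Real.sin t ≤ l / (r * Real.sin η) ∧ -(σ * Real.sin t) ≤ l / (r * Real.sin (ω - η)) := by
  have hω := h.lt_pi
  have h1 : 0 < Real.sin η := Real.sin_pos_of_pos_of_lt_pi hη (by linarith)
  have h2 : 0 < Real.sin (ω - η) := Real.sin_pos_of_pos_of_lt_pi (by linarith) (by linarith)
  have hσ : ∀ x, Real.sin (σ * x) = σ * Real.sin x := fun x => by
    rcases h.sign with h | h <;> simp [h]
  constructor
  · have h3 := h.subset_closedBall hP hr (η := 0) ⟨le_rfl, h.pos.le⟩ hx
    rw [mul_zero, sub_zero, show v - r • unitVec φ₀ = v - r • unitVec (φ₀ - σ * η + σ * η) by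
      rw [sub_add_cancel]] at h3
    have := sin_mul_sin_le hr hl h3
    rw [hσ] at this
    rw [le_div_iff₀ (by positivity)]
    linarith
  · have h3 := h.subset_closedBall hP hr (η := ω) ⟨h.pos.le, le_rfl⟩ hx
    rw [show φ₀ - σ * ω = φ₀ - σ * η + σ * (-(ω - η)) by ring] at h3
    have := sin_mul_sin_le hr hl h3
    rw [hσ, Real.sin_neg] at this
    rw [le_div_iff₀ (by positivity)]
    linarith

lemma IsDiscCorner.chordMeasure_le {v : Plane} {φ₀ σ ω τ : ℝ} (h : IsDiscCorner r P v φ₀ σ ω τ)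
    (hP : IsDiscPolygon r P) (hr : 0 < r) {η l : ℝ} (hη : 0 < η) (hηω : η < ω) (hl : 0 ≤ l)
    (h₁ : l / (r * Real.sin η) < Real.sin (ω / 2))
    (h₂ : l / (r * Real.sin (ω - η)) < Real.sin (ω / 2)) :
    chordMeasure r P (supportCentre r P (φ₀ - σ * η) - l • unitVec (φ₀ - σ * η)) ≤
      ENNReal.ofReal (r ^ 2 * (Real.arcsin (l / (r * Real.sin η)) +
        Real.arcsin (l / (r * Real.sin (ω - η)))) ^ 3 / 6) := by
  have hω := h.lt_pi
  have hω0 := h.pos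
  have hs1 : 0 < Real.sin η := Real.sin_pos_of_pos_of_lt_pi hη (by linarith)
  have hs2 : 0 < Real.sin (ω - η) := Real.sin_pos_of_pos_of_lt_pi (by linarith) (by linarith)
  rw [h.supportCentre_eq ⟨hη.le, hηω.le⟩]
  set φ := φ₀ - σ * η
  set u₁ := l / (r * Real.sin η)
  set u₂ := l / (r * Real.sin (ω - η))
  have hu1 : 0 ≤ u₁ := by positivity
  have hu2 : 0 ≤ u₂ := by positivity
  have hsw : Real.sin (ω / 2) ≤ 1 := Real.sin_le_one _
  have key : ∀ t ∈ Set.Ioc (-Real.pi) Real.pi,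
      v - r • unitVec φ - l • unitVec φ + r • unitVec (φ + t) ∈ P →
      t ∈ Set.Ioo (-(Real.pi / 2)) (Real.pi / 2) ∧ σ * Real.sin t ≤ u₁ ∧ -(σ * Real.sin t) ≤ u₂ := by
    intro t ht hx
    obtain ⟨e1, e2⟩ := h.sin_le hP hr hη hηω hl hx
    refine ⟨?_, e1, e2⟩
    have hlt : |Real.sin t| < Real.sin (ω / 2) := by
      have : |Real.sin t| = |σ * Real.sin t| := by
        rcases h.sign with h | h <;> simp [h]
      rw [this, abs_lt]
      constructor <;> linarith
    have h0 := h.subset_closedBall hP hr (η := 0) ⟨le_rfl, h.pos.le⟩ hx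
    rw [mul_zero, sub_zero] at h0
    have hc := cos_pos_of_mem_lens h.sign hr ⟨hω0, hω⟩ hl hlt h0
      (h.subset_closedBall hP hr (η := ω) ⟨h.pos.le, le_rfl⟩ hx)
    rw [Set.mem_Ioo, ← abs_lt]
    by_contra hcon
    push Not at hcon
    have habs : |t| ≤ Real.pi := abs_le.2 ⟨ht.1.le, ht.2⟩
    have := Real.cos_nonpos_of_pi_div_two_le_of_le hcon (by linarith)
    rw [Real.cos_abs] at this
    linarith
  have ha1 : Real.arcsin u₁ ∈ Set.Ico 0 (Real.pi / 2) :=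
    ⟨Real.arcsin_nonneg.2 hu1, Real.arcsin_lt_pi_div_two.2 (by linarith)⟩
  have ha2 : Real.arcsin u₂ ∈ Set.Ico 0 (Real.pi / 2) :=
    ⟨Real.arcsin_nonneg.2 hu2, Real.arcsin_lt_pi_div_two.2 (by linarith)⟩
  have up : ∀ {t u : ℝ}, t ∈ Set.Ioo (-(Real.pi / 2)) (Real.pi / 2) → Real.sin t ≤ u →
      t ≤ Real.arcsin u := fun {t u} ht hu => by
    rw [← Real.arcsin_sin ht.1.le ht.2.le]
    exact Real.monotone_arcsin hu
  have hm := hP.isCompact.measurableSet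
  rcases h.sign with hs | hs
  · rw [add_comm (Real.arcsin u₁)]
    refine _root_.chordMeasure_le hr hm _ φ ha2 ha1 fun t ht hx => ?_
    obtain ⟨k1, k2, k3⟩ := key t ht hx
    rw [hs, one_mul] at k2 k3
    exact ⟨neg_le.1 (up ⟨by linarith [k1.2], by linarith [k1.1]⟩ (by rwa [Real.sin_neg])), up k1 k2⟩
  · refine _root_.chordMeasure_le hr hm _ φ ha1 ha2 fun t ht hx => ?_
    obtain ⟨k1, k2, k3⟩ := key t ht hx
    rw [hs, neg_one_mul] at k2 k3
    rw [neg_neg] at k3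
    exact ⟨neg_le.1 (up ⟨by linarith [k1.2], by linarith [k1.1]⟩ (by rwa [Real.sin_neg])), up k1 k3⟩

/-- At shift `l'` the half circle inside `P` has projected length at most `l'` times the sum of the
two reciprocal sines; integration over `l'` gives the square. -/
lemma IsDiscCorner.volume_cap_le {v : Plane} {φ₀ σ ω τ : ℝ} (h : IsDiscCorner r P v φ₀ σ ω τ)
    (hP : IsDiscPolygon r P) (hr : 0 < r) {η l : ℝ} (hη : 0 < η) (hηω : η < ω) (hl : 0 ≤ l) :
    volume (P \ Metric.closedBall
      (supportCentre r P (φ₀ - σ * η) - l • unitVec (φ₀ - σ * η)) r) ≤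
      ENNReal.ofReal ((1 / Real.sin η + 1 / Real.sin (ω - η)) * (l ^ 2 / 2)) := by
  have hω := h.lt_pi
  have hs1 : 0 < Real.sin η := Real.sin_pos_of_pos_of_lt_pi hη (by linarith)
  have hs2 : 0 < Real.sin (ω - η) := Real.sin_pos_of_pos_of_lt_pi (by linarith) (by linarith)
  set B := 1 / Real.sin η + 1 / Real.sin (ω - η) with hB
  have hB0 : 0 < B := by positivity
  rw [volume_cap hP.isCompact.measurableSet (hP.subset_closedBall hr _) _ hl,
    h.supportCentre_eq ⟨hη.le, hηω.le⟩]
  set φ := φ₀ - σ * η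
  have hlen : ∀ l' ∈ Set.Ico 0 l, halfCircleLength r P φ (v - r • unitVec φ - l' • unitVec φ) ≤
      ENNReal.ofReal (B * l') := by
    intro l' hl'
    have key : ∀ x ∈ {h : ℝ | h ∈ Set.Icc (-r) r ∧ v - r • unitVec φ - l' • unitVec φ +
        √(r ^ 2 - h ^ 2) • unitVec φ + h • unitVec (φ + Real.pi / 2) ∈ P},
        σ * x ≤ l' / Real.sin η ∧ -(σ * x) ≤ l' / Real.sin (ω - η) := by
      rintro x ⟨hx, hxP⟩
      have hx1 : -1 ≤ x / r := by rw [le_div_iff₀ hr]; linarith [hx.1]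
      have hx2 : x / r ≤ 1 := by rw [div_le_iff₀ hr]; linarith [hx.2]
      have hsin := Real.sin_arcsin hx1 hx2
      have e : v - r • unitVec φ - l' • unitVec φ + √(r ^ 2 - x ^ 2) • unitVec φ +
          x • unitVec (φ + Real.pi / 2) = v - r • unitVec φ - l' • unitVec φ +
          r • unitVec (φ + Real.arcsin (x / r)) := by
        rw [unitVec_add φ (Real.arcsin (x / r)), hsin, Real.cos_arcsin, smul_add, smul_smul, smul_smul,
          mul_div_cancel₀ _ hr.ne', add_assoc]
        congr 3
        rw [show r ^ 2 - x ^ 2 = r ^ 2 * (1 - (x / r) ^ 2) by field_simp,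
          Real.sqrt_mul (sq_nonneg r), Real.sqrt_sq hr.le]
      rw [e] at hxP
      obtain ⟨e1, e2⟩ := h.sin_le hP hr hη hηω hl'.1 hxP
      rw [hsin, le_div_iff₀ (by positivity)] at e1 e2
      rw [le_div_iff₀ hs1, le_div_iff₀ hs2]
      have f1 : σ * (x / r) * (r * Real.sin η) = σ * x * Real.sin η := by field_simp
      have f2 : -(σ * (x / r)) * (r * Real.sin (ω - η)) = -(σ * x) * Real.sin (ω - η) := by field_simp
      exact ⟨f1 ▸ e1, f2 ▸ e2⟩
    have e3 : B * l' = l' / Real.sin η + l' / Real.sin (ω - η) := by rw [hB]; ring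
    rw [halfCircleLength]
    rcases h.sign with hs | hs
    · calc _ ≤ volume (Set.Icc (-(l' / Real.sin (ω - η))) (l' / Real.sin η)) := by
            refine measure_mono fun x hx => ?_
            obtain ⟨k1, k2⟩ := key x hx
            rw [hs, one_mul] at k1 k2
            exact ⟨by linarith, k1⟩
        _ = _ := by rw [Real.volume_Icc]; congr 1; rw [e3]; ring
    · calc _ ≤ volume (Set.Icc (-(l' / Real.sin η)) (l' / Real.sin (ω - η))) := by
            refine measure_mono fun x hx => ?_
            obtain ⟨k1, k2⟩ := key x hx
            rw [hs, neg_one_mul] at k1 k2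
            exact ⟨by linarith, by linarith⟩
        _ = _ := by rw [Real.volume_Icc]; congr 1; rw [e3]; ring
  refine (setLIntegral_mono' measurableSet_Ico hlen).trans ?_
  rw [setLIntegral_congr Ico_ae_eq_Ioc]
  rw [setLIntegral_ofReal_eq_sub (F := fun x => B * (x ^ 2 / 2)) hl]
  · apply ENNReal.ofReal_le_ofReal; simp
  · intro x _
    refine (((hasDerivAt_id x).pow 2).div_const 2 |>.const_mul B).congr_deriv ?_
    simp
  · fun_prop
  · exact fun x hx => mul_nonneg hB0.le hx.1

lemma IsDiscCorner.exists_le_sin {v : Plane} {φ₀ σ ω τ : ℝ} (h : IsDiscCorner r P v φ₀ σ ω τ) :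
    ∃ s > 0, ∀ η ∈ Set.Icc 0 (ω / 2), s ≤ Real.sin (ω - η) := by
  have h1 := h.lt_pi
  have h2 := h.pos
  obtain ⟨x, hx, hmin⟩ := (isCompact_Icc (a := 0) (b := ω / 2)).exists_isMinOn
    (Set.nonempty_Icc.2 (by linarith)) (f := fun η => Real.sin (ω - η)) (by fun_prop)
  exact ⟨_, Real.sin_pos_of_pos_of_lt_pi (by linarith [hx.2]) (by linarith [hx.1]), fun η hη => hmin hη⟩

/-- A crude cubic bound, uniform up to half the arc of normals; the sharp constant matters only near
its end. -/
lemma IsDiscCorner.exists_chordMeasure_le {v : Plane} {φ₀ σ ω τ : ℝ}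
    (h : IsDiscCorner r P v φ₀ σ ω τ) (hP : IsDiscPolygon r P) (hr : 0 < r) :
    ∃ δ > 0, ∃ C ≥ 0, ∀ η ∈ Set.Ioc 0 (ω / 2), ∀ l ∈ Set.Icc 0 (δ * η),
      chordMeasure r P (supportCentre r P (φ₀ - σ * η) - l • unitVec (φ₀ - σ * η)) ≤
        ENNReal.ofReal (C * (l / η) ^ 3) := by
  obtain ⟨s, hs, hsin⟩ := h.exists_le_sin
  have hω := h.lt_pi
  have hω0 := h.pos
  have hpi := Real.pi_pos
  have hsw : 0 < Real.sin (ω / 2) := Real.sin_pos_of_pos_of_lt_pi (by linarith) (by linarith)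
  have harc : ∀ x ∈ Set.Icc (0 : ℝ) 1, Real.arcsin x ≤ Real.pi / 2 * x := by
    intro x hx
    have h2 := Real.mul_le_sin (Real.arcsin_nonneg.2 hx.1) (Real.arcsin_le_pi_div_two x)
    rw [Real.sin_arcsin (by linarith [hx.1]) hx.2, div_mul_eq_mul_div, div_le_iff₀ hpi] at h2
    linarith
  obtain ⟨δ, hδ, d1, d2⟩ : ∃ δ > 0, Real.pi / 2 * (δ / r) < Real.sin (ω / 2) ∧
      Real.pi / s * (δ / r) < Real.sin (ω / 2) := by
    refine ⟨min (r * Real.sin (ω / 2) / Real.pi) (r * Real.sin (ω / 2) * s / (2 * Real.pi)),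
      by positivity, ?_, ?_⟩
    · calc _ ≤ Real.pi / 2 * (r * Real.sin (ω / 2) / Real.pi / r) := by
            gcongr; exact min_le_left _ _
        _ = Real.sin (ω / 2) / 2 := by field_simp
        _ < _ := by linarith
    · calc _ ≤ Real.pi / s * (r * Real.sin (ω / 2) * s / (2 * Real.pi) / r) := by
            gcongr; exact min_le_right _ _
        _ = Real.sin (ω / 2) / 2 := by field_simp
        _ < _ := by linarith
  refine ⟨δ, hδ, r ^ 2 * ((Real.pi / 2 * (Real.pi / 2) + Real.pi / 2 * (Real.pi / s)) / r) ^ 3 / 6,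
    by positivity, fun η hη l hl => ?_⟩
  have hη0 := hη.1
  have hlη : l / η ≤ δ := (div_le_iff₀ hη0).2 hl.2
  have hlη0 : 0 ≤ l / η := div_nonneg hl.1 hη0.le
  have hsη : 2 / Real.pi * η ≤ Real.sin η := Real.mul_le_sin hη0.le (by linarith [hη.2])
  have hs1 : 0 < Real.sin η := lt_of_lt_of_le (by positivity) hsη
  have hs2 : 0 < Real.sin (ω - η) := hs.trans_le (hsin η ⟨hη0.le, hη.2⟩)
  have hu1 : l / (r * Real.sin η) ≤ Real.pi / 2 * (l / η / r) := by
    calc _ ≤ l / (r * (2 / Real.pi * η)) := by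
          have := hl.1
          gcongr
      _ = _ := by field_simp
  have hu2 : l / (r * Real.sin (ω - η)) ≤ Real.pi / s * (l / η / r) := by
    calc _ ≤ l / (r * s) := by
          have := hl.1
          gcongr
          exact hsin η ⟨hη0.le, hη.2⟩
      _ = η / s * (l / η / r) := by field_simp
      _ ≤ _ := by
          gcongr
          linarith [hη.2]
  have hlr : l / η / r ≤ δ / r := by gcongr
  have hu1' : l / (r * Real.sin η) < Real.sin (ω / 2) :=
    (hu1.trans (mul_le_mul_of_nonneg_left hlr (by positivity))).trans_lt d1
  have hu2' : l / (r * Real.sin (ω - η)) < Real.sin (ω / 2) :=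
    (hu2.trans (mul_le_mul_of_nonneg_left hlr (by positivity))).trans_lt d2
  have hl0 := hl.1
  have hn1 : 0 ≤ l / (r * Real.sin η) := by positivity
  have hn2 : 0 ≤ l / (r * Real.sin (ω - η)) := by positivity
  have hw1 := Real.sin_le_one (ω / 2)
  refine (h.chordMeasure_le hP hr hη0 (by linarith [hη.2]) hl.1 hu1' hu2').trans
    (ENNReal.ofReal_le_ofReal ?_)
  have h1 := (harc _ ⟨hn1, by linarith⟩).trans (mul_le_mul_of_nonneg_left hu1 (by positivity))
  have h2 := (harc _ ⟨hn2, by linarith⟩).trans (mul_le_mul_of_nonneg_left hu2 (by positivity))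
  calc _ ≤ r ^ 2 * (Real.pi / 2 * (Real.pi / 2 * (l / η / r)) +
        Real.pi / 2 * (Real.pi / s * (l / η / r))) ^ 3 / 6 := by
        have a1 := Real.arcsin_nonneg.2 hn1
        have a2 := Real.arcsin_nonneg.2 hn2
        gcongr
    _ = _ := by ring

lemma IsDiscCorner.exists_chordMeasure_le_sharp {v : Plane} {φ₀ σ ω τ k : ℝ}
    (h : IsDiscCorner r P v φ₀ σ ω τ) (hP : IsDiscPolygon r P) (hr : 0 < r) (hk : 1 < k) :
    ∃ δ > 0, ∀ η ∈ Set.Ioc 0 δ, ∀ l ∈ Set.Icc 0 (δ * η),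
      chordMeasure r P (supportCentre r P (φ₀ - σ * η) - l • unitVec (φ₀ - σ * η)) ≤
        ENNReal.ofReal (k * (l ^ 3 / (6 * r * η ^ 3))) := by
  -- The arc has angle at most `k₁ ^ 3 * (l / η / r)`, and its cube enters.
  obtain ⟨k₁, hk₁, rfl⟩ := exists_pow_le hk (n := 9) (by norm_num)
  obtain ⟨s, hs, hsin⟩ := h.exists_le_sin
  obtain ⟨x₀, hx₀, hsmall⟩ := exists_small_angle hk₁
  have hω := h.lt_pi
  have hω0 := h.pos
  have hk0 : 0 < k₁ := by linarith
  have hsw : 0 < Real.sin (ω / 2) := Real.sin_pos_of_pos_of_lt_pi (by linarith) (by linarith)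
  obtain ⟨y, hy0, y1, y2⟩ : ∃ y > 0, y < Real.sin (ω / 2) ∧ y ≤ x₀ :=
    ⟨min (Real.sin (ω / 2) / 2) x₀, lt_min (by positivity) hx₀.1,
      (min_le_left _ _).trans_lt (by linarith), min_le_right _ _⟩
  obtain ⟨δ, hδ, d1, d2, d3, d4⟩ : ∃ δ > 0, δ ≤ ω / 2 ∧ δ ≤ x₀ ∧ δ ≤ (k₁ - 1) * s ∧
      k₁ * (δ / r) ≤ y := by
    -- The bound `δ ≤ (k₁ - 1) * s` makes the side of the other edge negligible, since it
    -- contributes order `l` against `l / η`.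
    have hk1 : 0 < k₁ - 1 := by linarith
    have hx := hx₀.1
    refine ⟨min (min (ω / 2) x₀) (min ((k₁ - 1) * s) (y * r / k₁)), by positivity,
      (min_le_left _ _).trans (min_le_left _ _), (min_le_left _ _).trans (min_le_right _ _),
      (min_le_right _ _).trans (min_le_left _ _), ?_⟩
    calc _ ≤ k₁ * (y * r / k₁ / r) := by
          gcongr; exact (min_le_right _ _).trans (min_le_right _ _)
      _ = y := by field_simp
  refine ⟨δ, hδ, fun η hη l hl => ?_⟩
  have hη0 := hη.1
  have hl0 := hl.1
  have hlη : l / η ≤ δ := (div_le_iff₀ hη0).2 hl.2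
  have hlη0 : 0 ≤ l / η := div_nonneg hl.1 hη0.le
  have hsη : η / k₁ ≤ Real.sin η := by
    rw [div_le_iff₀ hk0, mul_comm]
    exact (hsmall η ⟨hη0.le, hη.2.trans d2⟩).1
  have hs1 : 0 < Real.sin η := lt_of_lt_of_le (by positivity) hsη
  have hs2' := hsin η ⟨hη0.le, hη.2.trans d1⟩
  have hs2 : 0 < Real.sin (ω - η) := hs.trans_le hs2'
  have hu1 : l / (r * Real.sin η) ≤ k₁ * (l / η / r) := by
    calc _ ≤ l / (r * (η / k₁)) := by gcongr
      _ = _ := by field_simp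
  have hu2 : l / (r * Real.sin (ω - η)) ≤ (k₁ - 1) * (l / η / r) := by
    calc _ ≤ l / (r * s) := by gcongr
      _ = η / s * (l / η / r) := by field_simp
      _ ≤ _ := by
          gcongr
          rw [div_le_iff₀ hs]
          exact hη.2.trans d3
  have hlr : l / η / r ≤ δ / r := by gcongr
  have hX0 : 0 ≤ l / η / r := by positivity
  have hu1' : l / (r * Real.sin η) ≤ y :=
    (hu1.trans (mul_le_mul_of_nonneg_left hlr hk0.le)).trans d4
  have hu2' : l / (r * Real.sin (ω - η)) ≤ y := by
    refine (hu2.trans ?_).trans d4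
    exact mul_le_mul (by linarith) hlr hX0 hk0.le
  have hn1 : 0 ≤ l / (r * Real.sin η) := by positivity
  have hn2 : 0 ≤ l / (r * Real.sin (ω - η)) := by positivity
  refine (h.chordMeasure_le hP hr hη0 (by linarith [hη.2]) hl.1 (hu1'.trans_lt y1)
    (hu2'.trans_lt y1)).trans (ENNReal.ofReal_le_ofReal ?_)
  have h1 := (hsmall _ ⟨hn1, by linarith⟩).2.1.trans (mul_le_mul_of_nonneg_left hu1 hk0.le)
  have h2 := (hsmall _ ⟨hn2, by linarith⟩).2.1.trans (mul_le_mul_of_nonneg_left hu2 hk0.le)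
  have h3 : Real.arcsin (l / (r * Real.sin η)) + Real.arcsin (l / (r * Real.sin (ω - η))) ≤
      k₁ ^ 3 * (l / η / r) := by
    have : (k₁ * k₁ + k₁ * (k₁ - 1)) * (l / η / r) ≤ k₁ ^ 3 * (l / η / r) := by
      refine mul_le_mul_of_nonneg_right ?_ hX0
      nlinarith [mul_nonneg hk0.le (sq_nonneg (k₁ - 1))]
    linarith
  have a1 := Real.arcsin_nonneg.2 hn1
  have a2 := Real.arcsin_nonneg.2 hn2
  calc _ ≤ r ^ 2 * (k₁ ^ 3 * (l / η / r)) ^ 3 / 6 := by gcongr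
    _ = _ := by field_simp

lemma IsDiscCorner.exists_volume_cap_le {v : Plane} {φ₀ σ ω τ k : ℝ}
    (h : IsDiscCorner r P v φ₀ σ ω τ) (hP : IsDiscPolygon r P) (hr : 0 < r) (hk : 1 < k) :
    ∃ δ > 0, ∀ η ∈ Set.Ioc 0 δ, ∀ l, 0 ≤ l →
      volume (P \ Metric.closedBall
        (supportCentre r P (φ₀ - σ * η) - l • unitVec (φ₀ - σ * η)) r) ≤
        ENNReal.ofReal (k * (l ^ 2 / (2 * η))) := by
  obtain ⟨k₁, hk₁, rfl⟩ := exists_pow_le hk (n := 2) (by norm_num)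
  obtain ⟨s, hs, hsin⟩ := h.exists_le_sin
  obtain ⟨x₀, hx₀, hsmall⟩ := exists_small_angle hk₁
  have hω0 := h.pos
  have hk0 : 0 < k₁ := by linarith
  have hk1 : 0 < k₁ - 1 := by linarith
  have hx := hx₀.1
  refine ⟨min (min (ω / 2) x₀) (k₁ * (k₁ - 1) * s), by positivity, fun η hη l hl => ?_⟩
  have d1 := hη.2.trans ((min_le_left _ _).trans (min_le_left _ _))
  have d2 := hη.2.trans ((min_le_left _ _).trans (min_le_right _ _))
  have d3 := hη.2.trans (min_le_right _ _)
  have hη0 := hη.1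
  refine (h.volume_cap_le hP hr hη0 (by linarith) hl).trans (ENNReal.ofReal_le_ofReal ?_)
  have hsη : η / k₁ ≤ Real.sin η := by
    rw [div_le_iff₀ hk0, mul_comm]
    exact (hsmall η ⟨hη0.le, d2⟩).1
  have h1 : 1 / Real.sin η ≤ k₁ * (1 / η) := by
    calc _ ≤ 1 / (η / k₁) := by gcongr
      _ = _ := by field_simp
  have h2 : 1 / Real.sin (ω - η) ≤ k₁ * (k₁ - 1) * (1 / η) := by
    calc _ ≤ 1 / s := by gcongr; exact hsin η ⟨hη0.le, d1⟩
      _ ≤ _ := by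
        rw [mul_one_div, div_le_div_iff₀ hs hη0]; linarith
  calc _ ≤ (k₁ * (1 / η) + k₁ * (k₁ - 1) * (1 / η)) * (l ^ 2 / 2) := by gcongr
    _ = _ := by field_simp; ring

/-- Both bounds follow from `exists_arc_sharp`: the arc between the two points found there lies in
`P`; its projected length is integrated for the cap, and its chords are counted for `chordMeasure`.
-/
lemma IsDiscPolygon.exists_le_sharp (hP : IsDiscPolygon r P) (hr : 0 < r) {τ k : ℝ} (hτ : 0 < τ)
    (hk : 1 < k) : ∃ δ > 0, ∀ (v : Plane) (φ₀ σ η : ℝ), (σ = 1 ∨ σ = -1) →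
      supportPoint P (φ₀ - σ * η) = v → η ∈ Set.Ioc 0 δ →
      (∀ s ∈ Set.Icc 0 τ, v - r • unitVec φ₀ + r • unitVec (φ₀ + σ * s) ∈ P) →
      ∀ l ∈ Set.Icc 0 (δ * η),
        ENNReal.ofReal (l ^ 2 / (2 * η) / k) ≤ volume (P \ Metric.closedBall
          (supportCentre r P (φ₀ - σ * η) - l • unitVec (φ₀ - σ * η)) r) ∧
        ENNReal.ofReal (l ^ 3 / (6 * r * η ^ 3) / k) ≤
          chordMeasure r P (supportCentre r P (φ₀ - σ * η) - l • unitVec (φ₀ - σ * η)) := by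
  obtain ⟨k₁, hk₁, rfl⟩ := exists_pow_le hk (n := 5) (by norm_num)
  obtain ⟨δ₁, hδ₁, hsharp⟩ := exists_arc_sharp hP hr hτ hk₁
  obtain ⟨x₀, hx₀, hsmall⟩ := exists_small_angle hk₁
  have hk0 : 0 < k₁ := by linarith
  have hx := hx₀.1
  have hm := hP.isCompact.measurableSet
  refine ⟨min δ₁ (r * x₀), by positivity, ?_⟩
  intro v φ₀ σ η hσ hv hη hE l hl
  have hη0 := hη.1
  have hl1 : l ≤ δ₁ * η := hl.2.trans (by gcongr; exact min_le_left _ _)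
  have hl2 : l ≤ r * x₀ * η := hl.2.trans (by gcongr; exact min_le_right _ _)
  have hsh := hsharp v φ₀ σ η hσ hv ⟨hη0, hη.2.trans (min_le_left _ _)⟩ hE
  set φ := φ₀ - σ * η
  constructor
  · rw [volume_cap hm (hP.subset_closedBall hr _) _ hl.1]
    have e : ENNReal.ofReal (l ^ 2 / (2 * η) / k₁ ^ 5) ≤
        ∫⁻ x in Set.Ico 0 l, ENNReal.ofReal (x / (η * k₁)) := by
      rw [setLIntegral_congr Ico_ae_eq_Ioc,
        setLIntegral_ofReal_eq_sub (F := fun x => x ^ 2 / 2 / (η * k₁)) hl.1]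
      · apply ENNReal.ofReal_le_ofReal
        have : k₁ ≤ k₁ ^ 5 := le_self_pow₀ hk₁.le (by norm_num)
        simp only [ne_eq, OfNat.ofNat_ne_zero, not_false_eq_true, zero_pow, zero_div, sub_zero]
        rw [div_div, div_div, ← mul_assoc]
        gcongr
      · intro x _
        refine (((hasDerivAt_id x).pow 2).div_const 2 |>.div_const (η * k₁)).congr_deriv ?_
        simp
      · fun_prop
      · exact fun x hx => div_nonneg hx.1 (by positivity)
    refine e.trans (setLIntegral_mono' measurableSet_Ico fun x hx => ?_)
    rcases eq_or_lt_of_le hx.1 with h | h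
    · simp [← h]
    obtain ⟨a, ha, b, hb, hac, hbc, hab⟩ := hsh x ⟨h, hx.2.le.trans hl1⟩
    refine le_trans (ENNReal.ofReal_le_ofReal ?_) (le_halfCircleLength hP hr ha hb hac hbc)
    calc x / (η * k₁) = r * (x / (r * η) / k₁) := by field_simp
      _ ≤ _ := mul_le_mul_of_nonneg_left hab hr.le
  · rcases eq_or_lt_of_le hl.1 with h | h
    · simp [← h]
    obtain ⟨a, ha, b, hb, hac, hbc, hab⟩ := hsh l ⟨h, hl1⟩
    set w := l / (r * η) / k₁ with hw
    have hw0 : 0 < w := by positivity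
    have hwx : w ≤ x₀ := by
      refine (div_le_self (by positivity) hk₁.le).trans ?_
      rw [div_le_iff₀ (by positivity)]
      linarith
    have hlt : a < b := by
      by_contra hcon
      have := Real.strictMonoOn_sin.monotoneOn ⟨hb.1.le, hb.2.le⟩ ⟨ha.1.le, ha.2.le⟩ (not_lt.1 hcon)
      linarith
    have hwab : w ≤ b - a := by
      refine hab.trans ?_
      have h1 := Real.sin_sub_sin b a
      have h2 : Real.sin ((b - a) / 2) ≤ (b - a) / 2 := Real.sin_le (by linarith)
      have h3 := Real.cos_le_one ((b + a) / 2)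
      have h4 : 0 ≤ Real.sin ((b - a) / 2) :=
        Real.sin_nonneg_of_nonneg_of_le_pi (by linarith) (by linarith [ha.1, hb.2])
      nlinarith
    have hk2 : x₀ ≤ 2 * k₁ * x₀ := by nlinarith
    refine le_trans (ENNReal.ofReal_le_ofReal ?_) (le_chordMeasure hr hm _ (φ + a) (w := w) (k := k₁)
      (x₀ := x₀) hk₁.le hx₀.2 (fun x hx => (hsmall x hx).2.1) hw0 (hwx.trans hk2)
      (by linarith [Real.pi_gt_three, hx₀.2]) fun t ht => ?_)
    · rw [hw]; apply le_of_eq; field_simp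
    · rw [show φ + a + t = φ + (a + t) by ring]
      exact hP.arc_mem hr (a := φ + a) (b := φ + b) (by linarith [ht.1]) (by linarith [ht.2])
        (by linarith [ha.1, hb.2]) hac hbc

lemma exists_chordMeasure_le_const (r : ℝ) (P : Set Plane) :
    ∃ C ≥ 0, ∀ c, chordMeasure r P c ≤ ENNReal.ofReal C := by
  refine ⟨(volume (Metric.ball (0 : Plane) (2 * r))).toReal, ENNReal.toReal_nonneg, fun c => ?_⟩
  rw [ENNReal.ofReal_toReal measure_ball_lt_top.ne]
  exact measure_mono fun w hw => by simpa using hw.1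

end Geometry

/-! ### The logarithmic integral -/

section Integrals

lemma setLIntegral_cube_mul_exp {b L : ℝ} (hb : 0 < b) (hL : 0 ≤ L) :
    ∫⁻ l in Set.Ioc 0 L, ENNReal.ofReal (l ^ 3 * Real.exp (-(b * l ^ 2))) =
      ENNReal.ofReal (1 / (2 * b ^ 2) * (1 - (1 + b * L ^ 2) * Real.exp (-(b * L ^ 2)))) := by
  rw [setLIntegral_ofReal_eq_sub
    (F := fun l => -(1 / (2 * b ^ 2)) * ((1 + b * l ^ 2) * Real.exp (-(b * l ^ 2)))) hL]
  · congr 1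
    simp
    ring
  · intro x _
    have h1 : HasDerivAt (fun l : ℝ => b * l ^ 2) (b * (2 * x)) x := by
      simpa using ((hasDerivAt_id x).pow 2).const_mul b
    refine (((h1.const_add 1).mul h1.neg.exp).const_mul _).congr_deriv ?_
    simp only [Pi.neg_apply]
    field_simp
    ring
  · fun_prop
  · exact fun x hx => mul_nonneg (pow_nonneg hx.1 3) (Real.exp_pos _).le

lemma setLIntegral_cube_mul_exp_le {b L : ℝ} (hb : 0 < b) (hL : 0 ≤ L) :
    ∫⁻ l in Set.Ioc 0 L, ENNReal.ofReal (l ^ 3 * Real.exp (-(b * l ^ 2))) ≤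
      ENNReal.ofReal (1 / (2 * b ^ 2)) := by
  rw [setLIntegral_cube_mul_exp hb hL]
  refine ENNReal.ofReal_le_ofReal (mul_le_of_le_one_right (by positivity) ?_)
  have : 0 ≤ (1 + b * L ^ 2) * Real.exp (-(b * L ^ 2)) := by positivity
  linarith

lemma setLIntegral_exp_le {b L : ℝ} (hb : 0 < b) (hL : 0 ≤ L) :
    ∫⁻ l in Set.Ioc 0 L, ENNReal.ofReal (Real.exp (-(b * l))) ≤ ENNReal.ofReal (1 / b) := by
  rw [setLIntegral_ofReal_eq_sub (F := fun l => -(1 / b) * Real.exp (-(b * l))) hL]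
  · apply ENNReal.ofReal_le_ofReal
    have : 0 ≤ 1 / b * Real.exp (-(b * L)) := by positivity
    simp only [mul_zero, neg_zero, Real.exp_zero, mul_one]
    linarith
  · intro x _
    have h1 : HasDerivAt (fun l : ℝ => b * l) b x := by
      simpa using (hasDerivAt_id x).const_mul b
    refine (h1.neg.exp.const_mul _).congr_deriv ?_
    simp only [Pi.neg_apply]
    field_simp
  · fun_prop
  · exact fun x _ => (Real.exp_pos _).le

lemma setLIntegral_one_div {a b : ℝ} (ha : 0 < a) (hab : a ≤ b) :
    ∫⁻ x in Set.Ioc a b, ENNReal.ofReal (1 / x) = ENNReal.ofReal (Real.log (b / a)) := by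
  rw [setLIntegral_ofReal_eq_sub (F := Real.log) hab, Real.log_div (by linarith) ha.ne']
  · intro x hx
    rw [one_div]
    exact Real.hasDerivAt_log (by linarith [hx.1])
  · exact continuousOn_const.div continuousOn_id fun x hx => (ha.trans_le hx.1).ne'
  · exact fun x hx => one_div_nonneg.2 (ha.le.trans hx.1)

lemma setLIntegral_le_of_le_add {g m : ℝ → ENNReal} {c₂ b₂ c₃ b₃ L : ℝ} (hm : Measurable m)
    (hc₂ : 0 ≤ c₂) (hb₂ : 0 < b₂) (hc₃ : 0 ≤ c₃) (hb₃ : 0 < b₃) (hL : 0 ≤ L)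
    (h : ∀ l ∈ Set.Ioc 0 L, g l ≤ m l + ENNReal.ofReal (c₂ * Real.exp (-(b₂ * l))) +
      ENNReal.ofReal (c₃ * (l ^ 3 * Real.exp (-(b₃ * l ^ 2))))) :
    ∫⁻ l in Set.Ioc 0 L, g l ≤ (∫⁻ l in Set.Ioc 0 L, m l) + ENNReal.ofReal (c₂ * (1 / b₂)) +
      ENNReal.ofReal (c₃ * (1 / (2 * b₃ ^ 2))) := by
  refine (setLIntegral_mono' measurableSet_Ioc h).trans ?_
  rw [lintegral_add_right _ (by fun_prop), lintegral_add_left hm]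
  gcongr
  · simp_rw [ENNReal.ofReal_mul hc₂]
    rw [lintegral_const_mul _ (by fun_prop)]
    gcongr
    exact setLIntegral_exp_le hb₂ hL
  · simp_rw [ENNReal.ofReal_mul hc₃]
    rw [lintegral_const_mul _ (by fun_prop)]
    gcongr
    exact setLIntegral_cube_mul_exp_le hb₃ hL

/-- The main region is `l ≤ δ * η` with `1 / a < η ≤ δ`. There the inner integral is at most `p / (2
* q ^ 2) / (a ^ 2 * η)`, whose integral over `η` is the logarithm. For `η ≤ 1 / a` the integrand is
bounded on a region of area of order `a⁻²`; for `l ≥ δ * η` exponential decay in `l` also gives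
decay in `η`; for `η > δ` nothing is singular. These parts add up to `C' / a ^ 2`. -/
lemma corner_integral_le {p q δ C κ w L : ℝ} (hp : 0 < p) (hq : 0 < q) (hδ : 0 < δ) (hC : 0 ≤ C)
    (hκ : 0 < κ) (hw : 0 ≤ w) (hL : 0 ≤ L) : ∃ C' ≥ 0, ∀ a ≥ 1, ∀ g : ℝ → ℝ → ENNReal,
    (∀ η ∈ Set.Ioc 0 δ, ∀ l ∈ Set.Ioc 0 (δ * η),
      g η l ≤ ENNReal.ofReal (p * l ^ 3 / η ^ 3 * Real.exp (-(q * a / η * l ^ 2)))) →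
    (∀ η ∈ Set.Ioc 0 w, ∀ l ∈ Set.Ioc 0 L, δ * η ≤ l →
      g η l ≤ ENNReal.ofReal (C * Real.exp (-(a * κ * l)))) →
    (∀ η ∈ Set.Ioc δ w, ∀ l ∈ Set.Ioc 0 L, l ≤ δ * η →
      g η l ≤ ENNReal.ofReal (C * (l ^ 3 * Real.exp (-(a * κ * l ^ 2))))) →
    ∫⁻ η in Set.Ioc 0 w, ∫⁻ l in Set.Ioc 0 L, g η l ≤
      ENNReal.ofReal (1 / a ^ 2 * (p / (2 * q ^ 2) * Real.log a + C')) := by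
  refine ⟨p / (2 * q ^ 2) * |Real.log δ| + (p * δ ^ 4 + C * (2 / κ) * (2 / (κ * δ)) +
    C * (1 / (2 * κ ^ 2)) * w), by positivity, fun a ha g h1 h2 h3 => ?_⟩
  have ha0 : 0 < a := by linarith
  have hb₂ : 0 < a * κ / 2 := by positivity
  have hb₃ : 0 < a * κ := by positivity
  -- the bound away from the main region
  have hrest : ∀ η ∈ Set.Ioc 0 w, ∀ l ∈ Set.Ioc 0 L, δ * η ≤ l → g η l ≤
      ENNReal.ofReal (C * Real.exp (-(a * κ * δ / 2 * η)) * Real.exp (-(a * κ / 2 * l))) := by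
    intro η hη l hl hlη
    refine (h2 η hη l hl hlη).trans (ENNReal.ofReal_le_ofReal ?_)
    rw [mul_assoc C, ← Real.exp_add]
    refine mul_le_mul_of_nonneg_left (Real.exp_le_exp.2 ?_) hC
    have := mul_le_mul_of_nonneg_left hlη hb₂.le
    linarith
  have hmaster : ∀ η ∈ Set.Ioc 0 w, ∀ m : ℝ → ENNReal, Measurable m →
      (η ≤ δ → ∀ l ∈ Set.Ioc 0 (δ * η), g η l ≤ m l) → ∫⁻ l in Set.Ioc 0 L, g η l ≤
      (∫⁻ l in Set.Ioc 0 L, m l) + ENNReal.ofReal (C * Real.exp (-(a * κ * δ / 2 * η)) *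
        (1 / (a * κ / 2))) + ENNReal.ofReal (C * (1 / (2 * (a * κ) ^ 2))) := by
    intro η hη m hm hgm
    refine setLIntegral_le_of_le_add hm (by positivity) hb₂ hC hb₃ hL fun l hl => ?_
    rcases le_total (δ * η) l with hle | hle
    · exact (hrest η hη l hl hle).trans (le_add_right (le_add_left le_rfl))
    · rcases le_or_gt η δ with hηδ | hηδ
      · exact (hgm hηδ l ⟨hl.1, hle⟩).trans (le_add_right (le_add_right le_rfl))
      · exact (h3 η ⟨hηδ, hη.2⟩ l hl hle).trans (le_add_left le_rfl)
  have hinner : ∀ η ∈ Set.Ioc 0 w, ∫⁻ l in Set.Ioc 0 L, g η l ≤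
      (Set.Ioc (1 / a) δ).indicator (fun η => ENNReal.ofReal (p / (2 * q ^ 2) / a ^ 2) *
        ENNReal.ofReal (1 / η)) η + (Set.Ioc 0 (1 / a)).indicator
        (fun _ => ENNReal.ofReal (p * δ ^ 4 / a)) η +
      ENNReal.ofReal (C * (1 / (a * κ / 2))) * ENNReal.ofReal (Real.exp (-(a * κ * δ / 2 * η))) +
      ENNReal.ofReal (C * (1 / (2 * (a * κ) ^ 2))) := by
    intro η hη
    have hη0 := hη.1
    have e : ENNReal.ofReal (C * Real.exp (-(a * κ * δ / 2 * η)) * (1 / (a * κ / 2))) =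
        ENNReal.ofReal (C * (1 / (a * κ / 2))) * ENNReal.ofReal (Real.exp (-(a * κ * δ / 2 * η))) := by
      rw [← ENNReal.ofReal_mul (by positivity)]; congr 1; ring
    rw [← e]
    rcases le_or_gt η (1 / a) with ha1 | ha1
    · refine (hmaster η hη ((Set.Ioc 0 (δ * η)).indicator fun _ => ENNReal.ofReal (p * δ ^ 3))
        (measurable_const.indicator measurableSet_Ioc) fun hηδ l hl => ?_).trans ?_
      · rw [Set.indicator_of_mem hl]
        refine (h1 η ⟨hη0, hηδ⟩ l hl).trans (ENNReal.ofReal_le_ofReal ?_)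
        have e1 : Real.exp (-(q * a / η * l ^ 2)) ≤ 1 := Real.exp_le_one_iff.2 (by
          have : 0 ≤ q * a / η * l ^ 2 := by positivity
          linarith)
        have e2 : p * l ^ 3 / η ^ 3 ≤ p * δ ^ 3 := by
          rw [div_le_iff₀ (by positivity), mul_assoc, ← mul_pow]
          have := hl.1.le
          have := hl.2
          gcongr
        have e3 : 0 ≤ p * l ^ 3 / η ^ 3 := by have := hl.1; positivity
        exact (mul_le_of_le_one_right e3 e1).trans e2
      · gcongr
        rw [Set.indicator_of_notMem (fun h => absurd h.1 (not_lt.2 ha1)), Set.indicator_of_mem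
          (show η ∈ Set.Ioc 0 (1 / a) from ⟨hη0, ha1⟩), zero_add,
          lintegral_indicator measurableSet_Ioc]
        refine (lintegral_mono' (Measure.restrict_mono_measure Measure.restrict_le_self _)
          le_rfl).trans ?_
        rw [setLIntegral_const, Real.volume_Ioc, ← ENNReal.ofReal_mul (by positivity)]
        refine ENNReal.ofReal_le_ofReal ?_
        calc p * δ ^ 3 * (δ * η - 0) = p * δ ^ 4 * η := by ring
          _ ≤ p * δ ^ 4 * (1 / a) := by gcongr
          _ = _ := by ring
    rcases le_or_gt η δ with hηδ | hηδ
    · refine (hmaster η hη (fun l => ENNReal.ofReal (p / η ^ 3) *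
        ENNReal.ofReal (l ^ 3 * Real.exp (-(q * a / η * l ^ 2))))
        (by fun_prop) fun _ l hl => ?_).trans ?_
      · refine (h1 η ⟨hη0, hηδ⟩ l hl).trans (le_of_eq ?_)
        rw [← ENNReal.ofReal_mul (by positivity)]
        congr 1; ring
      · gcongr
        rw [Set.indicator_of_mem (show η ∈ Set.Ioc (1 / a) δ from ⟨ha1, hηδ⟩)]
        refine le_add_right ?_
        rw [lintegral_const_mul _ (by fun_prop)]
        refine (mul_le_mul_right (setLIntegral_cube_mul_exp_le (by positivity) hL) _).trans ?_
        rw [← ENNReal.ofReal_mul (by positivity), ← ENNReal.ofReal_mul (by positivity)]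
        refine ENNReal.ofReal_le_ofReal (le_of_eq ?_)
        field_simp
    · refine (hmaster η hη 0 measurable_zero fun h => absurd h (not_le.2 hηδ)).trans ?_
      gcongr
      simp
  refine (setLIntegral_mono' measurableSet_Ioc hinner).trans ?_
  have hm1 : Measurable ((Set.Ioc (1 / a) δ).indicator fun η =>
    ENNReal.ofReal (p / (2 * q ^ 2) / a ^ 2) * ENNReal.ofReal (1 / η)) :=
    Measurable.indicator (by fun_prop) measurableSet_Ioc
  have hm2 : Measurable ((Set.Ioc 0 (1 / a)).indicator fun _ : ℝ => ENNReal.ofReal (p * δ ^ 4 / a)) :=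
    measurable_const.indicator measurableSet_Ioc
  rw [lintegral_add_right _ measurable_const, lintegral_add_right _ (by fun_prop),
    lintegral_add_left hm1, lintegral_const_mul _ (by fun_prop), setLIntegral_const, Real.volume_Ioc]
  have b1 : ∫⁻ η in Set.Ioc 0 w, (Set.Ioc (1 / a) δ).indicator (fun η =>
      ENNReal.ofReal (p / (2 * q ^ 2) / a ^ 2) * ENNReal.ofReal (1 / η)) η ≤
      ENNReal.ofReal (p / (2 * q ^ 2) / a ^ 2 * (Real.log a + |Real.log δ|)) := by
    rw [lintegral_indicator measurableSet_Ioc]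
    refine (lintegral_mono' (Measure.restrict_mono_measure Measure.restrict_le_self _)
      le_rfl).trans ?_
    rw [lintegral_const_mul _ (by fun_prop), ENNReal.ofReal_mul (by positivity)]
    gcongr
    rcases le_or_gt (1 / a) δ with h | h
    · rw [setLIntegral_one_div (by positivity) h]
      refine ENNReal.ofReal_le_ofReal ?_
      rw [div_div_eq_mul_div, div_one, Real.log_mul hδ.ne' ha0.ne']
      linarith [le_abs_self (Real.log δ)]
    · rw [Set.Ioc_eq_empty (not_lt.2 h.le)]
      simp
  have b2 : ∫⁻ η in Set.Ioc 0 w, (Set.Ioc 0 (1 / a)).indicator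
      (fun _ => ENNReal.ofReal (p * δ ^ 4 / a)) η ≤ ENNReal.ofReal (p * δ ^ 4 / a ^ 2) := by
    rw [lintegral_indicator measurableSet_Ioc]
    refine (lintegral_mono' (Measure.restrict_mono_measure Measure.restrict_le_self _)
      le_rfl).trans ?_
    rw [setLIntegral_const, Real.volume_Ioc, ← ENNReal.ofReal_mul (by positivity)]
    refine ENNReal.ofReal_le_ofReal (le_of_eq ?_)
    field_simp; ring
  refine (add_le_add (add_le_add (add_le_add b1 b2) (mul_le_mul_right
    (setLIntegral_exp_le (b := a * κ * δ / 2) (by positivity) hw) _)) le_rfl).trans ?_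
  rw [← ENNReal.ofReal_mul (by positivity), ← ENNReal.ofReal_mul (by positivity),
    ← ENNReal.ofReal_add (by have := Real.log_nonneg ha; positivity) (by positivity),
    ← ENNReal.ofReal_add (by have := Real.log_nonneg ha; positivity) (by positivity),
    ← ENNReal.ofReal_add (by have := Real.log_nonneg ha; positivity) (by simp; positivity)]
  refine ENNReal.ofReal_le_ofReal (le_of_eq ?_)
  field_simp
  ring

lemma exists_one_add_mul_exp_neg_le {k : ℝ} (hk : 1 < k) :
    ∃ K > 0, ∀ X ≥ K, 1 / k ≤ 1 - (1 + X) * Real.exp (-X) := by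
  have hk' : 0 < 1 - 1 / k := by rw [sub_pos, div_lt_one (by linarith)]; exact hk
  refine ⟨2 / (1 - 1 / k), by positivity, fun X hX => ?_⟩
  have hX0 : 0 < X := lt_of_lt_of_le (by positivity) hX
  have h1 := Real.quadratic_le_exp_of_nonneg hX0.le
  have h2 : (1 + X) * Real.exp (-X) ≤ 2 / X := by
    rw [Real.exp_neg, ← div_eq_mul_inv, div_le_div_iff₀ (Real.exp_pos _) hX0]
    nlinarith
  have h3 : 2 / X ≤ 1 - 1 / k := by
    rw [div_le_iff₀ hX0]
    rw [ge_iff_le, div_le_iff₀ hk'] at hX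
    linarith
  linarith

/-- For `η > K' / a` the exponent at `l = δ * η` is at least `K`, so cutting the inner integral
there loses only the factor `k`. -/
lemma le_corner_integral {p q δ k : ℝ} (hp : 0 < p) (hq : 0 < q) (hδ : 0 < δ) (hk : 1 < k) :
    ∃ C' : ℝ, ∀ a > 0, ∀ g : ℝ → ℝ → ENNReal,
    (∀ η ∈ Set.Ioc 0 δ, ∀ l ∈ Set.Ioc 0 (δ * η),
      ENNReal.ofReal (p * l ^ 3 / η ^ 3 * Real.exp (-(q * a / η * l ^ 2))) ≤ g η l) →
    ENNReal.ofReal (1 / a ^ 2 * (p / (2 * q ^ 2) / k * (Real.log a + C'))) ≤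
      ∫⁻ η in Set.Ioc 0 δ, ∫⁻ l in Set.Ioc 0 (δ * η), g η l := by
  obtain ⟨K, hK, hexp⟩ := exists_one_add_mul_exp_neg_le hk
  have hk0 : 0 < k := by linarith
  obtain ⟨K', hK', hKe⟩ : ∃ K' > 0, q * K' * δ ^ 2 = K := ⟨K / (q * δ ^ 2), by positivity, by field_simp⟩
  refine ⟨Real.log (δ / K'), fun a ha g h => ?_⟩
  rcases le_or_gt (K' / a) δ with hle | hgt
  swap
  -- For small `a` the claimed bound is nonpositive.
  · rw [← Real.log_mul ha.ne' (by positivity), ENNReal.ofReal_of_nonpos]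
    · exact zero_le
    · have : Real.log (a * (δ / K')) ≤ 0 := by
        refine Real.log_nonpos (by positivity) ?_
        rw [← mul_div_assoc, div_le_one hK']
        rw [lt_div_iff₀ ha] at hgt
        linarith
      exact mul_nonpos_of_nonneg_of_nonpos (by positivity)
        (mul_nonpos_of_nonneg_of_nonpos (by positivity) this)
  have hinner : ∀ η ∈ Set.Ioc (K' / a) δ, ENNReal.ofReal (p / (2 * q ^ 2) / k / a ^ 2) *
      ENNReal.ofReal (1 / η) ≤ ∫⁻ l in Set.Ioc 0 (δ * η), g η l := by
    intro η hη
    have hη0 : 0 < η := lt_trans (by positivity) hη.1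
    refine le_trans ?_ (setLIntegral_mono' measurableSet_Ioc (h η ⟨hη0, hη.2⟩))
    have e : ∀ l, ENNReal.ofReal (p * l ^ 3 / η ^ 3 * Real.exp (-(q * a / η * l ^ 2))) =
        ENNReal.ofReal (p / η ^ 3) * ENNReal.ofReal (l ^ 3 * Real.exp (-(q * a / η * l ^ 2))) := by
      intro l
      rw [← ENNReal.ofReal_mul (by positivity)]
      congr 1; ring
    simp_rw [e]
    rw [lintegral_const_mul _ (by fun_prop), setLIntegral_cube_mul_exp (by positivity) (by positivity),
      ← ENNReal.ofReal_mul (by positivity), ← ENNReal.ofReal_mul (by positivity)]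
    refine ENNReal.ofReal_le_ofReal ?_
    have hX : K ≤ q * a / η * (δ * η) ^ 2 := by
      rw [← hKe, show q * a / η * (δ * η) ^ 2 = q * (a * η) * δ ^ 2 by field_simp]
      have := (div_lt_iff₀ ha).1 hη.1
      gcongr
      linarith
    calc _ = p / η ^ 3 * (1 / (2 * (q * a / η) ^ 2) * (1 / k)) := by field_simp
      _ ≤ _ := by gcongr; exact hexp _ hX
  refine le_trans ?_ (lintegral_mono_set (Set.Ioc_subset_Ioc_left (by positivity : 0 ≤ K' / a)))
  refine le_trans ?_ (setLIntegral_mono' measurableSet_Ioc hinner)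
  rw [lintegral_const_mul _ (by fun_prop), setLIntegral_one_div (by positivity) hle,
    ← ENNReal.ofReal_mul (by positivity), div_div_eq_mul_div, mul_div_right_comm,
    Real.log_mul (by positivity) ha.ne']
  refine ENNReal.ofReal_le_ofReal (le_of_eq ?_)
  field_simp
  ring

end Integrals

/-! ### The probability that a disc covers the sample -/

section Probability

variable {r : ℝ} {P : Set Plane}

lemma IsDiscPolygon.volume_ne_top (hP : IsDiscPolygon r P) : volume P ≠ ⊤ :=
  hP.isCompact.measure_lt_top.ne

lemma IsDiscPolygon.volume_ne_zero (hP : IsDiscPolygon r P) : volume P ≠ 0 :=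
  (Measure.measure_pos_of_nonempty_interior _ hP.interior_nonempty).ne'

lemma IsDiscPolygon.area_pos (hP : IsDiscPolygon r P) : 0 < area P :=
  ENNReal.toReal_pos hP.volume_ne_zero hP.volume_ne_top

lemma IsDiscPolygon.isProbabilityMeasure_cond (hP : IsDiscPolygon r P) :
    IsProbabilityMeasure (ProbabilityTheory.cond volume P) :=
  ProbabilityTheory.cond_isProbabilityMeasure_of_finite hP.volume_ne_zero hP.volume_ne_top

lemma IsDiscPolygon.cond_eq (hP : IsDiscPolygon r P) {D : Set Plane} (hD : MeasurableSet D) :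
    ProbabilityTheory.cond volume P D =
      ENNReal.ofReal (1 - (volume (P \ D)).toReal / area P) := by
  have := hP.isProbabilityMeasure_cond
  have hle : volume (P \ D) ≤ volume P := measure_mono Set.sdiff_subset
  rw [← compl_compl D, prob_compl_eq_one_sub hD.compl, compl_compl,
    ProbabilityTheory.cond_apply hP.isCompact.measurableSet, ← Set.sdiff_eq,
    ENNReal.ofReal_sub _ (by unfold area; positivity), ENNReal.ofReal_one, area,
    ENNReal.ofReal_div_of_pos (ENNReal.toReal_pos hP.volume_ne_zero hP.volume_ne_top),
    ENNReal.ofReal_toReal hP.volume_ne_top, ENNReal.ofReal_toReal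
      (hle.trans_lt hP.isCompact.measure_lt_top).ne, ENNReal.div_eq_inv_mul]

lemma IsDiscPolygon.cond_pow_le (hP : IsDiscPolygon r P) {D : Set Plane} (hD : MeasurableSet D)
    (N : ℕ) {x : ℝ} (hx : ENNReal.ofReal x ≤ volume (P \ D)) :
    ProbabilityTheory.cond volume P D ^ N ≤ ENNReal.ofReal (Real.exp (-(N / area P * x))) := by
  have hA := hP.area_pos
  have hfin : volume (P \ D) ≠ ⊤ :=
    ((measure_mono Set.sdiff_subset).trans_lt hP.isCompact.measure_lt_top).ne
  have hx' : x ≤ (volume (P \ D)).toReal := (ENNReal.ofReal_le_iff_le_toReal hfin).1 hx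
  rw [hP.cond_eq hD, show -(N / area P * x) = N * (-(x / area P)) by ring, Real.exp_nat_mul,
    ENNReal.ofReal_pow (Real.exp_pos _).le]
  gcongr
  have h1 := Real.add_one_le_exp (-(x / area P))
  have h2 : x / area P ≤ (volume (P \ D)).toReal / area P := by gcongr
  linarith

/-- The lower counterpart of `1 - x ≤ exp (-x)` holds for small `x` with a factor `k > 1` in the
exponent, which is where `hk` comes from. -/
lemma IsDiscPolygon.le_cond_pow (hP : IsDiscPolygon r P) {D : Set Plane} (hD : MeasurableSet D)
    (N : ℕ) {x k : ℝ} (hx0 : 0 ≤ x) (hx : volume (P \ D) ≤ ENNReal.ofReal x)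
    (hk : Real.exp (-(k * (x / area P))) ≤ 1 - x / area P) :
    ENNReal.ofReal (Real.exp (-(k * (N / area P * x)))) ≤ ProbabilityTheory.cond volume P D ^ N := by
  have hA := hP.area_pos
  have hx' : (volume (P \ D)).toReal ≤ x := ENNReal.toReal_le_of_le_ofReal hx0 hx
  rw [hP.cond_eq hD, show -(k * (N / area P * x)) = N * (-(k * (x / area P))) by ring,
    Real.exp_nat_mul, ENNReal.ofReal_pow (Real.exp_pos _).le]
  gcongr
  have h2 : (volume (P \ D)).toReal / area P ≤ x / area P := by gcongr
  linarith

lemma exists_exp_neg_le_one_sub {k : ℝ} (hk : 1 < k) :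
    ∃ x₀ > 0, ∀ x ∈ Set.Icc 0 x₀, Real.exp (-(k * x)) ≤ 1 - x := by
  have hk0 : 0 < k := by linarith
  refine ⟨(k - 1) / k, div_pos (by linarith) hk0, fun x hx => ?_⟩
  have h1 := Real.add_one_le_exp (k * x)
  have h0 := hx.1
  rw [Real.exp_neg, inv_le_comm₀ (Real.exp_pos _)]
  · refine le_trans ?_ h1
    have h2 := hx.2
    rw [le_div_iff₀ hk0] at h2
    have : 0 < 1 - x := by
      nlinarith
    rw [inv_le_iff_one_le_mul₀ this]
    nlinarith
  · have h2 := hx.2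
    rw [le_div_iff₀ hk0] at h2
    nlinarith

/-- The density of the centre of the disc of radius `r` through two random points of `P`, weighted
by the probability that the disc covers `N` more random points. -/
def edgeDensity (r : ℝ) (P : Set Plane) (N : ℕ) (c : Plane) : ENNReal :=
  ProbabilityTheory.cond volume P (Metric.closedBall c r) ^ N * chordMeasure r P c

lemma IsDiscPolygon.measurable_edgeDensity (hP : IsDiscPolygon r P) (N : ℕ) :
    Measurable (edgeDensity r P N) := by
  have := hP.isProbabilityMeasure_cond
  exact ((measurable_measure_closedBall _ r).pow_const N).mul
    (measurable_chordMeasure hP.isCompact.measurableSet)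

end Probability

/-! ### Polar coordinates for the centres at a vertex -/

section Sector

variable {r : ℝ}

/-- A sector of an annulus, in polar coordinates around `v`. -/
def sector (r : ℝ) (v : Plane) (φ₀ σ : ℝ) (I J : Set ℝ) : Set Plane :=
  (fun p : ℝ × ℝ => v - (r + p.2) • unitVec (φ₀ - σ * p.1)) '' (I ×ˢ J)

lemma sector_injOn {v : Plane} {φ₀ σ : ℝ} (hσ : σ = 1 ∨ σ = -1) (hr : 0 < r) {I J : Set ℝ}
    (hI : I ⊆ Set.Ico 0 Real.pi) (hJ : J ⊆ Set.Ici 0) :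
    Set.InjOn (fun p : ℝ × ℝ => v - (r + p.2) • unitVec (φ₀ - σ * p.1)) (I ×ˢ J) := by
  rintro ⟨η, l⟩ ⟨hη, hl⟩ ⟨η', l'⟩ ⟨hη', hl'⟩ h
  have h1 : (r + l) • unitVec (φ₀ - σ * η) = (r + l') • unitVec (φ₀ - σ * η') := sub_right_inj.1 h
  have hl0 : 0 ≤ l := hJ hl
  have hl0' : 0 ≤ l' := hJ hl'
  have h2 := congrArg norm h1
  rw [norm_smul, norm_smul, norm_unitVec, norm_unitVec, Real.norm_of_nonneg (by positivity),
    Real.norm_of_nonneg (by positivity)] at h2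
  have hll : l = l' := by linarith
  subst hll
  have h3 := smul_right_injective Plane (by positivity : r + l ≠ 0) h1
  obtain ⟨k, hk⟩ := exists_int_of_unitVec_eq h3
  have a1 := hI hη
  have a2 := hI hη'
  have hk0 : k = 0 := by
    by_contra hk0
    have hpi := Real.pi_pos
    rcases lt_or_gt_of_ne hk0 with h | h
    · have : (k : ℝ) ≤ -1 := by exact_mod_cast (by omega : k ≤ -1)
      rcases hσ with rfl | rfl <;> nlinarith [a1.1, a1.2, a2.1, a2.2]
    · have : (1 : ℝ) ≤ k := by exact_mod_cast (by omega : 1 ≤ k)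
      rcases hσ with rfl | rfl <;> nlinarith [a1.1, a1.2, a2.1, a2.2]
  rw [hk0] at hk
  have : η = η' := by rcases hσ with rfl | rfl <;> simp at hk <;> linarith
  rw [this]

lemma measurableSet_sector {v : Plane} {φ₀ σ : ℝ} (hσ : σ = 1 ∨ σ = -1) (hr : 0 < r) {I J : Set ℝ}
    (hI : I ⊆ Set.Ico 0 Real.pi) (hJ : J ⊆ Set.Ici 0) (hIm : MeasurableSet I)
    (hJm : MeasurableSet J) : MeasurableSet (sector r v φ₀ σ I J) :=
  (hIm.prod hJm).image_of_continuousOn_injOn (by fun_prop) (sector_injOn hσ hr hI hJ)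

/-- Polar coordinates around `v` with radius `r + l`, which is the Jacobian; the angle is measured
from `φ₀ + π` because the centres lie opposite to the normals. -/
lemma setLIntegral_sector {v : Plane} {φ₀ σ : ℝ} (hσ : σ = 1 ∨ σ = -1) (hr : 0 < r) {I J : Set ℝ}
    (hI : I ⊆ Set.Ico 0 Real.pi) (hJ : J ⊆ Set.Ici 0) (hIm : MeasurableSet I)
    (hJm : MeasurableSet J) {f : Plane → ENNReal} (hf : Measurable f) :
    ∫⁻ c in sector r v φ₀ σ I J, f c = ∫⁻ η in I, ∫⁻ l in J,
      ENNReal.ofReal (r + l) * f (v - (r + l) • unitVec (φ₀ - σ * η)) := by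
  have hSm := measurableSet_sector (v := v) (φ₀ := φ₀) hσ hr hI hJ hIm hJm
  set S := sector r v φ₀ σ I J with hS
  have hσσ : σ * σ = 1 := by rcases hσ with h | h <;> simp [h]
  set H : ℝ → ENNReal := fun η => ∫⁻ l in J, ENNReal.ofReal (r + l) *
    f (v - (r + l) • unitVec (φ₀ - σ * η)) with hH
  rw [← lintegral_indicator hSm, lintegral_polar v (φ₀ + Real.pi) (hf.indicator hSm),
    ← lintegral_indicator measurableSet_Ioo, ← lintegral_indicator hIm]
  have hpt : ∀ t ρ : ℝ, v + ρ • unitVec (φ₀ + Real.pi + t) = v - ρ • unitVec (φ₀ - σ * (-σ * t)) := by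
    intro t ρ
    rw [show φ₀ + Real.pi + t = φ₀ + t + Real.pi by ring, unitVec_add_pi,
      show φ₀ - σ * (-σ * t) = φ₀ + (σ * σ) * t by ring, hσσ, one_mul, smul_neg, sub_eq_add_neg]
  have hmem : ∀ t ∈ Set.Ioo (-Real.pi) Real.pi, ∀ ρ > 0,
      v - ρ • unitVec (φ₀ - σ * (-σ * t)) ∈ S ↔ -σ * t ∈ I ∧ ρ - r ∈ J := by
    intro t ht ρ hρ
    constructor
    · rintro ⟨⟨η, l⟩, ⟨hη, hl⟩, h⟩
      have hη' := hI hη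
      have hl' : 0 ≤ l := hJ hl
      have h1 : (r + l) • unitVec (φ₀ - σ * η) = ρ • unitVec (φ₀ - σ * (-σ * t)) := sub_right_inj.1 h
      have h2 := congrArg norm h1
      rw [norm_smul, norm_smul, norm_unitVec, norm_unitVec, Real.norm_of_nonneg (by positivity),
        Real.norm_of_nonneg hρ.le, mul_one, mul_one] at h2
      rw [h2] at h1
      have h3 := smul_right_injective Plane hρ.ne' h1
      obtain ⟨k, hk⟩ := exists_int_of_unitVec_eq h3
      have hk0 : k = 0 := by
        by_contra hk0
        have hpi := Real.pi_pos
        rcases lt_or_gt_of_ne hk0 with h | h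
        · have : (k : ℝ) ≤ -1 := by exact_mod_cast (by omega : k ≤ -1)
          rcases hσ with rfl | rfl <;> nlinarith [ht.1, ht.2, hη'.1, hη'.2]
        · have : (1 : ℝ) ≤ k := by exact_mod_cast (by omega : 1 ≤ k)
          rcases hσ with rfl | rfl <;> nlinarith [ht.1, ht.2, hη'.1, hη'.2]
      rw [hk0] at hk
      have e : -σ * t = η := by rcases hσ with rfl | rfl <;> simp at hk ⊢ <;> linarith
      rw [e, ← h2, add_sub_cancel_left]
      exact ⟨hη, hl⟩
    · rintro ⟨h1, h2⟩
      exact ⟨(-σ * t, ρ - r), ⟨h1, h2⟩, by simp⟩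
  have hleft : ∀ t, (Set.Ioo (-Real.pi) Real.pi).indicator (fun t => ∫⁻ ρ in Set.Ioi (0 : ℝ),
      ENNReal.ofReal ρ * S.indicator f (v + ρ • unitVec (φ₀ + Real.pi + t))) t =
      I.indicator H (-σ * t) := by
    intro t
    by_cases ht : t ∈ Set.Ioo (-Real.pi) Real.pi
    · rw [Set.indicator_of_mem ht]
      by_cases htI : -σ * t ∈ I
      · rw [Set.indicator_of_mem htI, hH, ← lintegral_indicator measurableSet_Ioi]
        simp only
        rw [← lintegral_indicator hJm]
        refine Eq.trans ?_ (lintegral_sub_right_eq_self _ r)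
        refine lintegral_congr fun ρ => ?_
        by_cases hρ : 0 < ρ
        · rw [Set.indicator_of_mem (Set.mem_Ioi.2 hρ), hpt]
          by_cases hρJ : ρ - r ∈ J
          · rw [Set.indicator_of_mem ((hmem t ht ρ hρ).2 ⟨htI, hρJ⟩), Set.indicator_of_mem hρJ,
              add_sub_cancel]
          · rw [Set.indicator_of_notMem (fun h => hρJ ((hmem t ht ρ hρ).1 h).2),
              Set.indicator_of_notMem hρJ, mul_zero]
        · rw [Set.indicator_of_notMem (by simpa using hρ), Set.indicator_of_notMem]
          intro h
          have : 0 ≤ ρ - r := hJ h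
          linarith
      · rw [Set.indicator_of_notMem htI]
        rw [setLIntegral_congr_fun (g := fun _ => 0) measurableSet_Ioi]
        · simp
        · intro ρ hρ
          simp only
          rw [hpt, Set.indicator_of_notMem (fun h => htI ((hmem t ht ρ hρ).1 h).1), mul_zero]
    · rw [Set.indicator_of_notMem ht, Set.indicator_of_notMem]
      intro h
      have h1 := hI h
      apply ht
      rcases hσ with rfl | rfl <;> simp at h1 ⊢ <;> constructor <;> linarith [Real.pi_pos]
  rw [lintegral_congr hleft]
  change _ = ∫⁻ η, I.indicator H η
  rcases hσ with h | h
  · simp only [h, neg_mul, one_mul]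
    exact lintegral_neg_eq_self (I.indicator H)
  · simp [h]

end Sector

/-! ### The contribution of one end of an arc of normals -/

section Corner

variable {r : ℝ} {P : Set Plane}

lemma IsDiscPolygon.mul_edgeDensity_le (hP : IsDiscPolygon r P) (N : ℕ) {c : Plane} {ρ ρ' x m : ℝ}
    (hρ : 0 ≤ ρ') (hρρ' : ρ ≤ ρ')
    (hx : ENNReal.ofReal x ≤ volume (P \ Metric.closedBall c r))
    (hm : chordMeasure r P c ≤ ENNReal.ofReal m) : ENNReal.ofReal ρ * edgeDensity r P N c ≤
      ENNReal.ofReal (ρ' * m * Real.exp (-(N / area P * x))) := by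
  rw [mul_assoc, ENNReal.ofReal_mul hρ, mul_comm m, ENNReal.ofReal_mul (Real.exp_pos _).le]
  exact mul_le_mul' (ENNReal.ofReal_le_ofReal hρρ')
    (mul_le_mul' (hP.cond_pow_le Metric.isClosed_closedBall.measurableSet N hx) hm)

lemma IsDiscPolygon.le_mul_edgeDensity (hP : IsDiscPolygon r P) (N : ℕ) {c : Plane} {ρ ρ' x m k : ℝ}
    (hρ : 0 ≤ ρ') (hρρ' : ρ' ≤ ρ) (hx0 : 0 ≤ x)
    (hx : volume (P \ Metric.closedBall c r) ≤ ENNReal.ofReal x)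
    (hk : Real.exp (-(k * (x / area P))) ≤ 1 - x / area P)
    (hm : ENNReal.ofReal m ≤ chordMeasure r P c) :
    ENNReal.ofReal (ρ' * m * Real.exp (-(k * (N / area P * x)))) ≤
      ENNReal.ofReal ρ * edgeDensity r P N c := by
  rw [mul_assoc, ENNReal.ofReal_mul hρ, mul_comm m, ENNReal.ofReal_mul (Real.exp_pos _).le]
  exact mul_le_mul' (ENNReal.ofReal_le_ofReal hρρ')
    (mul_le_mul' (hP.le_cond_pow Metric.isClosed_closedBall.measurableSet N hx0 hx hk) hm)

lemma IsDiscCorner.exists_setLIntegral_edgeDensity_le {v : Plane} {φ₀ σ ω τ k : ℝ}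
    (h : IsDiscCorner r P v φ₀ σ ω τ) (hP : IsDiscPolygon r P) (hr : 0 < r) (hk : 1 < k) :
    ∃ C ≥ 0, ∀ N : ℕ, area P ≤ N →
      ∫⁻ c in sector r v φ₀ σ (Set.Icc 0 (ω / 2)) (Set.Icc 0 (2 * r)), edgeDensity r P N c ≤
        ENNReal.ofReal (1 / (N / area P) ^ 2 * (k / 3 * Real.log (N / area P) + C)) := by
  -- With `p = k₁ ^ 2 / 6` and `q = 1 / (2 * k₁)` the coefficient `p / (2 * q ^ 2)` equals `k₁ ^ 4 /
  -- 3`. The Jacobian, the chords and the cap each lose `k₁`, and the cap enters squared.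
  obtain ⟨k₁, hk₁, rfl⟩ := exists_pow_le hk (n := 4) (by norm_num)
  have hk0 : 0 < k₁ := by linarith
  have hA := hP.area_pos
  have hω := h.lt_pi
  have hω0 := h.pos
  have hpi := Real.pi_pos
  obtain ⟨δ₁, hδ₁, C₁, hC₁, hcrude⟩ := h.exists_chordMeasure_le hP hr
  obtain ⟨δ₂, hδ₂, hsharp⟩ := h.exists_chordMeasure_le_sharp hP hr hk₁
  obtain ⟨δ₃, hδ₃, hlow⟩ := hP.exists_le_sharp hr h.τ_pos hk₁
  obtain ⟨κ, hκ, hcap⟩ := exists_le_volume_cap hP hr h.τ_pos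
  obtain ⟨C₀, hC₀, hconst⟩ := exists_chordMeasure_le_const r P
  obtain ⟨δ, hδ, d1, d2, d3, d4, d5, d6⟩ : ∃ δ > 0, δ ≤ δ₁ ∧ δ ≤ δ₂ ∧ δ ≤ δ₃ ∧ δ ≤ 1 ∧
      δ ≤ ω / 2 ∧ δ ≤ (k₁ - 1) * r := by
    have : 0 < (k₁ - 1) * r := mul_pos (by linarith) hr
    exact ⟨min (min (min δ₁ δ₂) δ₃) (min (min 1 (ω / 2)) ((k₁ - 1) * r)), by positivity,
      (min_le_left _ _).trans ((min_le_left _ _).trans (min_le_left _ _)),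
      (min_le_left _ _).trans ((min_le_left _ _).trans (min_le_right _ _)),
      (min_le_left _ _).trans (min_le_right _ _),
      (min_le_right _ _).trans ((min_le_left _ _).trans (min_le_left _ _)),
      (min_le_right _ _).trans ((min_le_left _ _).trans (min_le_right _ _)),
      (min_le_right _ _).trans (min_le_right _ _)⟩
  -- The two values in `κ` come from the cap bound with `b = δ`, linear in `l`, and with `b = l / (2
  -- * r + π)`, quadratic in `l`.
  obtain ⟨C', hC', hint⟩ := corner_integral_le (p := k₁ ^ 2 / 6) (q := 1 / (2 * k₁)) (δ := δ)
    (C := 3 * r * C₀ + 3 * r * (C₁ / δ ^ 3)) (κ := min (κ * δ) (κ / (2 * r + Real.pi)))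
    (w := ω / 2) (L := 2 * r) (by positivity) (by positivity) hδ (by positivity) (by positivity)
    (by positivity) (by positivity)
  refine ⟨C', hC', fun N hN => ?_⟩
  have hvP : ∀ η ∈ Set.Icc 0 ω, supportPoint P (φ₀ - σ * η) = v := h.supportPoint_eq
  have hv₀ : supportPoint P φ₀ = v := by simpa using hvP 0 ⟨le_rfl, hω0.le⟩
  rw [setLIntegral_sector h.sign hr (fun x hx => ⟨hx.1, by linarith [hx.2]⟩) (fun x hx => hx.1)
    measurableSet_Icc measurableSet_Icc (hP.measurable_edgeDensity N),
    setLIntegral_congr Ioc_ae_eq_Icc.symm]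
  simp_rw [setLIntegral_congr (Ioc_ae_eq_Icc (a := (0 : ℝ)) (b := 2 * r)).symm]
  have hc : ∀ η ∈ Set.Icc 0 ω, ∀ l, v - (r + l) • unitVec (φ₀ - σ * η) =
      supportCentre r P (φ₀ - σ * η) - l • unitVec (φ₀ - σ * η) := by
    intro η hη l
    rw [h.supportCentre_eq hη]; module
  refine (hint (N / area P) ((one_le_div hA).2 hN) _ ?_ ?_ ?_).trans (le_of_eq ?_)
  · intro η hη l hl
    have hη0 := hη.1
    have hl0 := hl.1
    have hηω : η ∈ Set.Icc 0 ω := ⟨hη0.le, by linarith [hη.2]⟩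
    rw [hc η hηω]
    have hlr : l ≤ (k₁ - 1) * r := by
      refine hl.2.trans (le_trans ?_ d6)
      calc δ * η ≤ δ * 1 := by gcongr; linarith [hη.2]
        _ = δ := mul_one δ
    refine (hP.mul_edgeDensity_le N (ρ' := k₁ * r) (by positivity) (by linarith)
      (hlow v φ₀ σ η h.sign (hvP η hηω) ⟨hη0, hη.2.trans d3⟩ h.edge l
        ⟨hl0.le, hl.2.trans (by gcongr)⟩).1
      (hsharp η ⟨hη0, hη.2.trans d2⟩ l ⟨hl0.le, hl.2.trans (by gcongr)⟩)).trans (le_of_eq ?_)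
    congr 2
    · field_simp
    · congr 1; field_simp
  · intro η hη l hl hle
    have hη0 := hη.1
    have hl0 := hl.1
    have hηω : η ∈ Set.Icc 0 ω := ⟨hη0.le, by linarith [hη.2]⟩
    rw [hc η hηω]
    refine (hP.mul_edgeDensity_le N (ρ' := 3 * r) (by positivity) (by linarith [hl.2])
      (hcap v φ₀ σ η h.sign hv₀ (hvP η hηω) ⟨hη0.le, by linarith [hη.2]⟩ h.edge l hl δ
        ⟨hδ.le, d4⟩ hle) (hconst _)).trans (ENNReal.ofReal_le_ofReal ?_)
    refine mul_le_mul ?_ (Real.exp_le_exp.2 (neg_le_neg ?_)) (Real.exp_pos _).le (by positivity)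
    · have : 0 ≤ 3 * r * (C₁ / δ ^ 3) := by positivity
      linarith
    · rw [mul_assoc (N / area P : ℝ)]
      refine mul_le_mul_of_nonneg_left ?_ (by positivity)
      calc _ ≤ κ * δ * l := by gcongr; exact min_le_left _ _
        _ = _ := by ring
  · intro η hη l hl hle
    have hη0 : 0 < η := hδ.trans hη.1
    have hl0 := hl.1
    have hηω : η ∈ Set.Icc 0 ω := ⟨hη0.le, by linarith [hη.2]⟩
    rw [hc η hηω]
    have hb : l / (2 * r + Real.pi) ∈ Set.Icc (0 : ℝ) 1 :=
      ⟨by positivity, (div_le_one (by positivity)).2 (by linarith [hl.2])⟩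
    refine (hP.mul_edgeDensity_le N (ρ' := 3 * r) (by positivity) (by linarith [hl.2])
      (hcap v φ₀ σ η h.sign hv₀ (hvP η hηω) ⟨hη0.le, by linarith [hη.2]⟩ h.edge l hl _ hb ?_)
      (hcrude η ⟨hη0, hη.2⟩ l ⟨hl0.le, hle.trans (by gcongr)⟩)).trans
      (ENNReal.ofReal_le_ofReal ?_)
    · rw [div_mul_eq_mul_div, div_le_iff₀ (by positivity)]
      exact mul_le_mul_of_nonneg_left (by linarith [hη.2] : η ≤ 2 * r + Real.pi) hl0.le
    rw [← mul_assoc (3 * r * C₀ + _) (l ^ 3)]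
    refine mul_le_mul ?_ (Real.exp_le_exp.2 (neg_le_neg ?_)) (Real.exp_pos _).le (by positivity)
    · have e1 : C₁ * (l / η) ^ 3 ≤ C₁ * (l / δ) ^ 3 := by
        gcongr; exact hη.1.le
      calc 3 * r * (C₁ * (l / η) ^ 3) ≤ 3 * r * (C₁ * (l / δ) ^ 3) := by gcongr
        _ = 3 * r * (C₁ / δ ^ 3) * l ^ 3 := by field_simp
        _ ≤ _ := by
          gcongr
          have : 0 ≤ 3 * r * C₀ := by positivity
          linarith
    · rw [mul_assoc (N / area P : ℝ)]
      refine mul_le_mul_of_nonneg_left ?_ (by positivity)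
      calc _ ≤ κ / (2 * r + Real.pi) * l ^ 2 := by gcongr; exact min_le_right _ _
        _ = _ := by field_simp
  · congr 2
    field_simp
    ring

lemma IsDiscCorner.exists_le_setLIntegral_edgeDensity {v : Plane} {φ₀ σ ω τ k : ℝ}
    (h : IsDiscCorner r P v φ₀ σ ω τ) (hP : IsDiscPolygon r P) (hr : 0 < r) (hk : 1 < k) :
    ∃ C : ℝ, ∃ δ > 0, δ < ω / 2 ∧ ∀ N : ℕ, 0 < N →
      ENNReal.ofReal (1 / (N / area P) ^ 2 * (1 / (3 * k) * (Real.log (N / area P) + C))) ≤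
      ∫⁻ c in sector r v φ₀ σ (Set.Ioc 0 δ) (Set.Ioc 0 (δ * δ)), edgeDensity r P N c := by
  -- With `p = 1 / (6 * k₁)`, `q = k₁ ^ 2 / 2` and the loss `k₁` of the integral the coefficient is
  -- `1 / (3 * k₁ ^ 6)`.
  obtain ⟨k₁, hk₁, rfl⟩ := exists_pow_le hk (n := 6) (by norm_num)
  have hk0 : 0 < k₁ := by linarith
  have hA := hP.area_pos
  have hω := h.lt_pi
  have hω0 := h.pos
  obtain ⟨δ₁, hδ₁, hvol⟩ := h.exists_volume_cap_le hP hr hk₁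
  obtain ⟨δ₂, hδ₂, hlow⟩ := hP.exists_le_sharp hr h.τ_pos hk₁
  obtain ⟨x₀, hx₀, hexp⟩ := exists_exp_neg_le_one_sub hk₁
  obtain ⟨δ, hδ, d1, d2, d3, d4, d5⟩ : ∃ δ > 0, δ ≤ δ₁ ∧ δ ≤ δ₂ ∧ δ ≤ 1 ∧ δ < ω / 2 ∧
      δ ≤ x₀ * area P / k₁ :=
    ⟨min (min (min δ₁ δ₂) 1) (min (ω / 4) (x₀ * area P / k₁)), by positivity,
      (min_le_left _ _).trans ((min_le_left _ _).trans (min_le_left _ _)),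
      (min_le_left _ _).trans ((min_le_left _ _).trans (min_le_right _ _)),
      (min_le_left _ _).trans (min_le_right _ _),
      ((min_le_right _ _).trans (min_le_left _ _)).trans_lt (by linarith),
      (min_le_right _ _).trans (min_le_right _ _)⟩
  obtain ⟨C', hint⟩ := le_corner_integral (p := 1 / (6 * k₁)) (q := k₁ ^ 2 / 2) (δ := δ) (k := k₁)
    (by positivity) (by positivity) hδ hk₁
  refine ⟨C', δ, hδ, d4, fun N hN => ?_⟩
  have hN0 : (0 : ℝ) < N := by exact_mod_cast hN
  rw [setLIntegral_sector h.sign hr (fun x hx => ⟨hx.1.le, by linarith [hx.2]⟩) (fun x hx => hx.1.le)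
    measurableSet_Ioc measurableSet_Ioc (hP.measurable_edgeDensity N)]
  refine le_trans (le_of_eq ?_) ((hint (N / area P) (by positivity) (fun η l => ENNReal.ofReal (r + l) *
    edgeDensity r P N (v - (r + l) • unitVec (φ₀ - σ * η))) ?_).trans
    (setLIntegral_mono' measurableSet_Ioc fun η hη => lintegral_mono_set
      (Set.Ioc_subset_Ioc_right (mul_le_mul_of_nonneg_left hη.2 hδ.le))))
  · congr 2
    field_simp
    ring
  · intro η hη l hl
    have hη0 := hη.1
    have hl0 := hl.1
    have hηω : η ∈ Set.Icc 0 ω := ⟨hη0.le, by linarith [hη.2]⟩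
    have hc : v - (r + l) • unitVec (φ₀ - σ * η) =
        supportCentre r P (φ₀ - σ * η) - l • unitVec (φ₀ - σ * η) := by
      rw [h.supportCentre_eq hηω]; module
    have hx : k₁ * (l ^ 2 / (2 * η)) / area P ∈ Set.Icc 0 x₀ := by
      refine ⟨by positivity, ?_⟩
      rw [div_le_iff₀ hA]
      rw [le_div_iff₀ hk0] at d5
      refine le_trans ?_ d5
      rw [mul_comm δ]
      refine mul_le_mul_of_nonneg_left ?_ hk0.le
      rw [div_le_iff₀ (by positivity)]
      calc l ^ 2 ≤ (δ * η) ^ 2 := by gcongr; exact hl.2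
        _ = δ * (δ * η * η) := by ring
        _ ≤ δ * (1 * 1 * η) := by gcongr; linarith [hη.2]
        _ ≤ _ := by nlinarith
    rw [hc]
    refine le_trans (le_of_eq ?_) (hP.le_mul_edgeDensity N (ρ' := r) hr.le (by linarith)
      (by positivity) (hvol η ⟨hη0, hη.2.trans d1⟩ l hl0.le) (hexp _ hx)
      (hlow v φ₀ σ η h.sign (h.supportPoint_eq η hηω) ⟨hη0, hη.2.trans d2⟩ h.edge l
        ⟨hl0.le, hl.2.trans (by gcongr)⟩).2)
    congr 2
    · field_simp
    · congr 1; field_simp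

end Corner

/-! ### Summation over the vertices -/

section Total

variable {r : ℝ} {P : Set Plane}

/-- Some point of `P` is at distance `r` from `c`. The point of `P` farthest from `c` is extremal in
its direction `φ` from `c`, and its distance is `r + l`. -/
lemma IsDiscPolygon.exists_of_chordMeasure_ne_zero (hP : IsDiscPolygon r P) (hr : 0 < r) {c : Plane}
    (hc : chordMeasure r P c ≠ 0) : ∃ φ ∈ Set.Icc (-Real.pi) Real.pi, ∃ l ∈ Set.Icc 0 (2 * r),
      c = supportCentre r P φ - l • unitVec φ := by
  obtain ⟨w, ⟨hw2, hwP, -⟩, hw0⟩ : ∃ w, w ∈ {w : Plane | ‖w‖ < 2 * r ∧ c - arcCentre r 0 w ∈ P ∧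
      c - arcCentre r 0 w + w ∈ P} ∧ w ≠ 0 := by
    by_contra! hcon
    exact hc (measure_mono_null (fun w hw => hcon w hw) (measure_singleton (0 : Plane)))
  have hy := (norm_sub_arcCentre hr hw0 (by simpa using hw2)).1
  set y := c - arcCentre r 0 w with hydef
  have hyc : ‖y - c‖ = r := by rw [← hy, hydef]; congr 1; abel
  obtain ⟨x, hx, hmax⟩ := hP.isCompact.exists_isMaxOn ⟨y, hwP⟩ (f := fun x => ‖x - c‖) (by fun_prop)
  have hR : r ≤ ‖x - c‖ := hyc ▸ hmax hwP
  obtain ⟨φ, hφ, hxφ⟩ := exists_eq_norm_smul_unitVec (x - c)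
  have hs : supportPoint P φ = x := by
    refine hP.supportPoint_eq hr ⟨hx, fun z hz => ?_⟩
    have h1 := abs_real_inner_le_norm (unitVec φ) (z - c)
    rw [norm_unitVec, one_mul] at h1
    have h2 : ‖z - c‖ ≤ ‖x - c‖ := hmax hz
    have h3 : inner ℝ (unitVec φ) (x - c) = ‖x - c‖ := by
      rw [hxφ, real_inner_smul_right, inner_unitVec, norm_smul, norm_unitVec]; simp
    rw [show z - x = (z - c) - (x - c) by abel, inner_sub_right, h3]
    linarith [le_abs_self (inner ℝ (unitVec φ) (z - c))]
  refine ⟨φ, ⟨hφ.1.le, hφ.2⟩, ‖x - c‖ - r, ⟨by linarith, ?_⟩, ?_⟩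
  · have h1 := norm_sub_le_two_mul_of_mem hP hr hx hwP
    have h2 := norm_sub_le_norm_sub_add_norm_sub x y c
    linarith
  · rw [supportCentre, hs, sub_sub, ← add_smul, add_sub_cancel, ← hxφ]; abel

/-- Each half of the arc of normals is treated from its own end; the two halves give twice `k / 3`.
-/
lemma IsDiscPolygon.exists_vertex_region_le (hP : IsDiscPolygon r P) (hr : 0 < r) {k : ℝ}
    (hk : 1 < k) {v : Plane} (hv : v ∈ vertices P) : ∃ U : Set Plane, ∃ C : ℝ, MeasurableSet U ∧
      (∀ φ, supportPoint P φ = v → ∀ l ∈ Set.Icc 0 (2 * r),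
        supportCentre r P φ - l • unitVec φ ∈ U) ∧ 0 ≤ C ∧
      ∀ N : ℕ, area P ≤ N → ∫⁻ c in U, edgeDensity r P N c ≤
        ENNReal.ofReal (1 / (N / area P) ^ 2 * (2 / 3 * k * Real.log (N / area P) + C)) := by
  obtain ⟨φ₀, ω, τ, h, hall⟩ := hP.exists_isDiscCorner hr hv
  have hω := h.lt_pi
  have hω0 := h.pos
  have hA := hP.area_pos
  obtain ⟨C₁, hC₁, h₁⟩ := h.exists_setLIntegral_edgeDensity_le hP hr hk
  obtain ⟨C₂, hC₂, h₂⟩ := h.symm.exists_setLIntegral_edgeDensity_le hP hr hk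
  have hI : Set.Icc 0 (ω / 2) ⊆ Set.Ico 0 Real.pi := fun x hx => ⟨hx.1, by linarith [hx.2]⟩
  have hJ : Set.Icc 0 (2 * r) ⊆ Set.Ici 0 := fun x hx => hx.1
  have hm₁ := measurableSet_sector (v := v) (φ₀ := φ₀) h.sign hr hI hJ measurableSet_Icc
    measurableSet_Icc
  have hm₂ := measurableSet_sector (v := v) (φ₀ := φ₀ - 1 * ω) h.symm.sign hr hI hJ
    measurableSet_Icc measurableSet_Icc
  refine ⟨_, C₁ + C₂, hm₁.union hm₂, ?_, by positivity, ?_⟩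
  · intro φ hφ l hl
    obtain ⟨n, hn⟩ := hall φ hφ
    have he : supportCentre r P φ - l • unitVec φ =
        v - (r + l) • unitVec (φ + n * (2 * Real.pi)) := by
      rw [supportCentre, hφ, unitVec_add_int_mul]; module
    rw [he]
    rcases le_total (φ₀ - ω / 2) (φ + n * (2 * Real.pi)) with hle | hle
    · exact Or.inl ⟨(φ₀ - (φ + n * (2 * Real.pi)), l), ⟨⟨by linarith [hn.2], by linarith⟩, hl⟩, by
        simp⟩
    · refine Or.inr ⟨(φ + n * (2 * Real.pi) - (φ₀ - ω), l),
        ⟨⟨by linarith [hn.1], by linarith⟩, hl⟩, ?_⟩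
      simp only
      congr 3
      ring
  · intro N hN
    refine (lintegral_union_le _ _ _).trans ((add_le_add (h₁ N hN) (h₂ N hN)).trans ?_)
    have := Real.log_nonneg ((one_le_div hA).2 hN)
    rw [← ENNReal.ofReal_add (by positivity) (by positivity)]
    refine ENNReal.ofReal_le_ofReal (le_of_eq ?_)
    ring

lemma IsDiscPolygon.exists_le_vertex_region (hP : IsDiscPolygon r P) (hr : 0 < r) {k : ℝ}
    (hk : 1 < k) {v : Plane} (hv : v ∈ vertices P) : ∃ U : Set Plane, ∃ C : ℝ, MeasurableSet U ∧
      (∀ c ∈ U, ∃ φ l, 0 < l ∧ supportPoint P φ = v ∧ c = v - (r + l) • unitVec φ) ∧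
      ∀ N : ℕ, 0 < N →
        ENNReal.ofReal (1 / (N / area P) ^ 2 * (2 / 3 / k * Real.log (N / area P) + C)) ≤
          ∫⁻ c in U, edgeDensity r P N c := by
  obtain ⟨φ₀, ω, τ, h, hall⟩ := hP.exists_isDiscCorner hr hv
  have hω := h.lt_pi
  have hω0 := h.pos
  have hA := hP.area_pos
  obtain ⟨C₁, δ₁, hδ₁, hδω₁, h₁⟩ := h.exists_le_setLIntegral_edgeDensity hP hr hk
  obtain ⟨C₂, δ₂, hδ₂, hδω₂, h₂⟩ := h.symm.exists_le_setLIntegral_edgeDensity hP hr hk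
  have hI : ∀ {δ}, δ < ω / 2 → Set.Ioc 0 δ ⊆ Set.Ico 0 Real.pi :=
    fun {δ} hδ x hx => ⟨hx.1.le, by linarith [hx.2]⟩
  have hJ : ∀ {δ : ℝ}, Set.Ioc 0 (δ * δ) ⊆ Set.Ici 0 := fun {δ} x hx => hx.1.le
  have hm₁ := measurableSet_sector (v := v) (φ₀ := φ₀) h.sign hr (hI hδω₁) (hJ (δ := δ₁))
    measurableSet_Ioc measurableSet_Ioc
  have hm₂ := measurableSet_sector (v := v) (φ₀ := φ₀ - 1 * ω) h.symm.sign hr (hI hδω₂)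
    (hJ (δ := δ₂)) measurableSet_Ioc measurableSet_Ioc
  refine ⟨_, 1 / (3 * k) * (C₁ + C₂), hm₁.union hm₂, ?_, ?_⟩
  · rintro c (⟨⟨η, l⟩, ⟨hη, hl⟩, rfl⟩ | ⟨⟨η, l⟩, ⟨hη, hl⟩, rfl⟩)
    · exact ⟨_, l, hl.1, h.supportPoint_eq η ⟨hη.1.le, by linarith [hη.2]⟩, rfl⟩
    · exact ⟨_, l, hl.1, h.symm.supportPoint_eq η ⟨hη.1.le, by linarith [hη.2]⟩, rfl⟩
  · intro N hN
    rw [lintegral_union hm₂]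
    · refine le_trans ?_ (add_le_add (h₁ N hN) (h₂ N hN))
      refine le_trans (ENNReal.ofReal_le_ofReal (le_of_eq ?_)) ENNReal.ofReal_add_le
      field_simp
      ring
    · rw [Set.disjoint_left]
      rintro c ⟨⟨η, l⟩, ⟨hη, hl⟩, rfl⟩ ⟨⟨η', l'⟩, ⟨hη', hl'⟩, he⟩
      have h1 : (r + l') • unitVec (φ₀ - 1 * ω - -1 * η') = (r + l) • unitVec (φ₀ - 1 * η) :=
        sub_right_inj.1 he
      have hl0 : 0 < l := hl.1
      have hl0' : 0 < l' := hl'.1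
      have h2 := congrArg norm h1
      rw [norm_smul, norm_smul, norm_unitVec, norm_unitVec, Real.norm_of_nonneg (by positivity),
        Real.norm_of_nonneg (by positivity), mul_one, mul_one] at h2
      rw [h2] at h1
      have h3 := unitVec_eq_iff.1 (smul_right_injective Plane (by positivity : r + l ≠ 0) h1)
      have e1 : 0 < ω - η - η' := by
        have a1 : η ≤ δ₁ := hη.2
        have a2 : η' ≤ δ₂ := hη'.2
        linarith
      have a3 : 0 < η := hη.1
      have a4 : 0 < η' := hη'.1
      rw [← Real.cos_neg, show -(φ₀ - 1 * ω - -1 * η' - (φ₀ - 1 * η)) = ω - η - η' by ring] at h3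
      have := (Real.cos_eq_one_iff_of_lt_of_lt (by linarith) (by linarith)).1 h3
      linarith

/-- If `l ≤ m`, then `w` is at least as far from `c` as `v` is. Lying also in the disc that touches
at `v`, it must be extremal in the direction `φ`, hence equal to `v`. -/
lemma IsDiscPolygon.disjoint_vertex_regions (hP : IsDiscPolygon r P) (hr : 0 < r) {v w c : Plane}
    {φ ψ l m : ℝ} (hl : 0 < l) (hm : 0 < m) (hv : supportPoint P φ = v) (hw : supportPoint P ψ = w)
    (hcv : c = v - (r + l) • unitVec φ) (hcw : c = w - (r + m) • unitVec ψ) : v = w := by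
  have key : ∀ {v w : Plane} {φ ψ l m : ℝ}, 0 < l → 0 < m → supportPoint P φ = v →
      supportPoint P ψ = w → c = v - (r + l) • unitVec φ → c = w - (r + m) • unitVec ψ → l ≤ m →
      v = w := by
    intro v w φ ψ l m hl hm hv hw hcv hcw hlm
    have hwP : w ∈ P := hw ▸ hP.supportPoint_mem ψ
    have h1 : ‖w - (v - r • unitVec φ)‖ ≤ r := by
      have := mem_closedBall_iff_norm.1 (hP.subset_closedBall hr φ hwP)
      rwa [supportCentre, hv] at this
    have h2 : ‖w - c‖ = r + m := by
      rw [hcw, sub_sub_cancel, norm_smul, norm_unitVec, mul_one, Real.norm_of_nonneg (by positivity)]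
    set u := w - (v - r • unitVec φ) with hu
    rw [show w - c = u + l • unitVec φ by rw [hcv, hu]; module] at h2
    have h3 : ‖u + l • unitVec φ‖ ^ 2 = ‖u‖ ^ 2 + 2 * (l * inner ℝ u (unitVec φ)) + l ^ 2 := by
      rw [norm_add_sq_real, real_inner_smul_right, norm_smul, norm_unitVec, mul_one,
        Real.norm_of_nonneg hl.le]
    rw [h2] at h3
    have h4 : ‖u‖ ^ 2 ≤ r ^ 2 := pow_le_pow_left₀ (norm_nonneg _) h1 2
    have h5 : r ≤ inner ℝ u (unitVec φ) := by
      have : (2 * l) * r ≤ (2 * l) * inner ℝ u (unitVec φ) := by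
        nlinarith [mul_nonneg hr.le (sub_nonneg.2 hlm)]
      exact le_of_mul_le_mul_left this (by positivity)
    have h6 : 0 ≤ inner ℝ (unitVec φ) (w - v) := by
      rw [show w - v = u - r • unitVec φ by rw [hu]; module, inner_sub_right, real_inner_smul_right,
        inner_unitVec, sub_self, Real.cos_zero, mul_one, real_inner_comm]
      linarith
    have hsv : IsSupportPoint P φ v := hv ▸ hP.isSupportPoint φ
    rw [← hv]
    refine hP.supportPoint_eq hr ⟨hwP, fun y hy => ?_⟩
    have := hsv.2 y hy
    rw [show y - w = (y - v) - (w - v) by abel, inner_sub_right]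
    linarith
  rcases le_total l m with h | h
  · exact key hl hm hv hw hcv hcw h
  · exact (key hm hl hw hv hcw hcv h).symm

/-- The cap bound at `η = 0` with `b = 1` is linear in `l`, because the moved disc uncovers a whole
piece of edge. -/
lemma IsDiscPolygon.exists_edgeDensity_le_of_not_vertex (hP : IsDiscPolygon r P) (hr : 0 < r) :
    ∃ C ≥ 0, ∃ κ > 0, ∀ φ ∈ Set.Icc (-Real.pi) Real.pi, supportPoint P φ ∉ vertices P →
      ∀ l ∈ Set.Icc 0 (2 * r), ∀ N : ℕ, edgeDensity r P N (supportCentre r P φ - l • unitVec φ) ≤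
        ENNReal.ofReal (C * Real.exp (-(N / area P * κ * l))) := by
  obtain ⟨τ, hτ, hedge⟩ := hP.exists_edge_of_not_vertex hr
  obtain ⟨κ, hκ, hcap⟩ := exists_le_volume_cap hP hr hτ
  obtain ⟨C, hC, hconst⟩ := exists_chordMeasure_le_const r P
  refine ⟨C, hC, κ, hκ, fun φ hφ hv l hl N => ?_⟩
  obtain ⟨σ, hσ, hE⟩ := hedge φ hφ hv
  have hx : ENNReal.ofReal (κ * l) ≤ volume (P \ Metric.closedBall
      (supportCentre r P φ - l • unitVec φ) r) := by
    rcases eq_or_lt_of_le hl.1 with h | h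
    · simp [← h]
    have := hcap (supportPoint P φ) φ σ 0 hσ rfl (by simp) ⟨le_rfl, Real.pi_pos.le⟩ hE l
      ⟨h, hl.2⟩ 1 ⟨zero_le_one, le_rfl⟩ (by simpa using hl.1)
    simpa using this
  have := hP.mul_edgeDensity_le N zero_le_one le_rfl hx (hconst _)
  rwa [ENNReal.ofReal_one, one_mul, one_mul, ← mul_assoc] at this

/-- With `b` proportional to `N`, each of the finitely many centres off the vertices contributes
`O(N⁻²)`, without a logarithm. -/
lemma setLIntegral_closedBall_exp_le (q : Plane) {b R : ℝ} (hb : 0 < b) (hR : 0 ≤ R) :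
    ∫⁻ c in Metric.closedBall q R, ENNReal.ofReal (Real.exp (-(b * ‖c - q‖))) ≤
      ENNReal.ofReal (8 * Real.pi / b ^ 2) := by
  rw [← lintegral_indicator Metric.isClosed_closedBall.measurableSet, lintegral_polar q 0
    (Measurable.indicator (by fun_prop) Metric.isClosed_closedBall.measurableSet)]
  have h : ∀ t, ∫⁻ ρ in Set.Ioi (0 : ℝ), ENNReal.ofReal ρ * (Metric.closedBall q R).indicator
      (fun c => ENNReal.ofReal (Real.exp (-(b * ‖c - q‖)))) (q + ρ • unitVec (0 + t)) ≤
      ENNReal.ofReal (4 / b ^ 2) := by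
    intro t
    calc _ ≤ ∫⁻ ρ in Set.Ioi (0 : ℝ), (Set.Ioc 0 R).indicator
          (fun ρ => ENNReal.ofReal (2 / b) * ENNReal.ofReal (Real.exp (-(b / 2 * ρ)))) ρ := by
          refine setLIntegral_mono' measurableSet_Ioi fun ρ hρ => ?_
          have hρ0 : 0 < ρ := hρ
          have hn : ‖q + ρ • unitVec (0 + t) - q‖ = ρ := by
            rw [add_sub_cancel_left, norm_smul, norm_unitVec, mul_one, Real.norm_of_nonneg hρ0.le]
          by_cases hmem : ρ ≤ R
          · rw [Set.indicator_of_mem (mem_closedBall_iff_norm.2 (hn.trans_le hmem)),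
              Set.indicator_of_mem (show ρ ∈ Set.Ioc 0 R from ⟨hρ0, hmem⟩), hn,
              ← ENNReal.ofReal_mul hρ0.le, ← ENNReal.ofReal_mul (by positivity)]
            refine ENNReal.ofReal_le_ofReal ?_
            have h1 := Real.add_one_le_exp (b / 2 * ρ)
            have h2 : ρ ≤ 2 / b * Real.exp (b / 2 * ρ) := by
              rw [div_mul_eq_mul_div, le_div_iff₀ hb]; linarith
            calc ρ * Real.exp (-(b * ρ)) ≤ 2 / b * Real.exp (b / 2 * ρ) * Real.exp (-(b * ρ)) := by
                  gcongr
              _ = _ := by rw [mul_assoc, ← Real.exp_add]; congr 2; ring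
          · rw [Set.indicator_of_notMem, mul_zero]
            · exact zero_le
            · rw [mem_closedBall_iff_norm, hn]; exact hmem
      _ ≤ ∫⁻ ρ in Set.Ioc 0 R, ENNReal.ofReal (2 / b) * ENNReal.ofReal (Real.exp (-(b / 2 * ρ))) := by
          rw [← lintegral_indicator measurableSet_Ioc]
          exact setLIntegral_le_lintegral _ _
      _ ≤ _ := by
          rw [lintegral_const_mul _ (by fun_prop)]
          refine (mul_le_mul_right (setLIntegral_exp_le (by positivity) hR) _).trans ?_
          rw [← ENNReal.ofReal_mul (by positivity)]
          refine ENNReal.ofReal_le_ofReal (le_of_eq ?_)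
          field_simp
          norm_num
  refine (lintegral_mono h).trans ?_
  rw [setLIntegral_const, Real.volume_Ioo, ← ENNReal.ofReal_mul (by positivity)]
  refine ENNReal.ofReal_le_ofReal (le_of_eq ?_)
  ring

lemma IsDiscPolygon.exists_lintegral_edgeDensity_le (hP : IsDiscPolygon r P) (hr : 0 < r) {k : ℝ}
    (hk : 1 < k) : ∃ C : ℝ, ∀ N : ℕ, area P ≤ N → ∫⁻ c, edgeDensity r P N c ≤
      ENNReal.ofReal (1 / (N / area P) ^ 2 * (2 / 3 * f₀ P * k * Real.log (N / area P) + C)) := by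
  have hA := hP.area_pos
  have hVfin := hP.finite_vertices hr
  have hQfin := hP.finite_supportCentre hr
  choose! U C hUm hU hC hUint using fun v (hv : v ∈ vertices P) => hP.exists_vertex_region_le hr hk hv
  obtain ⟨C₀, hC₀, κ, hκ, hnv⟩ := hP.exists_edgeDensity_le_of_not_vertex hr
  refine ⟨∑ v ∈ hVfin.toFinset, C v + ∑ q ∈ hQfin.toFinset, C₀ * (8 * Real.pi / κ ^ 2),
    fun N hN => ?_⟩
  have hN0 : (0 : ℝ) < N := hA.trans_le hN
  have hmeas := hP.measurable_edgeDensity N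
  have hpt : ∀ c, edgeDensity r P N c ≤ ∑ v ∈ hVfin.toFinset, (U v).indicator (edgeDensity r P N) c +
      ∑ q ∈ hQfin.toFinset, (Metric.closedBall q (2 * r)).indicator (fun c => ENNReal.ofReal C₀ *
        ENNReal.ofReal (Real.exp (-(N / area P * κ * ‖c - q‖)))) c := by
    intro c
    by_cases h0 : chordMeasure r P c = 0
    · simp [edgeDensity, h0]
    obtain ⟨φ, hφ, l, hl, hc⟩ := hP.exists_of_chordMeasure_ne_zero hr h0
    by_cases hv : supportPoint P φ ∈ vertices P
    · refine le_add_right ?_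
      have hmem : c ∈ U (supportPoint P φ) := hc ▸ hU _ hv φ rfl l hl
      calc _ = (U (supportPoint P φ)).indicator (edgeDensity r P N) c := by
            rw [Set.indicator_of_mem hmem]
        _ ≤ _ := Finset.single_le_sum (f := fun v => (U v).indicator (edgeDensity r P N) c)
            (fun _ _ => zero_le) (hVfin.mem_toFinset.2 hv)
    · refine le_add_left ?_
      have hn : ‖c - supportCentre r P φ‖ = l := by
        rw [hc, sub_sub_cancel_left, norm_neg, norm_smul, norm_unitVec, mul_one,
          Real.norm_of_nonneg hl.1]
      refine le_trans ?_ (Finset.single_le_sum (f := fun q => (Metric.closedBall q (2 * r)).indicator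
        (fun c => ENNReal.ofReal C₀ * ENNReal.ofReal (Real.exp (-(N / area P * κ * ‖c - q‖)))) c)
        (fun _ _ => zero_le) (hQfin.mem_toFinset.2 ⟨φ, hv, rfl⟩))
      rw [Set.indicator_of_mem (mem_closedBall_iff_norm.2 (hn.trans_le hl.2)), hn,
        ← ENNReal.ofReal_mul hC₀, hc]
      exact hnv φ hφ hv l hl N
  refine (lintegral_mono hpt).trans ?_
  have hmU : ∀ v ∈ hVfin.toFinset, Measurable ((U v).indicator (edgeDensity r P N)) := fun v hv =>
    hmeas.indicator (hUm v (hVfin.mem_toFinset.1 hv))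
  rw [lintegral_add_left (Finset.measurable_fun_sum _ hmU), lintegral_finsetSum' _
    fun v hv => (hmU v hv).aemeasurable, lintegral_finsetSum _ fun q _ => Measurable.indicator
      (by fun_prop) Metric.isClosed_closedBall.measurableSet]
  have b1 : ∀ v ∈ hVfin.toFinset, ∫⁻ c, (U v).indicator (edgeDensity r P N) c ≤
      ENNReal.ofReal (1 / (N / area P) ^ 2 * (2 / 3 * k * Real.log (N / area P) + C v)) := by
    intro v hv
    rw [lintegral_indicator (hUm v (hVfin.mem_toFinset.1 hv))]
    exact hUint v (hVfin.mem_toFinset.1 hv) N hN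
  have b2 : ∀ q ∈ hQfin.toFinset, ∫⁻ c, (Metric.closedBall q (2 * r)).indicator (fun c =>
      ENNReal.ofReal C₀ * ENNReal.ofReal (Real.exp (-(N / area P * κ * ‖c - q‖)))) c ≤
      ENNReal.ofReal (1 / (N / area P) ^ 2 * (C₀ * (8 * Real.pi / κ ^ 2))) := by
    intro q _
    rw [lintegral_indicator Metric.isClosed_closedBall.measurableSet, lintegral_const_mul _
      (by fun_prop)]
    refine (mul_le_mul_right (setLIntegral_closedBall_exp_le q (by positivity) (by positivity))
      _).trans ?_
    rw [← ENNReal.ofReal_mul hC₀]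
    refine ENNReal.ofReal_le_ofReal (le_of_eq ?_)
    field_simp
  have hlog := Real.log_nonneg ((one_le_div hA).2 hN)
  refine (add_le_add (Finset.sum_le_sum b1) (Finset.sum_le_sum b2)).trans ?_
  rw [← ENNReal.ofReal_sum_of_nonneg fun v hv => by
      have := hC v (hVfin.mem_toFinset.1 hv)
      positivity,
    ← ENNReal.ofReal_sum_of_nonneg fun _ _ => by positivity, ← ENNReal.ofReal_add
      (Finset.sum_nonneg fun v hv => by
        have := hC v (hVfin.mem_toFinset.1 hv)
        positivity) (Finset.sum_nonneg fun _ _ => by positivity)]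
  refine ENNReal.ofReal_le_ofReal (le_of_eq ?_)
  rw [← Finset.mul_sum, ← Finset.mul_sum, Finset.sum_add_distrib, Finset.sum_const, nsmul_eq_mul,
    f₀, Set.ncard_eq_toFinset_card _ hVfin]
  ring

lemma IsDiscPolygon.exists_le_lintegral_edgeDensity (hP : IsDiscPolygon r P) (hr : 0 < r) {k : ℝ}
    (hk : 1 < k) : ∃ C : ℝ, ∀ N : ℕ, 0 < N →
      ENNReal.ofReal (1 / (N / area P) ^ 2 * (2 / 3 * f₀ P / k * Real.log (N / area P) + C)) ≤
        ∫⁻ c, edgeDensity r P N c := by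
  have hVfin := hP.finite_vertices hr
  choose! U C hUm hU hUint using fun v (hv : v ∈ vertices P) => hP.exists_le_vertex_region hr hk hv
  refine ⟨∑ v ∈ hVfin.toFinset, C v, fun N hN => ?_⟩
  calc _ = ENNReal.ofReal (∑ v ∈ hVfin.toFinset,
        1 / (N / area P) ^ 2 * (2 / 3 / k * Real.log (N / area P) + C v)) := by
        congr 1
        rw [← Finset.mul_sum, Finset.sum_add_distrib, Finset.sum_const, nsmul_eq_mul, f₀,
          Set.ncard_eq_toFinset_card _ hVfin]
        ring
    _ ≤ ∑ v ∈ hVfin.toFinset, ENNReal.ofReal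
        (1 / (N / area P) ^ 2 * (2 / 3 / k * Real.log (N / area P) + C v)) :=
        Finset.le_sum_of_subadditive _ ENNReal.ofReal_zero.le (fun _ _ => ENNReal.ofReal_add_le) _ _
    _ ≤ ∑ v ∈ hVfin.toFinset, ∫⁻ c in U v, edgeDensity r P N c :=
        Finset.sum_le_sum fun v hv => hUint v (hVfin.mem_toFinset.1 hv) N hN
    _ = ∫⁻ c in ⋃ v ∈ hVfin.toFinset, U v, edgeDensity r P N c := by
        refine (lintegral_biUnion_finset (fun v hv w hw hne => ?_)
          (fun v hv => hUm v (hVfin.mem_toFinset.1 hv)) _).symm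
        refine Set.disjoint_left.2 fun c hcv hcw => hne ?_
        obtain ⟨φ, l, hl, hs, hc⟩ := hU v (hVfin.mem_toFinset.1 hv) c hcv
        obtain ⟨ψ, m, hm, hs', hc'⟩ := hU w (hVfin.mem_toFinset.1 hw) c hcw
        exact hP.disjoint_vertex_regions hr hl hm hs hs' hc hc'
    _ ≤ _ := setLIntegral_le_lintegral _ _

end Total

/-! ### From bounds with a factor to the limit -/

section Limits

variable {r : ℝ} {P : Set Plane}

lemma tendsto_log_div_const {A : ℝ} (hA : 0 < A) :
    Filter.Tendsto (fun N : ℕ => Real.log (N / A) / Real.log N) Filter.atTop (nhds 1) := by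
  have hlog : Filter.Tendsto (fun N : ℕ => Real.log N) Filter.atTop Filter.atTop :=
    Real.tendsto_log_atTop.comp tendsto_natCast_atTop_atTop
  have h : Filter.Tendsto (fun N : ℕ => 1 - Real.log A / Real.log N) Filter.atTop (nhds (1 - 0)) :=
    tendsto_const_nhds.sub (hlog.const_div_atTop _)
  rw [sub_zero] at h
  refine h.congr' ?_
  filter_upwards [hlog.eventually_gt_atTop 0, Filter.eventually_gt_atTop 0] with N hN hN0
  have : (N : ℝ) ≠ 0 := by exact_mod_cast hN0.ne'
  rw [Real.log_div this hA.ne', sub_div, div_self hN.ne']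

/-- Additive constants disappear after division by the logarithm, and `k` may be taken arbitrarily
close to `1`. -/
lemma tendsto_of_log_bounds {f : ℕ → ℝ} {A L : ℝ} (hA : 0 < A)
    (hup : ∀ k > 1, ∃ C : ℝ, ∀ᶠ N : ℕ in Filter.atTop, f N ≤ L * k * Real.log (N / A) + C)
    (hlow : ∀ k > 1, ∃ C : ℝ, ∀ᶠ N : ℕ in Filter.atTop, L / k * Real.log (N / A) + C ≤ f N) :
    Filter.Tendsto (fun N : ℕ => f N / Real.log N) Filter.atTop (nhds L) := by
  have hlog : Filter.Tendsto (fun N : ℕ => Real.log N) Filter.atTop Filter.atTop :=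
    Real.tendsto_log_atTop.comp tendsto_natCast_atTop_atTop
  have hlim : ∀ B C : ℝ, Filter.Tendsto
      (fun N : ℕ => B * (Real.log (N / A) / Real.log N) + C / Real.log N) Filter.atTop (nhds B) := by
    intro B C
    simpa using ((tendsto_log_div_const hA).const_mul B).add (hlog.const_div_atTop C)
  have hself : ∀ᶠ k : ℝ in nhdsWithin 1 (Set.Ioi 1), k ∈ Set.Ioi (1 : ℝ) := self_mem_nhdsWithin
  rw [tendsto_order]
  constructor
  · intro a ha
    have hk : Filter.Tendsto (fun k : ℝ => L / k) (nhdsWithin 1 (Set.Ioi 1)) (nhds (L / 1)) :=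
      (tendsto_const_nhds.div Filter.tendsto_id one_ne_zero).mono_left nhdsWithin_le_nhds
    rw [div_one] at hk
    obtain ⟨k, hka, hk1⟩ := ((hk.eventually_const_lt ha).and hself).exists
    obtain ⟨C, hC⟩ := hlow k hk1
    filter_upwards [hC, (hlim (L / k) C).eventually_const_lt hka, hlog.eventually_gt_atTop 0]
      with N h1 h2 h3
    refine h2.trans_le ?_
    rw [← mul_div_assoc, ← add_div]
    gcongr
  · intro a ha
    have hk : Filter.Tendsto (fun k : ℝ => L * k) (nhdsWithin 1 (Set.Ioi 1)) (nhds (L * 1)) :=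
      (tendsto_const_nhds.mul Filter.tendsto_id).mono_left nhdsWithin_le_nhds
    rw [mul_one] at hk
    obtain ⟨k, hka, hk1⟩ := ((hk.eventually_lt_const ha).and hself).exists
    obtain ⟨C, hC⟩ := hup k hk1
    filter_upwards [hC, (hlim (L * k) C).eventually_lt_const hka, hlog.eventually_gt_atTop 0]
      with N h1 h2 h3
    refine lt_of_le_of_lt ?_ h2
    rw [← mul_div_assoc, ← add_div]
    gcongr

lemma IsDiscPolygon.tendsto_lintegral_edgeDensity (hP : IsDiscPolygon r P) (hr : 0 < r) :
    Filter.Tendsto (fun N : ℕ => (N / area P) ^ 2 * (∫⁻ c, edgeDensity r P N c).toReal / Real.log N)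
      Filter.atTop (nhds (2 / 3 * f₀ P)) := by
  have hA := hP.area_pos
  refine tendsto_of_log_bounds hA (fun k hk => ?_) (fun k hk => ?_)
  · obtain ⟨C, hC⟩ := hP.exists_lintegral_edgeDensity_le hr hk
    refine ⟨|C|, ?_⟩
    filter_upwards [tendsto_natCast_atTop_atTop.eventually_ge_atTop (area P)] with N hN
    have hN0 : (0 : ℝ) < N := hA.trans_le hN
    have hlog := Real.log_nonneg ((one_le_div hA).2 hN)
    have h1 : (∫⁻ c, edgeDensity r P N c).toReal ≤
        1 / (N / area P) ^ 2 * (2 / 3 * f₀ P * k * Real.log (N / area P) + |C|) := by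
      refine ENNReal.toReal_le_of_le_ofReal (by positivity) ((hC N hN).trans ?_)
      gcongr
      exact le_abs_self C
    calc _ ≤ (N / area P) ^ 2 * (1 / (N / area P) ^ 2 *
          (2 / 3 * f₀ P * k * Real.log (N / area P) + |C|)) := by gcongr
      _ = _ := by field_simp
  · obtain ⟨C, hC⟩ := hP.exists_le_lintegral_edgeDensity hr hk
    obtain ⟨C', hC'⟩ := hP.exists_lintegral_edgeDensity_le hr hk
    refine ⟨C, ?_⟩
    filter_upwards [tendsto_natCast_atTop_atTop.eventually_ge_atTop (area P)] with N hN
    have hN0 : (0 : ℝ) < N := hA.trans_le hN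
    have h1 := (ENNReal.ofReal_le_iff_le_toReal ((hC' N hN).trans_lt ENNReal.ofReal_lt_top).ne).1
      (hC N (by exact_mod_cast hN0))
    calc _ = (N / area P) ^ 2 * (1 / (N / area P) ^ 2 *
          (2 / 3 * f₀ P / k * Real.log (N / area P) + C)) := by field_simp
      _ ≤ _ := by gcongr

end Limits

/-! ### The Efron identities -/

section Expectation

variable {r : ℝ} {P : Set Plane}

/-- The probability that a random point of `P` is missed by the `r`-hull of `m` others. -/
def missProb (r : ℝ) (P : Set Plane) (m : ℕ) : ℝ :=
  ((ProbabilityTheory.cond volume P).prod (uniformSample P m)).real (missSet r m)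

lemma IsDiscPolygon.ae_mem_ball (hP : IsDiscPolygon r P) (hr : 0 < r) :
    ∀ᵐ x ∂ProbabilityTheory.cond volume P, x ∈ Metric.ball (supportCentre r P 0) r := by
  have h1 : ∀ᵐ x ∂ProbabilityTheory.cond volume P, x ∉ Metric.sphere (supportCentre r P 0) r :=
    measure_eq_zero_iff_ae_notMem.1 (ProbabilityTheory.cond_absolutelyContinuous
      (Measure.addHaar_sphere_of_ne_zero _ _ hr.ne'))
  filter_upwards [h1, ProbabilityTheory.ae_cond_mem hP.isCompact.measurableSet] with x hx hxP
  have h2 := hP.subset_closedBall hr 0 hxP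
  rw [← Metric.ball_union_sphere] at h2
  exact h2.resolve_right hx

lemma lintegral_cond_volume (f : Plane → ENNReal) :
    ∫⁻ x, f x ∂ProbabilityTheory.cond volume P = (volume P)⁻¹ * ∫⁻ x in P, f x := by
  rw [ProbabilityTheory.cond, lintegral_smul_measure, smul_eq_mul]

/-- The square of the area comes from normalising the two points of the pair; the exponent `m`
leaves out the other end of the first edge. -/
lemma IsDiscPolygon.missProb_succ (hP : IsDiscPolygon r P) (hr : 0 < r) (m : ℕ) :
    missProb r P (m + 1) =
      (m + 1) * ((∫⁻ c, edgeDensity r P m c).toReal / area P ^ 2) := by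
  have := hP.isProbabilityMeasure_cond
  have h := measure_missSet _ hr ProbabilityTheory.cond_absolutelyContinuous (hP.ae_mem_ball hr) m
  simp_rw [lintegral_cond_volume (P := P)] at h
  rw [lintegral_const_mul' _ _ (ENNReal.inv_ne_top.2 hP.volume_ne_zero), lintegral_pairs hr hP.isCompact.measurableSet
    (hP.subset_closedBall hr 0)
    ((measurable_measure_closedBall (ProbabilityTheory.cond volume P) r).pow_const m)] at h
  rw [missProb, Measure.real, uniformSample, h]
  simp only [edgeDensity, area, ENNReal.toReal_mul, ENNReal.toReal_inv]
  rw [← Nat.cast_succ, ENNReal.toReal_natCast]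
  push_cast
  ring

/-- Almost surely the number of vertices is a sum of `m + 1` indicators, one for each point missed
by the hull of the others, and all have the same probability. -/
lemma IsDiscPolygon.integral_f₀ (hP : IsDiscPolygon r P) (hr : 0 < r) (m : ℕ) :
    Integrable (fun x => (f₀ (rHull r (Set.range x)) : ℝ)) (uniformSample P (m + 1)) ∧
    ∫ x, (f₀ (rHull r (Set.range x)) : ℝ) ∂(uniformSample P (m + 1)) =
      (m + 1) * missProb r P m := by
  have := hP.isProbabilityMeasure_cond
  have : IsProbabilityMeasure (uniformSample P (m + 1)) := by unfold uniformSample; infer_instance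
  set S : Fin (m + 1) → Set (Fin (m + 1) → Plane) := fun i =>
    {x | x i ∉ rHull r (Set.range (i.removeNth x))} with hS
  have hSeq : ∀ i, S i = MeasurableEquiv.piFinSuccAbove (fun _ : Fin (m + 1) => Plane) i ⁻¹'
      missSet r m := fun i => rfl
  have hSm : ∀ i, MeasurableSet (S i) := fun i => by
    rw [hSeq]
    exact (MeasurableEquiv.measurable _) (measurableSet_missSet r m)
  have hSr : ∀ i, (uniformSample P (m + 1)).real (S i) = missProb r P m := fun i => by
    rw [missProb, Measure.real, Measure.real, hSeq, uniformSample, uniformSample,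
      (measurePreserving_piFinSuccAbove (fun _ : Fin (m + 1) =>
        ProbabilityTheory.cond volume P) i).measure_preimage_equiv]
  have hae : (fun x => (f₀ (rHull r (Set.range x)) : ℝ)) =ᵐ[uniformSample P (m + 1)]
      fun x => ∑ i, (S i).indicator (fun _ => (1 : ℝ)) x := by
    have h1 : ∀ᵐ x ∂uniformSample P (m + 1), ∀ i, x i ∈ Metric.ball (supportCentre r P 0) r := by
      rw [ae_all_iff]
      exact fun i => (measurePreserving_eval (fun _ : Fin (m + 1) =>
        ProbabilityTheory.cond volume P) i).quasiMeasurePreserving.ae (hP.ae_mem_ball hr)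
    have h2 : ∀ᵐ x ∂uniformSample P (m + 1), ∀ i j, i ≠ j → x i ≠ x j := by
      rw [ae_all_iff]
      intro i
      rw [ae_all_iff]
      intro j
      by_cases hij : i = j
      · simp [hij]
      have := ae_pi_pair_notMem (ProbabilityTheory.cond volume P) (S := {p | p.1 = p.2})
        (measurableSet_eq_fun measurable_fst measurable_snd) (fun a => ?_) hij
      · exact this.mono fun x hx _ => hx
      · refine ProbabilityTheory.cond_absolutelyContinuous ?_
        have : Prod.mk a ⁻¹' {p : Plane × Plane | p.1 = p.2} = {a} := by ext b; simp [eq_comm]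
        rw [this]
        exact measure_singleton a
    filter_upwards [h1, h2] with x hx1 hx2
    exact f₀_rHull_range hr (fun i j hij => by_contra fun hne => hx2 i j hne hij)
      (Set.range_subset_iff.2 hx1)
  have hint : ∀ i, Integrable ((S i).indicator fun _ => (1 : ℝ)) (uniformSample P (m + 1)) :=
    fun i => (integrable_const 1).indicator (hSm i)
  refine ⟨(integrable_finsetSum _ fun i _ => hint i).congr hae.symm, ?_⟩
  rw [integral_congr_ae hae, integral_finsetSum _ fun i _ => hint i]
  simp_rw [integral_indicator_const _ (hSm _), hSr]
  simp

/-- Relative missed area is the probability that one more independent uniform point is missed; the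
rest is Tonelli's theorem. -/
lemma IsDiscPolygon.integral_area (hP : IsDiscPolygon r P) (m : ℕ) :
    Integrable (fun x => area (P \ rHull r (Set.range x))) (uniformSample P m) ∧
    ∫ x, area (P \ rHull r (Set.range x)) ∂(uniformSample P m) = area P * missProb r P m := by
  have := hP.isProbabilityMeasure_cond
  have : IsProbabilityMeasure (uniformSample P m) := by unfold uniformSample; infer_instance
  have hS := measurableSet_missSet r m
  have heq : ∀ x : Fin m → Plane, area (P \ rHull r (Set.range x)) =
      area P * (ProbabilityTheory.cond volume P ((fun y => (y, x)) ⁻¹' missSet r m)).toReal := by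
    intro x
    have hA : (volume P).toReal ≠ 0 := hP.area_pos.ne'
    rw [ProbabilityTheory.cond_apply hP.isCompact.measurableSet, ENNReal.toReal_mul,
      ENNReal.toReal_inv, area, area, mul_inv_cancel_left₀ hA]
    rfl
  have hm : Measurable fun x : Fin m → Plane =>
      ProbabilityTheory.cond volume P ((fun y => (y, x)) ⁻¹' missSet r m) :=
    measurable_measure_prodMk_right hS
  have hint : Integrable (fun x : Fin m → Plane =>
      (ProbabilityTheory.cond volume P ((fun y => (y, x)) ⁻¹' missSet r m)).toReal)
      (uniformSample P m) := by
    refine Integrable.of_bound (C := 1) hm.ennreal_toReal.aestronglyMeasurable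
      (Filter.Eventually.of_forall fun x => ?_)
    rw [Real.norm_of_nonneg ENNReal.toReal_nonneg]
    exact ENNReal.toReal_le_of_le_ofReal zero_le_one (by simpa using prob_le_one)
  simp_rw [heq]
  refine ⟨hint.const_mul _, ?_⟩
  rw [integral_const_mul, integral_toReal hm.aemeasurable (Filter.Eventually.of_forall fun x =>
    measure_lt_top _ _), missProb, Measure.real, Measure.prod_apply_symm hS]

end Expectation

end

/-! ### Conclusion -/

theorem theorem1 (r : ℝ) (hr : 0 < r) (P : Set Plane) (hP : IsDiscPolygon r P) :
    (∀ n : ℕ, Integrable (fun x => (f₀ (rHull r (Set.range x)) : ℝ)) (uniformSample P n)) ∧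
    Filter.Tendsto
      (fun n : ℕ =>
        (∫ x, (f₀ (rHull r (Set.range x)) : ℝ) ∂(uniformSample P n)) / Real.log n)
      Filter.atTop (nhds (2 / 3 * f₀ P)) ∧
    (∀ n : ℕ, Integrable (fun x => area (P \ rHull r (Set.range x))) (uniformSample P n)) ∧
    Filter.Tendsto
      (fun n : ℕ =>
        n * (∫ x, area (P \ rHull r (Set.range x)) ∂(uniformSample P n)) / Real.log n)
      Filter.atTop (nhds (2 / 3 * f₀ P * area P)) := by
  have hA := hP.area_pos
  have := hP.isProbabilityMeasure_cond
  have hlim := hP.tendsto_lintegral_edgeDensity hr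
  have hratio : ∀ j : ℕ, Filter.Tendsto (fun N : ℕ => ((N + j : ℕ) : ℝ) / N) Filter.atTop (nhds 1) := by
    intro j
    have h : Filter.Tendsto (fun N : ℕ => 1 + (j : ℝ) / N) Filter.atTop (nhds (1 + 0)) :=
      tendsto_const_nhds.add (tendsto_const_div_atTop_nhds_zero_nat _)
    rw [add_zero] at h
    refine h.congr' ?_
    filter_upwards [Filter.eventually_gt_atTop 0] with N hN
    have : (N : ℝ) ≠ 0 := by exact_mod_cast hN.ne'
    push_cast
    field_simp
  have hlogN : Filter.Tendsto (fun N : ℕ => Real.log N) Filter.atTop Filter.atTop :=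
    Real.tendsto_log_atTop.comp tendsto_natCast_atTop_atTop
  have hlogratio : ∀ j : ℕ, Filter.Tendsto (fun N : ℕ => Real.log N / Real.log (N + j : ℕ))
      Filter.atTop (nhds 1) := by
    intro j
    have h1 := ((hratio j).log one_ne_zero).div_atTop hlogN
    have h2 := (tendsto_const_nhds (x := (1 : ℝ))).add h1
    have h3 := h2.inv₀ (by norm_num)
    rw [add_zero, inv_one] at h3
    refine h3.congr' ?_
    filter_upwards [hlogN.eventually_gt_atTop 0, Filter.eventually_gt_atTop 0] with N hN hN0
    have e1 : (N : ℝ) ≠ 0 := by exact_mod_cast hN0.ne'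
    have e2 : ((N + j : ℕ) : ℝ) ≠ 0 := by exact_mod_cast (by omega : N + j ≠ 0)
    rw [Real.log_div e2 e1, ← div_self hN.ne', ← add_div, add_sub_cancel, inv_div]
  refine ⟨fun n => ?_, ?_, fun n => (hP.integral_area n).1, ?_⟩
  · rcases n with _ | n
    -- Without points the hull is empty and the variable is constant.
    · have : IsProbabilityMeasure (uniformSample P 0) := by unfold uniformSample; infer_instance
      simp_rw [Set.range_eq_empty]
      exact integrable_const _
    · exact (hP.integral_f₀ hr n).1
  -- For `n = N + 2` the expectation is `(N + 2) * (N + 1)` times the integral of `edgeDensity r P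
  -- N`, divided by the squared area: an edge uses two points and leaves `N`.
  · rw [← Filter.tendsto_add_atTop_iff_nat 2]
    have h := ((hlim.mul (hratio 2)).mul (hratio 1)).mul (hlogratio 2)
    rw [mul_one, mul_one, mul_one] at h
    refine h.congr' ?_
    filter_upwards [hlogN.eventually_gt_atTop 0, Filter.eventually_gt_atTop 0] with N hN hN0
    have e1 : (N : ℝ) ≠ 0 := by exact_mod_cast hN0.ne'
    rw [show N + 2 = N + 1 + 1 from rfl, (hP.integral_f₀ hr (N + 1)).2, hP.missProb_succ hr]
    push_cast
    field_simp
  -- For `n = N + 1` the missed point is not in the sample, so only one point besides the `N` is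
  -- used; one factor `N + 1` comes from `missProb_succ`, the other from the factor `n`.
  · rw [← Filter.tendsto_add_atTop_iff_nat 1]
    have h := (((hlim.mul (hratio 1)).mul (hratio 1)).mul (hlogratio 1)).mul_const (area P)
    rw [mul_one, mul_one, mul_one] at h
    refine h.congr' ?_
    filter_upwards [hlogN.eventually_gt_atTop 0, Filter.eventually_gt_atTop 0] with N hN hN0
    have e1 : (N : ℝ) ≠ 0 := by exact_mod_cast hN0.ne'
    rw [(hP.integral_area (N + 1)).2, hP.missProb_succ hr]
    push_cast
    field_simp
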